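/- **Theorem (Error of the bilinear form).** *Geometry.* Let $\square=[0,1]^2$ and let $\Gamma=\bigcup_{i\le N}\Gamma_i$ be the boundary of a bounded open set $\Omega\subset\mathbb R^3$ with Lipschitz boundary, where $\Gamma_i=\boldsymbol F_i(\square)$, each $\boldsymbol F_i$ is real analytic in a neighbourhood of $\square$ (for instance a rational map with positive weights), injective on $\square$, with $\partial_1\boldsymbol F_i\times\partial_2\boldsymbol F_i\ne 0$ on $\square$, and where for $i\neq j$ no point $\boldsymbol F_i(\boldsymbol s)$ with $\boldsymbol s$ in the interior of $\square$ lies in $\Gamma_j$. Let $\mathrm d\sigma$ be the surface measure on $\Gamma$. Let $\boldsymbol H^0(\operatorname{div}_\Gamma,\Gamma)$ be the space of the complex tangential fields $\boldsymbol u\in\boldsymbol L^2(\Gamma)$ with weak surface divergence $\operatorname{div}_\Gamma\boldsymbol u\in L^2(\Gamma)$, with the norm $\|\boldsymbol u\|^2=\|\boldsymbol u\|_{\boldsymbol L^2(\Gamma)}^2+\|\operatorname{div}_\Gamma\boldsymbol u\|_{L^2(\Gamma)}^2$. *Bilinear form.* Let $\kappa>0$ and $G_\kappa(\boldsymbol z)=e^{i\kappa\|\boldsymbol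 z\|}/(4\pi\|\boldsymbol z\|)$. The electric single layer operator $\mathscr V_\kappa$ has the bilinear form $$\langle \mathscr V_\kappa\boldsymbol u,\boldsymbol v\rangle_\times=\int_\Gamma\!\int_\Gamma G_\kappa(\boldsymbol x-\boldsymbol y)\,\boldsymbol u(\boldsymbol x)\cdot\boldsymbol v(\boldsymbol y)\,\mathrm d\sigma_{\boldsymbol y}\mathrm d\sigma_{\boldsymbol x}-\frac1{\kappa^2}\int_\Gamma\!\int_\Gamma G_\kappa(\boldsymbol x-\boldsymbol y)\operatorname{div}_\Gamma\boldsymbol u(\boldsymbol x)\operatorname{div}_\Gamma\boldsymbol v(\boldsymbol y)\,\mathrm d\sigma_{\boldsymbol y}\mathrm d\sigma_{\boldsymbol x}.$$ *Compression.* For $0\le j\le m$ the clusters of level $j$ are the images $\Gamma_{\boldsymbol\lambda}$ under the $\boldsymbol F_i$ of the $4^j$ congruent dyadic subsquares of $\square$ of side $2^{-j}$; $\boldsymbol F_{\boldsymbol\lambda}:\square\to\Gamma_{\boldsymbol\lambda}$ is $\boldsymbol F_i$ composed with the affine map of $\square$ onto the subsquare. Fix $\eta\in(0,1)$. Two clusters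 of the same level are admissible if $\max\{\operatorname{diam}\Gamma_{\boldsymbol\lambda},\operatorname{diam}\Gamma_{\boldsymbol\lambda'}\}\le\eta\operatorname{dist}(\Gamma_{\boldsymbol\lambda},\Gamma_{\boldsymbol\lambda'})$. The far-field consists of the admissible blocks $\Gamma_{\boldsymbol\lambda}\times\Gamma_{\boldsymbol\lambda'}$ of levels $0,\dots,m$ whose father block, if there is one, is not admissible; the near-field consists of the non-admissible blocks of level $m$. For each $q$ let $x^{(q)}_0,\dots,x^{(q)}_q\in[0,1]$ be distinct points such that the Lebesgue constants $\Lambda_q=\max_{s\in[0,1]}\sum_{k}|L^{(q)}_k(s)|$ of their Lagrange basis polynomials $L_k^{(q)}$ grow subexponentially, i.e. for every $\rho>1$ there is $A$ with $\Lambda_q\le A\rho^q$ for all $q$ (for instance Chebyshev points). Let $\mathscr V_{\kappa,q}$ be the operator whose bilinear form results when, in every far-field block, the localized kernel $G_\kappa(\boldsymbol F_{\boldsymbol\lambda}(\boldsymbol s)-\boldsymbol F_{\boldsymbol\lambda'}(\boldsymbol t))$ on $\square\times\square$ is replaced in both summands by its tensor product interpolant of degree $q$ in each variable, while it is kept exactly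 in the near-field. *Claim.* There are constants $c_0,C>0$ which depend only on the parametrization of $\Gamma$, on $\kappa$, on $\eta$ and on the family of interpolation points, such that for all $\sigma>0$, all $m\ge0$, all $q\ge1$ with $q\ge c_0(\sigma+1)m$, and all $\boldsymbol u,\boldsymbol v\in\boldsymbol H^0(\operatorname{div}_\Gamma,\Gamma)$ $$\big|\langle \mathscr V_\kappa\boldsymbol u,\boldsymbol v\rangle_\times-\langle \mathscr V_{\kappa,q}\boldsymbol u,\boldsymbol v\rangle_\times\big|\le C\,2^{-m\sigma}\,\|\boldsymbol u\|_{\boldsymbol H^0(\operatorname{div}_\Gamma,\Gamma)}\|\boldsymbol v\|_{\boldsymbol H^0(\operatorname{div}_\Gamma,\Gamma)}.$$ The same estimate holds for the variant of $\mathscr V_{\kappa,q}$ in which, in the first summand, the kernels including the geometry, $G_\kappa(\boldsymbol F_{\boldsymbol\lambda}(\boldsymbol s)-\boldsymbol F_{\boldsymbol\lambda'}(\boldsymbol t))\,\langle\partial_\alpha\boldsymbol F_{\boldsymbol\lambda}(\boldsymbol s),\partial_\beta\boldsymbol F_{\boldsymbol\lambda'}(\boldsymbol t)\rangle$, $\alpha,\beta\in\{1,2\}$,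 are interpolated; they act on the components of the pull-backs $\hat{\boldsymbol u},\hat{\boldsymbol v}$ defined by $\sum_\alpha\hat u_\alpha\,\partial_\alpha\boldsymbol F_{\boldsymbol\lambda}=\|\partial_1\boldsymbol F_{\boldsymbol\lambda}\times\partial_2\boldsymbol F_{\boldsymbol\lambda}\|\;\boldsymbol u\circ\boldsymbol F_{\boldsymbol\lambda}$ and likewise, with $\boldsymbol\lambda'$, for $\hat{\boldsymbol v}$. -/

import Mathlib

open MeasureTheory Set
open scoped ContDiff RealInnerProductSpace

noncomputable section

namespace EFIE

/-- Euclidean space `ℝ³`. -/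
abbrev R3 : Type := EuclideanSpace ℝ (Fin 3)

/-- The space `ℂ³` in which surface currents take their values. -/
abbrev C3 : Type := EuclideanSpace ℂ (Fin 3)

/-- The parameter plane, which contains the reference domain. -/
abbrev R2 : Type := Fin 2 → ℝ

/-- The reference domain, the closed unit square `[0,1]²`. -/
def unitSquare : Set R2 := Icc 0 1

/-! ### Parametrized surfaces -/

/-- The partial derivative `∂_α f (s)` of a parametrization. -/
def partialD (f : R2 → R3) (α : Fin 2) (s : R2) : R3 :=
  fderiv ℝ f s (Pi.single α 1)

/-- The (non-normalized) normal vector `∂₁f (s) × ∂₂f (s)`. -/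
def normalVec (f : R2 → R3) (s : R2) : R3 :=
  WithLp.toLp 2 (crossProduct (partialD f 0 s).ofLp (partialD f 1 s).ofLp)

/-- The surface element `τ(s) = ‖∂₁f (s) × ∂₂f (s)‖`. -/
def surfElt (f : R2 → R3) (s : R2) : ℝ := ‖normalVec f s‖

/-- `Ω` has a Lipschitz boundary: near each boundary point, and in suitable Cartesian coordinates,
`Ω` is the set of the points above the graph of a Lipschitz function. -/
def HasLipschitzBoundary (Ω : Set R3) : Prop :=
  ∀ x ∈ frontier Ω, ∃ (e : R3 ≃ᵢ R3) (φ : EuclideanSpace ℝ (Fin 2) → ℝ) (K : NNReal) (r : ℝ),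
    LipschitzWith K φ ∧ 0 < r ∧
      ∀ y ∈ Metric.ball x r, (y ∈ Ω ↔ φ !₂[e y 0, e y 1] < e y 2)

/-- The patches `F i (unitSquare)` form the boundary of the bounded Lipschitz set `Ω`. Each `F i` is
analytic up to the boundary of the square, non-singular and invertible onto its patch, and different
patches meet only in boundary points of the patches. -/
structure IsMultipatchBoundary {N : ℕ} (F : Fin N → R2 → R3) (Ω : Set R3) : Prop where
  isOpen : IsOpen Ω
  isBounded : Bornology.IsBounded Ω
  lipschitz : HasLipschitzBoundary Ω
  frontier_eq : frontier Ω = ⋃ i, F i '' unitSquare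
  analytic : ∀ i, AnalyticOnNhd ℝ (F i) unitSquare
  injective : ∀ i, InjOn (F i) unitSquare
  regular : ∀ i, ∀ s ∈ unitSquare, normalVec (F i) s ≠ 0
  overlap : ∀ i j, i ≠ j → ∀ s ∈ interior unitSquare, ∀ t ∈ unitSquare, F i s ≠ F j t

/-- The surface measure on `Γ = ⋃ i, F i '' unitSquare`, as a measure on `ℝ³`. -/
def surfaceMeasure {N : ℕ} (F : Fin N → R2 → R3) : Measure R3 :=
  ∑ i, Measure.map (F i)
    ((volume.restrict unitSquare).withDensity fun s => ENNReal.ofReal (surfElt (F i) s))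

/-! ### The space `H⁰(div_Γ, Γ)` -/

/-- An element of `H⁰(div_Γ, Γ)`: a square integrable tangential field `toFun` on `Γ` with a square
integrable weak surface divergence `div`. For a tangential field `u` one has
`u ⬝ ∇φ = u ⬝ ∇_Γ φ` on `Γ`, so the last condition is `∫_Γ u ⬝ ∇_Γ φ = - ∫_Γ (div_Γ u) φ`; it
determines `div` almost everywhere. -/
structure HDiv {N : ℕ} (F : Fin N → R2 → R3) where
  toFun : R3 → C3
  div : R3 → ℂ
  memLp_toFun : MemLp toFun 2 (surfaceMeasure F)
  memLp_div : MemLp div 2 (surfaceMeasure F)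
  tangential : ∀ i, ∀ᵐ s ∂(volume.restrict unitSquare),
    ∑ k, ((normalVec (F i) s k : ℝ) : ℂ) * toFun (F i s) k = 0
  integral_grad : ∀ φ : R3 → ℝ, ContDiff ℝ ∞ φ →
    ∫ x, ∑ k, toFun x k * ((fderiv ℝ φ x (EuclideanSpace.single k 1) : ℝ) : ℂ)
        ∂(surfaceMeasure F) =
      - ∫ x, div x * ((φ x : ℝ) : ℂ) ∂(surfaceMeasure F)

/-- The norm of `H⁰(div_Γ, Γ)`. -/
def HDiv.norm {N : ℕ} {F : Fin N → R2 → R3} (u : HDiv F) : ℝ :=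
  Real.sqrt ((∫ x, ‖u.toFun x‖ ^ 2 ∂(surfaceMeasure F)) + ∫ x, ‖u.div x‖ ^ 2 ∂(surfaceMeasure F))

/-- The bilinear (not sesquilinear) product on `ℂ³`. -/
def bdot (a b : C3) : ℂ := ∑ k, a k * b k

/-! ### The bilinear form of the electric single layer operator -/

/-- The Helmholtz fundamental solution `e^{iκ‖z‖} / (4π‖z‖)`. -/
def helmholtz (κ : ℝ) (z : R3) : ℂ :=
  Complex.exp (Complex.I * κ * ‖z‖) / (4 * Real.pi * ‖z‖)

/-- The bilinear form of the electric single layer operator. -/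
def singleLayerForm {N : ℕ} (κ : ℝ) {F : Fin N → R2 → R3} (u v : HDiv F) : ℂ :=
  (∫ x, ∫ y, helmholtz κ (x - y) * bdot (u.toFun x) (v.toFun y)
      ∂(surfaceMeasure F) ∂(surfaceMeasure F)) -
    1 / (κ : ℂ) ^ 2 *
      ∫ x, ∫ y, helmholtz κ (x - y) * (u.div x * v.div y) ∂(surfaceMeasure F) ∂(surfaceMeasure F)

/-! ### Cluster tree and block-cluster tree -/

/-- A cluster of level `j`: the index of a patch and the position of a square in the grid of the
`2^j × 2^j` congruent subsquares of the reference domain. -/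
abbrev Cluster (N j : ℕ) : Type := Fin N × (Fin 2 → Fin (2 ^ j))

/-- The cluster of level `j` that contains a given cluster of level `j + 1`. -/
def dad {N j : ℕ} (l : Cluster N (j + 1)) : Cluster N j :=
  (l.1, fun a => ⟨(l.2 a : ℕ) / 2,
    by have h := (l.2 a).isLt; have h2 := pow_succ 2 j; omega⟩)

/-- The parametrization `F_λ` of the cluster `λ` over the reference domain: the parametrization of
the patch, combined with the affine map of the reference domain onto the subsquare. -/
def clusterMap {N j : ℕ} (F : Fin N → R2 → R3) (l : Cluster N j) (s : R2) : R3 :=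
  F l.1 fun a => (((l.2 a : ℕ) : ℝ) + s a) / 2 ^ j

/-- The region `Γ_λ` of the surface. -/
def clusterSet {N j : ℕ} (F : Fin N → R2 → R3) (l : Cluster N j) : Set R3 :=
  clusterMap F l '' unitSquare

/-- The distance of two sets. -/
def setDist (A B : Set R3) : ℝ := sInf (image2 dist A B)

/-- The admissibility condition. -/
def Admissible {N j : ℕ} (F : Fin N → R2 → R3) (η : ℝ) (l l' : Cluster N j) : Prop :=
  max (Metric.diam (clusterSet F l)) (Metric.diam (clusterSet F l')) ≤
    η * setDist (clusterSet F l) (clusterSet F l')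

/-- The block belongs to the far-field: it is admissible, and its father, if it has one, is not. -/
def IsFar {N : ℕ} (F : Fin N → R2 → R3) (η : ℝ) : (j : ℕ) → Cluster N j → Cluster N j → Prop
  | 0, l, l' => Admissible F η l l'
  | _ + 1, l, l' => Admissible F η l l' ∧ ¬ Admissible F η (dad l) (dad l')

open Classical in
/-- The sum of `f` over the far-field blocks of the block-cluster tree with finest level `m`. -/
def farSum {N : ℕ} (F : Fin N → R2 → R3) (η : ℝ) (m : ℕ)
    (f : (j : ℕ) → Cluster N j → Cluster N j → ℂ) : ℂ :=
  ∑ j ∈ Finset.range (m + 1), ∑ l : Cluster N j, ∑ l' : Cluster N j,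
    if IsFar F η j l l' then f j l l' else 0

open Classical in
/-- The sum of `f` over the near-field, i.e. over the non-admissible blocks of finest level `m`. -/
def nearSum {N : ℕ} (F : Fin N → R2 → R3) (η : ℝ) (m : ℕ)
    (f : Cluster N m → Cluster N m → ℂ) : ℂ :=
  ∑ l : Cluster N m, ∑ l' : Cluster N m, if Admissible F η l l' then 0 else f l l'

/-! ### Interpolation of the localized kernel -/

/-- The localized kernel function on the product of the reference domain with itself. -/
def locKernel {N j : ℕ} (κ : ℝ) (F : Fin N → R2 → R3) (l l' : Cluster N j) (s t : R2) : ℂ :=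
  helmholtz κ (clusterMap F l s - clusterMap F l' t)

/-- The value at `s` of the Lagrange basis polynomial `L_m` to the points `x₀, …, x_q`. -/
def lagr {q : ℕ} (x : Fin (q + 1) → ℝ) (m : Fin (q + 1)) (s : ℝ) : ℝ :=
  (Lagrange.basis Finset.univ x m).eval s

/-- The tensor product basis polynomial `L_{m₁}(s₁) L_{m₂}(s₂)`. -/
def tensorLagr {q : ℕ} (x : Fin (q + 1) → ℝ) (m : Fin 2 → Fin (q + 1)) (s : R2) : ℝ :=
  ∏ a, lagr x (m a) (s a)

/-- The tensor product interpolant of a kernel on the product of the reference domain with itself,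
of degree `q` in each of the four variables. -/
def interp {q : ℕ} (x : Fin (q + 1) → ℝ) (K : R2 → R2 → ℂ) (s t : R2) : ℂ :=
  ∑ m : Fin 2 → Fin (q + 1), ∑ m' : Fin 2 → Fin (q + 1),
    K (fun a => x (m a)) (fun a => x (m' a)) * ((tensorLagr x m s * tensorLagr x m' t : ℝ) : ℂ)

/-- A family of interpolation points, `q + 1` distinct points of `[0,1]` for each degree `q`, whose
Lebesgue constants grow subexponentially. -/
structure IsInterpolationFamily (x : (q : ℕ) → Fin (q + 1) → ℝ) : Prop where
  mem : ∀ q m, x q m ∈ Icc (0 : ℝ) 1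
  injective : ∀ q, Function.Injective (x q)
  lebesgue : ∀ ρ : ℝ, 1 < ρ → ∃ A : ℝ, ∀ q : ℕ, ∀ s ∈ Icc (0 : ℝ) 1,
    ∑ m, |lagr (x q) m s| ≤ A * ρ ^ q

/-! ### The compressed bilinear forms -/

/-- The contribution of the block `Γ_λ × Γ_λ'` to the first summand of the bilinear form, pulled back
to the reference domain, when the kernel there is `K`. -/
def currentBlock {N j : ℕ} {F : Fin N → R2 → R3} (K : R2 → R2 → ℂ) (l l' : Cluster N j)
    (u v : HDiv F) : ℂ :=
  ∫ s in unitSquare, ∫ t in unitSquare,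
    K s t * bdot (u.toFun (clusterMap F l s)) (v.toFun (clusterMap F l' t)) *
      ((surfElt (clusterMap F l) s * surfElt (clusterMap F l') t : ℝ) : ℂ)

/-- The same for the double integral in the second summand. -/
def chargeBlock {N j : ℕ} {F : Fin N → R2 → R3} (K : R2 → R2 → ℂ) (l l' : Cluster N j)
    (u v : HDiv F) : ℂ :=
  ∫ s in unitSquare, ∫ t in unitSquare,
    K s t * (u.div (clusterMap F l s) * v.div (clusterMap F l' t)) *
      ((surfElt (clusterMap F l) s * surfElt (clusterMap F l') t : ℝ) : ℂ)

/-- The contribution of a block to the bilinear form. -/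
def blockForm {N j : ℕ} (κ : ℝ) {F : Fin N → R2 → R3} (K : R2 → R2 → ℂ) (l l' : Cluster N j)
    (u v : HDiv F) : ℂ :=
  currentBlock K l l' u v - 1 / (κ : ℂ) ^ 2 * chargeBlock K l l' u v

/-- The bilinear form of the compressed operator: the kernel is interpolated in the far-field blocks
and exact in all other blocks. -/
def compressedForm {N q : ℕ} (κ η : ℝ) (m : ℕ) (x : Fin (q + 1) → ℝ) {F : Fin N → R2 → R3}
    (u v : HDiv F) : ℂ :=
  farSum F η m (fun _ l l' => blockForm κ (interp x (locKernel κ F l l')) l l' u v) +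
    nearSum F η m (fun l l' => blockForm κ (locKernel κ F l l') l l' u v)

/-- The pull-back `τ (dfᵀ df)⁻¹ dfᵀ (w ∘ f)` of a tangential field `w` to the reference domain; it
satisfies `∑ α, pullback f w s α • ∂_α f (s) = τ(s) • w (f s)`. -/
def pullback (f : R2 → R3) (w : R3 → C3) (s : R2) : Fin 2 → ℂ :=
  let gram : Matrix (Fin 2) (Fin 2) ℝ := Matrix.of fun α β => ⟪partialD f α s, partialD f β s⟫
  fun α => (surfElt f s : ℂ) * ∑ β, ((gram⁻¹ α β : ℝ) : ℂ) *
    ∑ k, ((partialD f β s k : ℝ) : ℂ) * w (f s) k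

/-- The contribution of the block `Γ_λ × Γ_λ'` to the first summand of the bilinear form when the
kernels `G_{κ,λ,λ'}(s,t) ⟨∂_α F_λ(s), ∂_β F_λ'(t)⟩`, which include the geometry, are interpolated. -/
def currentBlockGeo {N j q : ℕ} (κ : ℝ) (x : Fin (q + 1) → ℝ) {F : Fin N → R2 → R3}
    (l l' : Cluster N j) (u v : HDiv F) : ℂ :=
  ∑ α : Fin 2, ∑ β : Fin 2, ∫ s in unitSquare, ∫ t in unitSquare,
    interp x (fun s t => locKernel κ F l l' s t *
        ((⟪partialD (clusterMap F l) α s, partialD (clusterMap F l') β t⟫ : ℝ) : ℂ)) s t *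
      (pullback (clusterMap F l) u.toFun s α * pullback (clusterMap F l') v.toFun t β)

/-- The bilinear form of the compressed operator when in the first summand the geometry is included
into the kernel that is interpolated. -/
def compressedFormGeo {N q : ℕ} (κ η : ℝ) (m : ℕ) (x : Fin (q + 1) → ℝ) {F : Fin N → R2 → R3}
    (u v : HDiv F) : ℂ :=
  farSum F η m (fun _ l l' => currentBlockGeo κ x l l' u v -
      1 / (κ : ℂ) ^ 2 * chargeBlock (interp x (locKernel κ F l l')) l l' u v) +
    nearSum F η m (fun l l' => blockForm κ (locKernel κ F l l') l l' u v)

end EFIE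

end

open MeasureTheory Set
open scoped ContDiff RealInnerProductSpace

noncomputable section

namespace EFIE

/-! ### Chebyshev approximation of holomorphic functions -/

/-! The near-field is not altered, so the error is a finite sum over far-field blocks, each of which
contributes the interpolation error of its kernel. For this the exact form is split along the same
blocks (`singleLayerForm_eq`). The weakly singular double integrals converge absolutely, because the
potential of `‖x - y‖⁻¹` is bounded on the surface (`integrable_of_weakly_singular`). The levels fit
together because the surface measure of a cluster is the sum of those of its sons, and because the
sons of an admissible block are admissible (`farSum_add_nearSum`).

The analytic core is a uniform exponential rate on admissible blocks. A real analytic patch extends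
holomorphically along coordinate lines to a complex neighbourhood of the unit interval, of a radius
that does not depend on the line (`exists_lineExt`). On an admissible block of level `j` the points
keep a distance of order `2⁻ʲ`, and one parameter direction moves the point along an arc of a
coordinate line of parameter length `2⁻ʲ`. Hence a complex perturbation of the local parameter by a
fixed small amount changes the difference vector only by a small fraction of its length. The
bilinear square of that vector stays in the right half-plane, and the kernel extends to a
neighbourhood whose radius `δ` is the same on all levels, with a bound of order `2ʲ`
(`exists_kernel_extension`).

A function that is holomorphic and bounded on such a neighbourhood has an exponentially convergent
Chebyshev expansion (`exists_chebyshev_approx`). Lagrange interpolation is then worse only by the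
factor `1 + Λ`, and tensor products cost further powers of `Λ` (`norm_interp_sub_le`). The kernel
error on a block is therefore at most `B 2ʲ (1+δ)⁻q Λ⁴`. Integrated against `L²` densities on a
surface of finite measure, it bounds the error of the block (`exists_block_error`). For the kernels
with geometry, the exact block is first rewritten with the pull-backs, which recover tangential
fields (`sum_pullback_mul`).

All remaining losses (powers of the mesh size, the number of blocks, the number of levels) are of
the form `const ^ m` and are estimated generously. Since the Lebesgue constants grow
subexponentially, `Λ⁴` uses up only part of the decay, and a degree `q` proportional to `(σ + 1) m`
compensates every power of `m` and leaves `2^(-mσ)` (`inv_pow_mul_pow_le`). -/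

/-- The complex `δ`-neighbourhood of the unit interval. -/
def segNhd (δ : ℝ) : Set ℂ := {z | ∃ x ∈ Icc (0 : ℝ) 1, ‖z - x‖ < δ}

lemma segNhd_eq_iUnion (δ : ℝ) :
    segNhd δ = ⋃ x ∈ Icc (0 : ℝ) 1, Metric.ball (x : ℂ) δ := by
  ext z
  simp [segNhd, dist_eq_norm]

lemma isOpen_segNhd (δ : ℝ) : IsOpen (segNhd δ) := by
  rw [segNhd_eq_iUnion]
  exact isOpen_biUnion fun _ _ => Metric.isOpen_ball

lemma ofReal_mem_segNhd {δ : ℝ} (hδ : 0 < δ) {x : ℝ} (hx : x ∈ Icc (0 : ℝ) 1) :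
    (x : ℂ) ∈ segNhd δ := ⟨x, hx, by simpa using hδ⟩

lemma segNhd_mono {δ δ' : ℝ} (h : δ ≤ δ') : segNhd δ ⊆ segNhd δ' :=
  fun _ ⟨x, hx, hz⟩ => ⟨x, hx, hz.trans_le h⟩

/-- The Joukowski map, which maps the unit circle onto the unit interval. -/
def joukowski (w : ℂ) : ℂ := 1 / 2 + (w + w⁻¹) / 4

/-- With `w = r u` and `|u| = 1`, the image of `u` is the point `(1 + Re u) / 2` of the unit
interval. The image of `w` differs from it by `((r - 1) u + (r⁻¹ - 1) u⁻¹) / 4`, of modulus at most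
`(r - 1) / 2`. Thus the closed annulus of width `δ` lands in the domain of holomorphy. -/
lemma joukowski_mem_segNhd {δ : ℝ} (hδ : 0 < δ) {w : ℂ} (h1 : 1 ≤ ‖w‖) (h2 : ‖w‖ ≤ 1 + δ) :
    joukowski w ∈ segNhd δ := by
  have hr : 0 < ‖w‖ := by linarith
  set r : ℝ := ‖w‖ with hrdef
  set u : ℂ := w / r with hu
  have hrc : (r : ℂ) ≠ 0 := by exact_mod_cast hr.ne'
  have hun : ‖u‖ = 1 := by
    rw [hu, norm_div, Complex.norm_real, Real.norm_of_nonneg hr.le, ← hrdef, div_self hr.ne']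
  have hw : w = r * u := by rw [hu]; field_simp
  have hu0 : u ≠ 0 := by intro h; simp [h] at hun
  have huinv : u⁻¹ = (starRingEnd ℂ) u := by
    rw [Complex.inv_def, Complex.normSq_eq_norm_sq, hun]; simp
  have hre : |u.re| ≤ 1 := hun ▸ Complex.abs_re_le_norm u
  have hsum : u + u⁻¹ = 2 * (u.re : ℂ) := by
    rw [huinv, Complex.add_conj]; push_cast; ring
  refine ⟨1 / 2 + u.re / 2, ⟨by linarith [(abs_le.1 hre).1], by linarith [(abs_le.1 hre).2]⟩, ?_⟩
  have key : joukowski w - ((1 / 2 + u.re / 2 : ℝ) : ℂ) =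
      (((r - 1 : ℝ) : ℂ) * u + ((r⁻¹ - 1 : ℝ) : ℂ) * u⁻¹) / 4 := by
    have : (u.re : ℂ) = (u + u⁻¹) / 2 := by rw [hsum]; ring
    rw [joukowski]
    push_cast
    rw [this, hw, mul_inv]
    ring
  rw [key, norm_div]
  have hle : r⁻¹ ≤ 1 := inv_le_one_of_one_le₀ h1
  have hge : 1 - r⁻¹ ≤ r - 1 := by
    have : 2 ≤ r + r⁻¹ := by
      have := mul_inv_cancel₀ hr.ne'
      nlinarith [sq_nonneg (r - 1), inv_pos.2 hr]
    linarith
  have h3 : ‖((r - 1 : ℝ) : ℂ) * u + ((r⁻¹ - 1 : ℝ) : ℂ) * u⁻¹‖ ≤ (r - 1) + (1 - r⁻¹) := by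
    refine (norm_add_le _ _).trans ?_
    rw [norm_mul, norm_mul, norm_inv, hun, Complex.norm_real, Complex.norm_real,
      Real.norm_of_nonneg (by linarith), Real.norm_of_nonpos (by linarith)]
    simp
  have h4 : ‖(4 : ℂ)‖ = 4 := by simp
  rw [h4]
  linarith

lemma joukowski_exp (θ : ℝ) :
    joukowski (Complex.exp (θ * Complex.I)) = ((1 / 2 + Real.cos θ / 2 : ℝ) : ℂ) := by
  rw [joukowski, ← Complex.exp_neg]
  push_cast
  rw [Complex.cos, neg_mul]
  ring

lemma differentiableAt_joukowski {w : ℂ} (hw : w ≠ 0) : DifferentiableAt ℂ joukowski w := by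
  unfold joukowski
  fun_prop (disch := assumption)

/-- The trigonometric coefficients of a function that is holomorphic near the unit interval decay
exponentially. -/
lemma norm_integral_joukowski_le {δ M : ℝ} (hδ : 0 < δ) {Φ : ℂ → ℂ}
    (hd : DifferentiableOn ℂ Φ (segNhd δ)) (hM : ∀ z ∈ segNhd δ, ‖Φ z‖ ≤ M) (n : ℕ) :
    ‖∫ θ in (0 : ℝ)..2 * Real.pi, Complex.exp (-(n * (θ * Complex.I))) *
        Φ (joukowski (Complex.exp (θ * Complex.I)))‖ ≤ 2 * Real.pi * (M * (1 + δ)⁻¹ ^ n) := by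
  set h : ℂ → ℂ := fun w => (w ^ n)⁻¹ * Φ (joukowski w) with hh
  have hdiff : ∀ w : ℂ, 1 ≤ ‖w‖ → ‖w‖ ≤ 1 + δ → DifferentiableAt ℂ h w := by
    intro w h1 h2
    have hw : w ≠ 0 := by intro h0; simp [h0] at h1; linarith
    have hmem := joukowski_mem_segNhd hδ h1 h2
    have hΦ : DifferentiableAt ℂ Φ (joukowski w) := hd.differentiableAt ((isOpen_segNhd δ).mem_nhds hmem)
    exact ((differentiableAt_id.pow n).inv (pow_ne_zero n hw)).mul
      (hΦ.comp w (differentiableAt_joukowski hw))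
  -- Cauchy's theorem on the annulus moves the contour from the unit circle to the circle of radius
  -- `1 + δ`, where the factor `w⁻ⁿ` supplies the decay.
  have heq := Complex.circleIntegral_sub_center_inv_smul_eq_of_differentiable_on_annulus_off_countable
    (c := 0) (r := 1) (R := 1 + δ) one_pos (by linarith) (f := h) countable_empty
    (fun w hw => (hdiff w (by simpa using hw.2) (by simpa using hw.1)).continuousAt.continuousWithinAt)
    (fun w hw => hdiff w (by have := hw.1.2; simp at this; exact this.le)
      (by have := hw.1.1; simp at this; exact this.le))
  have hleft : (∮ z in C(0, 1), (z - 0)⁻¹ • h z) = Complex.I *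
      ∫ θ in (0 : ℝ)..2 * Real.pi, Complex.exp (-(n * (θ * Complex.I))) *
        Φ (joukowski (Complex.exp (θ * Complex.I))) := by
    rw [circleIntegral, ← intervalIntegral.integral_const_mul]
    congr 1
    ext θ
    have hne := Complex.exp_ne_zero (θ * Complex.I)
    simp only [deriv_circleMap, circleMap, hh, smul_eq_mul, Complex.ofReal_one, one_mul, zero_add,
      sub_zero]
    rw [← Complex.exp_nat_mul]
    simp only [Complex.exp_neg]
    field_simp
  have hbound : ‖∮ z in C(0, 1 + δ), (z - 0)⁻¹ • h z‖ ≤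
      2 * Real.pi * (1 + δ) * ((1 + δ)⁻¹ * ((1 + δ)⁻¹ ^ n * M)) := by
    refine circleIntegral.norm_integral_le_of_norm_le_const (by linarith) fun z hz => ?_
    have hz' : ‖z‖ = 1 + δ := by simpa using hz
    rw [norm_smul, sub_zero, norm_inv, hz', hh, norm_mul, norm_inv, norm_pow, hz', inv_pow]
    gcongr
    exact hM _ (joukowski_mem_segNhd hδ (by linarith) hz'.le)
  rw [← heq] at hleft
  have := congrArg norm hleft
  rw [norm_mul, Complex.norm_I, one_mul] at this
  rw [← this]
  refine hbound.trans (le_of_eq ?_)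
  field_simp

/-- Composition with the Joukowski map turns `Φ` into an even function on the circle. Its Fourier
series is a cosine series, which in the variable `cos θ = 2x - 1` is a Chebyshev series. The
coefficients decay like `(1+δ)⁻ⁿ`, and truncation leaves a geometric tail. -/
lemma exists_chebyshev_approx {δ M : ℝ} (hδ : 0 < δ) {Φ : ℂ → ℂ}
    (hd : DifferentiableOn ℂ Φ (segNhd δ)) (hM : ∀ z ∈ segNhd δ, ‖Φ z‖ ≤ M) (q : ℕ) :
    ∃ c : ℕ → ℂ, ∀ x ∈ Icc (0 : ℝ) 1,
      ‖Φ x - ∑ n ∈ Finset.range (q + 1),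
        c n * (((Polynomial.Chebyshev.T ℝ n).eval (2 * x - 1) : ℝ) : ℂ)‖ ≤
          2 * M / δ * (1 + δ)⁻¹ ^ q := by
  have : Fact (0 < 2 * Real.pi) := ⟨Real.two_pi_pos⟩
  set r : ℝ := (1 + δ)⁻¹ with hr
  have hr0 : 0 < r := by positivity
  have hr1 : r < 1 := inv_lt_one_of_one_lt₀ (by linarith)
  have hmem : ∀ z : Circle, joukowski (z : ℂ) ∈ segNhd δ := fun z =>
    joukowski_mem_segNhd hδ (Circle.norm_coe z).ge (by rw [Circle.norm_coe]; linarith)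
  let g : C(AddCircle (2 * Real.pi), ℂ) :=
    ⟨fun t => Φ (joukowski (AddCircle.toCircle t : ℂ)), by
      refine continuous_iff_continuousAt.2 fun t => ?_
      have h1 : ContinuousAt Φ (joukowski (AddCircle.toCircle t : ℂ)) :=
        (hd.differentiableAt ((isOpen_segNhd δ).mem_nhds (hmem _))).continuousAt
      have h2 : ContinuousAt joukowski (AddCircle.toCircle t : ℂ) :=
        (differentiableAt_joukowski (Circle.coe_ne_zero _)).continuousAt
      have h3 : ContinuousAt (fun t : AddCircle (2 * Real.pi) => (AddCircle.toCircle t : ℂ)) t :=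
        (continuous_subtype_val.comp AddCircle.continuous_toCircle).continuousAt
      exact ContinuousAt.comp (f := fun t : AddCircle (2 * Real.pi) =>
        joukowski (AddCircle.toCircle t : ℂ)) h1 (ContinuousAt.comp (f := fun t :
          AddCircle (2 * Real.pi) => (AddCircle.toCircle t : ℂ)) h2 h3)⟩
  have hgθ : ∀ θ : ℝ, g (θ : AddCircle (2 * Real.pi)) =
      Φ (joukowski (Complex.exp (θ * Complex.I))) := by
    intro θ
    have h1 : 2 * Real.pi / (2 * Real.pi) * θ = θ := by field_simp
    change Φ (joukowski (AddCircle.toCircle (θ : AddCircle (2 * Real.pi)) : ℂ)) = _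
    rw [AddCircle.toCircle_apply_mk, h1, Circle.coe_exp]
  have hfour : ∀ (n : ℤ) (θ : ℝ), fourier n (θ : AddCircle (2 * Real.pi)) =
      Complex.exp (n * (θ * Complex.I)) := by
    intro n θ
    rw [fourier_coe_apply]
    congr 1
    have : (Real.pi : ℂ) ≠ 0 := by exact_mod_cast Real.pi_ne_zero
    push_cast
    field_simp
  have hcoef : ∀ n : ℕ, ‖fourierCoeff g n‖ ≤ M * r ^ n := by
    intro n
    rw [fourierCoeff_eq_intervalIntegral _ _ 0, zero_add, norm_smul]
    have h1 := norm_integral_joukowski_le hδ hd hM n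
    have h2 : (∫ x in (0 : ℝ)..2 * Real.pi, fourier (-(n : ℤ)) (x : AddCircle (2 * Real.pi)) •
        g (x : AddCircle (2 * Real.pi))) = ∫ θ in (0 : ℝ)..2 * Real.pi,
        Complex.exp (-(n * (θ * Complex.I))) * Φ (joukowski (Complex.exp (θ * Complex.I))) := by
      congr 1
      ext θ
      rw [hgθ, hfour, smul_eq_mul]
      push_cast
      rw [neg_mul]
    rw [h2, Real.norm_of_nonneg (by positivity)]
    calc _ ≤ 1 / (2 * Real.pi) * (2 * Real.pi * (M * r ^ n)) := by gcongr
      _ = _ := by field_simp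
  -- The Joukowski map is invariant under `w ↦ w⁻¹`, so the contour estimate for nonnegative
  -- frequencies covers the negative ones too.
  have heven : ∀ n : ℤ, fourierCoeff g (-n) = fourierCoeff g n := by
    intro n
    have hg : ∀ t, g (-t) = g t := by
      intro t
      change Φ (joukowski (AddCircle.toCircle (-t) : ℂ)) = Φ (joukowski (AddCircle.toCircle t : ℂ))
      rw [AddCircle.toCircle_neg, Circle.coe_inv]
      unfold joukowski
      rw [inv_inv, add_comm (_⁻¹)]
    rw [fourierCoeff, fourierCoeff, ← integral_neg_eq_self]
    congr 1
    ext t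
    rw [hg, neg_neg, fourier_apply, fourier_apply, smul_neg, neg_smul]
  have hM0 : 0 ≤ M := (norm_nonneg _).trans (hM _ (hmem 1))
  have habs : ∀ k : ℤ, ‖fourierCoeff g k‖ ≤ M * r ^ k.natAbs := by
    intro k
    rcases Int.natAbs_eq k with h | h
    · nth_rewrite 1 [h]; exact hcoef _
    · nth_rewrite 1 [h]; rw [heven]; exact hcoef _
  have hgeo : Summable fun n : ℕ => M * r ^ n :=
    (summable_geometric_of_lt_one hr0.le hr1).mul_left M
  have hsum : Summable (fourierCoeff g) := by
    refine Summable.of_norm_bounded (g := fun k : ℤ => M * r ^ k.natAbs) ?_ habs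
    refine Summable.of_nat_of_neg ?_ ?_ <;> simpa using hgeo
  -- Pairing the frequencies `n` and `-n` counts the constant term twice; the correction at `n = 0`
  -- removes the surplus.
  refine ⟨fun n => 2 * fourierCoeff g n - if n = 0 then fourierCoeff g 0 else 0, fun x hx => ?_⟩
  set θ : ℝ := Real.arccos (2 * x - 1) with hθ
  have hcos : Real.cos θ = 2 * x - 1 :=
    Real.cos_arccos (by linarith [hx.1]) (by linarith [hx.2])
  have hΦ : Φ x = g (θ : AddCircle (2 * Real.pi)) := by
    rw [hgθ, joukowski_exp, hcos]
    congr 2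
    ring
  have hs := (has_pointwise_sum_fourier_series_of_summable hsum
    (θ : AddCircle (2 * Real.pi))).nat_add_neg
  have hterm : ∀ n : ℕ, fourierCoeff g n • fourier (n : ℤ) (θ : AddCircle (2 * Real.pi)) +
      fourierCoeff g (-n) • fourier (-(n : ℤ)) (θ : AddCircle (2 * Real.pi)) =
      2 * fourierCoeff g n * (((Polynomial.Chebyshev.T ℝ n).eval (2 * x - 1) : ℝ) : ℂ) := by
    intro n
    rw [heven, hfour, hfour, ← hcos, Polynomial.Chebyshev.T_real_cos, Complex.ofReal_cos,
      Complex.cos]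
    push_cast
    simp only [smul_eq_mul, neg_mul, mul_assoc]
    ring
  simp only [hterm] at hs
  have hs2 := (hasSum_nat_add_iff' (q + 1)).2 hs
  have hb : ∀ n : ℕ, ‖2 * fourierCoeff g (n + (q + 1) : ℕ) *
      (((Polynomial.Chebyshev.T ℝ (n + (q + 1) : ℕ)).eval (2 * x - 1) : ℝ) : ℂ)‖ ≤
      2 * M * r ^ (q + 1) * r ^ n := by
    intro n
    rw [← hcos, Polynomial.Chebyshev.T_real_cos, norm_mul, norm_mul, Complex.norm_real]
    have h1 := hcoef (n + (q + 1))
    have h2 : ‖Real.cos (((n + (q + 1) : ℕ) : ℤ) * θ)‖ ≤ 1 := Real.abs_cos_le_one _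
    calc _ ≤ ‖(2 : ℂ)‖ * (M * r ^ (n + (q + 1))) * 1 := by gcongr
      _ = _ := by rw [pow_add]; simp; ring
  have htail := tsum_of_norm_bounded ((hasSum_geometric_of_lt_one hr0.le hr1).mul_left
    (2 * M * r ^ (q + 1))) hb
  rw [hs2.tsum_eq] at htail
  -- Since `1 - r = δ r`, summing the geometric tail trades one power of `r` for the factor `1 / δ`.
  have hfin : 2 * M * r ^ (q + 1) * (1 - r)⁻¹ = 2 * M / δ * r ^ q := by
    have : 1 - r = δ * r := by rw [hr]; field_simp; ring
    rw [this, pow_succ]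
    field_simp
  rw [hfin] at htail
  refine le_of_eq_of_le (congrArg norm ?_) htail
  rw [hΦ]
  simp only [sub_mul, Finset.sum_sub_distrib, ite_mul, zero_mul]
  rw [Finset.sum_ite_eq' (Finset.range (q + 1)) 0]
  simp
  ring

/-- Interpolation error of a function that is holomorphic near the unit interval. -/
lemma norm_interpolation_sub_le {δ M Λ : ℝ} (hδ : 0 < δ) {Φ : ℂ → ℂ}
    (hd : DifferentiableOn ℂ Φ (segNhd δ)) (hM : ∀ z ∈ segNhd δ, ‖Φ z‖ ≤ M) {q : ℕ}
    {x : Fin (q + 1) → ℝ} (hx : Function.Injective x) (hmem : ∀ k, x k ∈ Icc (0 : ℝ) 1)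
    {s : ℝ} (hs : s ∈ Icc (0 : ℝ) 1) (hΛ : ∑ k, |lagr x k s| ≤ Λ) :
    ‖∑ k, Φ (x k) * ((lagr x k s : ℝ) : ℂ) - Φ s‖ ≤ (1 + Λ) * (2 * M / δ * (1 + δ)⁻¹ ^ q) := by
  obtain ⟨c, hc⟩ := exists_chebyshev_approx hδ hd hM q
  set P : ℝ → ℂ := fun y => ∑ n ∈ Finset.range (q + 1),
        c n * (((Polynomial.Chebyshev.T ℝ n).eval (2 * y - 1) : ℝ) : ℂ) with hP
  set e := 2 * M / δ * (1 + δ)⁻¹ ^ q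
  -- Interpolation reproduces polynomials of degree at most `q`. The error for `Φ` is therefore that
  -- for `Φ - P`, at most `1 + Λ` times the Chebyshev error.
  have hrepr : ∑ k, P (x k) * ((lagr x k s : ℝ) : ℂ) = P s := by
    simp only [hP, Finset.sum_mul]
    rw [Finset.sum_comm]
    refine Finset.sum_congr rfl fun n hn => ?_
    simp only [mul_assoc]
    rw [← Finset.mul_sum]
    congr 1
    set p : Polynomial ℝ := (Polynomial.Chebyshev.T ℝ n).comp (2 * Polynomial.X - 1) with hp
    have hpe : ∀ y : ℝ, (Polynomial.Chebyshev.T ℝ n).eval (2 * y - 1) = p.eval y := by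
      intro y; simp [hp]
    have hdeg : p.degree < (Finset.univ : Finset (Fin (q + 1))).card := by
      rw [Finset.card_univ, Fintype.card_fin]
      have h1 : (2 * Polynomial.X - 1 : Polynomial ℝ).natDegree ≤ 1 := by compute_degree
      have h2 : p.natDegree ≤ n := by
        refine Polynomial.natDegree_comp_le.trans ?_
        rw [Polynomial.Chebyshev.natDegree_T]
        simpa using Nat.mul_le_mul_left n h1
      refine lt_of_le_of_lt Polynomial.degree_le_natDegree ?_
      have := Finset.mem_range.1 hn
      exact_mod_cast lt_of_le_of_lt h2 this
    have h := Lagrange.eq_interpolate (s := Finset.univ) hx.injOn hdeg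
    simp only [hpe]
    conv_rhs => rw [h]
    rw [Lagrange.interpolate_apply, Polynomial.eval_finsetSum]
    push_cast
    refine Finset.sum_congr rfl fun k _ => ?_
    simp [lagr]
  have hsplit : ∑ k, Φ (x k) * ((lagr x k s : ℝ) : ℂ) - Φ s =
      ∑ k, (Φ (x k) - P (x k)) * ((lagr x k s : ℝ) : ℂ) - (Φ s - P s) := by
    simp only [sub_mul, Finset.sum_sub_distrib, hrepr]
    ring
  rw [hsplit]
  have he : 0 ≤ e := (norm_nonneg _).trans (hc s hs)
  calc _ ≤ ∑ k, ‖(Φ (x k) - P (x k)) * ((lagr x k s : ℝ) : ℂ)‖ + ‖Φ s - P s‖ :=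
        (norm_sub_le _ _).trans (by gcongr; exact norm_sum_le _ _)
    _ ≤ ∑ k, e * |lagr x k s| + e := by
        gcongr with k
        · rw [norm_mul, Complex.norm_real, Real.norm_eq_abs]
          gcongr
          exact hc _ (hmem k)
        · exact hc s hs
    _ ≤ e * Λ + e := by rw [← Finset.mul_sum]; gcongr
    _ = _ := by ring

/-! ### Holomorphic extension of real analytic functions along coordinate lines -/

/-- A function that is analytic at a point extends, along each coordinate line near that point, to a
holomorphic function on a disc, whose radius and whose bound do not depend on the line. -/
lemma exists_local_extension {g : R2 → ℝ} {s₀ : R2} (hg : AnalyticAt ℝ g s₀) :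
    ∃ r > 0, ∃ M : ℝ, ∀ s ∈ Metric.ball s₀ r, ∀ α : Fin 2, ∃ Ψ : ℂ → ℂ,
      DifferentiableOn ℂ Ψ (Metric.ball (s α : ℂ) r) ∧
      (∀ z ∈ Metric.ball (s α : ℂ) r, ‖Ψ z‖ ≤ M) ∧
      ∀ x : ℝ, |x - s α| < r → Ψ x = (g (Function.update s α x) : ℝ) := by
  obtain ⟨p, R, hp⟩ := hg
  obtain ⟨r', hr'0, hr'R⟩ := ENNReal.lt_iff_exists_nnreal_btwn.1 hp.r_pos
  have hr0 : (0 : ℝ) < r' := by exact_mod_cast hr'0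
  obtain ⟨C, hC0, hC⟩ := p.norm_mul_pow_le_of_lt_radius (hr'R.trans_le hp.r_le)
  -- Two displacements of size `r' / 8`, of `s` from `s₀` and of `z` from `s α`, add up to at most
  -- `r' / 4` in each coordinate. The expansion of the `n`-linear term has `2 ^ n` summands, which
  -- raises `(r' / 4) ^ n` to `(r' / 2) ^ n`; half the radius `r'` gives the ratio `1 / 2` and the
  -- sum `2 C`.
  refine ⟨r' / 8, by positivity, 2 * C, fun s hs α => ?_⟩
  set w : ℂ → Fin 2 → ℂ := fun z i => if i = α then z - (s₀ α : ℂ) else ((s i - s₀ i : ℝ) : ℂ) with hw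
  -- The Taylor terms at `s₀` are written out in the standard basis with real coefficients; this
  -- form still makes sense when the coordinate `α` of the displacement becomes complex.
  set F : ℕ → ℂ → ℂ := fun n z => ∑ f : Fin n → Fin 2,
    ((p n fun i => Pi.single (f i) (1 : ℝ) : ℝ) : ℂ) * ∏ i, w z (f i) with hF
  have hsi : ∀ i, |s i - s₀ i| < r' / 8 := fun i => by
    have := (dist_pi_lt_iff (by positivity)).1 (Metric.mem_ball.1 hs) i
    rwa [Real.dist_eq] at this
  have hwb : ∀ z ∈ Metric.ball (s α : ℂ) (r' / 8), ∀ i, ‖w z i‖ ≤ r' / 4 := by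
    intro z hz i
    simp only [hw]
    split_ifs with h
    · rw [Metric.mem_ball, dist_eq_norm] at hz
      have h1 : z - (s₀ α : ℂ) = (z - s α) + ((s α - s₀ α : ℝ) : ℂ) := by push_cast; ring
      rw [h1]
      refine (norm_add_le _ _).trans ?_
      rw [Complex.norm_real, Real.norm_eq_abs]
      linarith [hsi α]
    · rw [Complex.norm_real, Real.norm_eq_abs]
      linarith [hsi i]
  have hFb : ∀ n, ∀ z ∈ Metric.ball (s α : ℂ) (r' / 8), ‖F n z‖ ≤ C * (1 / 2) ^ n := by
    intro n z hz
    have h1 : ∀ f : Fin n → Fin 2, ‖((p n fun i => Pi.single (f i) (1 : ℝ) : ℝ) : ℂ) *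
        ∏ i, w z (f i)‖ ≤ ‖p n‖ * (r' / 4 : ℝ) ^ n := by
      intro f
      rw [norm_mul, Complex.norm_real, norm_prod]
      gcongr
      · refine ((p n).le_opNorm _).trans (le_of_eq ?_)
        rw [Finset.prod_eq_one, mul_one]
        intro i _
        rw [Pi.norm_single, norm_one]
      · calc ∏ i, ‖w z (f i)‖ ≤ ∏ _i : Fin n, (r' / 4 : ℝ) :=
              Finset.prod_le_prod (fun _ _ => norm_nonneg _) fun i _ => hwb z hz (f i)
          _ = _ := by rw [Finset.prod_const, Finset.card_univ, Fintype.card_fin]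
    calc ‖F n z‖ ≤ ∑ _f : Fin n → Fin 2, ‖p n‖ * (r' / 4 : ℝ) ^ n :=
          (norm_sum_le _ _).trans (Finset.sum_le_sum fun f _ => h1 f)
      _ = ‖p n‖ * (r' : ℝ) ^ n * (1 / 2) ^ n := by
          have : (r' / 4 : ℝ) ^ n * 2 ^ n = (r' : ℝ) ^ n * (1 / 2) ^ n := by
            rw [← mul_pow, ← mul_pow]; congr 1; ring
          simp only [Finset.sum_const, Finset.card_univ, Fintype.card_fun, Fintype.card_fin,
            nsmul_eq_mul, Nat.cast_pow, Nat.cast_ofNat]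
          rw [mul_assoc, ← this]; ring
      _ ≤ _ := by gcongr; exact hC n
  have hgs : HasSum (fun n : ℕ => C * (1 / 2 : ℝ) ^ n) (C * 2) := hasSum_geometric_two.mul_left C
  have hFd : ∀ n, Differentiable ℂ (F n) := by
    intro n
    have h1 : ∀ i, Differentiable ℂ fun z => w z i := by
      intro i
      simp only [hw]
      split_ifs <;> fun_prop
    have h2 : ∀ f : Fin n → Fin 2, Differentiable ℂ fun z => ∏ i, w z (f i) := by
      intro f
      have := Differentiable.fun_finsetProd (𝕜 := ℂ) (u := Finset.univ) (f := fun i z => w z (f i))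
        (fun i _ => h1 (f i))
      exact this
    refine Differentiable.fun_sum fun f _ => (h2 f).const_mul _
  refine ⟨fun z => ∑' n, F n z, ?_, ?_, ?_⟩
  · exact Complex.differentiableOn_tsum_of_summable_norm hgs.summable
      (fun n => (hFd n).differentiableOn) Metric.isOpen_ball hFb
  · intro z hz
    have := tsum_of_norm_bounded hgs fun n => hFb n z hz
    linarith
  · intro x hx
    set h : R2 := Function.update s α x - s₀ with hh
    have hhw : ∀ i, w x i = (h i : ℂ) := by
      intro i
      simp only [hw, hh, Pi.sub_apply]
      split_ifs with hi
      · subst hi; simp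
      · simp [hi]
    have hFx : ∀ n, F n x = ((p n fun _ => h : ℝ) : ℂ) := by
      intro n
      have h1 : h = ∑ i, h i • (Pi.single i (1 : ℝ) : R2) := by
        ext j; fin_cases j <;> simp
      have h2 : (p n fun _ => h) = ∑ f : Fin n → Fin 2, (∏ i, h (f i)) *
          p n fun i => Pi.single (f i) (1 : ℝ) := by
        conv_lhs => rw [h1]
        rw [ContinuousMultilinearMap.map_sum]
        refine Finset.sum_congr rfl fun f _ => ?_
        rw [ContinuousMultilinearMap.map_smul_univ, smul_eq_mul]
      rw [h2]
      push_cast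
      refine Finset.sum_congr rfl fun f _ => ?_
      simp only [hhw]
      ring
    have hmem : h ∈ Metric.eball (0 : R2) R := by
      have : ‖h‖ < r' := by
        rw [pi_norm_lt_iff hr0]
        intro i
        simp only [hh, Pi.sub_apply, Real.norm_eq_abs]
        by_cases hi : i = α
        · subst hi
          rw [Function.update_self]
          calc |x - s₀ i| = |(x - s i) + (s i - s₀ i)| := by ring_nf
            _ ≤ _ := abs_add_le _ _
            _ < _ := by linarith [hsi i]
        · rw [Function.update_of_ne hi]; linarith [hsi i]
      rw [Metric.mem_eball, edist_zero_right]
      refine lt_trans ?_ hr'R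
      rw [enorm_eq_nnnorm]
      exact_mod_cast this
    have hs := hp.hasSum hmem
    rw [hh, add_sub_cancel] at hs
    simp only [hFx]
    exact (Complex.hasSum_ofReal.2 hs).tsum_eq

/-- `g` extends along the coordinate lines through the unit square to holomorphic functions on the
complex `R`-neighbourhood of the unit interval, with the bound `M`. -/
def LineExt (g : R2 → ℝ) (R M : ℝ) : Prop :=
  ∀ s ∈ unitSquare, ∀ α : Fin 2, ∃ Φ : ℂ → ℂ, DifferentiableOn ℂ Φ (segNhd R) ∧
    (∀ z ∈ segNhd R, ‖Φ z‖ ≤ M) ∧ ∀ x ∈ Icc (0 : ℝ) 1, Φ x = (g (Function.update s α x) : ℝ)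

lemma update_mem_unitSquare {s : R2} (hs : s ∈ unitSquare) (α : Fin 2) {x : ℝ}
    (hx : x ∈ Icc (0 : ℝ) 1) : Function.update s α x ∈ unitSquare := by
  constructor <;> intro i <;> by_cases hi : i = α
  · subst hi; simpa using hx.1
  · simpa [hi] using hs.1 i
  · subst hi; simpa using hx.2
  · simpa [hi] using hs.2 i

lemma isCompact_unitSquare : IsCompact unitSquare := isCompact_Icc

/-- Local holomorphic extensions of a function on the unit interval agree where they overlap, and
hence define an extension to a neighbourhood. -/
lemma exists_glued_extension {φ : ℝ → ℂ} {r M : ℝ} (hr : 0 < r)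
    (h : ∀ x ∈ Icc (0 : ℝ) 1, ∃ Ψ : ℂ → ℂ, DifferentiableOn ℂ Ψ (Metric.ball (x : ℂ) r) ∧
      (∀ z ∈ Metric.ball (x : ℂ) r, ‖Ψ z‖ ≤ M) ∧ ∀ y : ℝ, |y - x| < r → Ψ y = φ y) :
    ∃ Φ : ℂ → ℂ, DifferentiableOn ℂ Φ (segNhd r) ∧ (∀ z ∈ segNhd r, ‖Φ z‖ ≤ M) ∧
      ∀ x ∈ Icc (0 : ℝ) 1, Φ x = φ x := by
  choose! Ψ hd hb he using h
  have hagree : ∀ x ∈ Icc (0 : ℝ) 1, ∀ y ∈ Icc (0 : ℝ) 1,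
      EqOn (Ψ x) (Ψ y) (Metric.ball (x : ℂ) r ∩ Metric.ball (y : ℂ) r) := by
    intro x hx y hy z hz
    have hxy : |x - y| < 2 * r := by
      have h1 := Metric.mem_ball.1 hz.1
      have h2 := Metric.mem_ball.1 hz.2
      have h3 : dist (x : ℂ) y < 2 * r := by
        linarith [dist_triangle_left (x : ℂ) y z]
      rwa [dist_eq_norm, ← Complex.ofReal_sub, Complex.norm_real, Real.norm_eq_abs] at h3
    -- When two discs with real centres and equal radii meet, the midpoint of the centres lies in
    -- both. Near it both extensions equal `φ` on the real line, and the identity theorem on the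
    -- convex intersection gives agreement.
    set mid : ℝ := (x + y) / 2 with hmid
    have hopen : IsOpen (Metric.ball (x : ℂ) r ∩ Metric.ball (y : ℂ) r) :=
      Metric.isOpen_ball.inter Metric.isOpen_ball
    have hdist : ∀ a b : ℝ, dist (a : ℂ) b = |a - b| := fun a b => by
      rw [dist_eq_norm, ← Complex.ofReal_sub, Complex.norm_real, Real.norm_eq_abs]
    have hmx : |mid - x| < r := by
      rw [hmid, show (x + y) / 2 - x = -((x - y) / 2) by ring, abs_neg, abs_div, abs_two]; linarith
    have hmy : |mid - y| < r := by
      rw [hmid, show (x + y) / 2 - y = (x - y) / 2 by ring, abs_div, abs_two]; linarith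
    refine AnalyticOnNhd.eqOn_of_preconnected_of_frequently_eq (𝕜 := ℂ) (z₀ := (mid : ℂ))
      (((hd x hx).mono inter_subset_left).analyticOnNhd hopen)
      (((hd y hy).mono inter_subset_right).analyticOnNhd hopen)
      ((convex_ball _ _).inter (convex_ball _ _)).isPreconnected
      ⟨by rw [Metric.mem_ball, hdist]; exact hmx, by rw [Metric.mem_ball, hdist]; exact hmy⟩ ?_ hz
    have ht : Filter.Tendsto (fun y : ℝ => (y : ℂ)) (nhdsWithin mid {mid}ᶜ)
        (nhdsWithin (mid : ℂ) {(mid : ℂ)}ᶜ) := by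
      refine tendsto_nhdsWithin_iff.2 ⟨(Complex.continuous_ofReal.tendsto mid).mono_left
        nhdsWithin_le_nhds, ?_⟩
      filter_upwards [self_mem_nhdsWithin] with a ha
      simpa using ha
    refine ht.frequently (Filter.Eventually.frequently ?_)
    have hev : ∀ᶠ a in nhds mid, |a - x| < r ∧ |a - y| < r := by
      have h1 : Continuous fun a : ℝ => |a - x| := by fun_prop
      have h2 : Continuous fun a : ℝ => |a - y| := by fun_prop
      exact (h1.continuousAt.eventually_lt continuousAt_const hmx).and
        (h2.continuousAt.eventually_lt continuousAt_const hmy)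
    filter_upwards [nhdsWithin_le_nhds hev] with a ha
    rw [he x hx a ha.1, he y hy a ha.2]
  classical
  -- The extension at `z` uses an arbitrarily chosen centre; by the agreement on overlaps it
  -- coincides locally with a single `Ψ x`, so the choice does not harm differentiability.
  set c : ℂ → ℝ := fun z => if h : ∃ x ∈ Icc (0 : ℝ) 1, ‖z - x‖ < r then h.choose else 0 with hc
  have hc1 : ∀ z ∈ segNhd r, c z ∈ Icc (0 : ℝ) 1 ∧ z ∈ Metric.ball (c z : ℂ) r := by
    intro z hz
    have hz' : ∃ x ∈ Icc (0 : ℝ) 1, ‖z - x‖ < r := hz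
    simp only [hc, dif_pos hz', Metric.mem_ball, dist_eq_norm]
    exact hz'.choose_spec
  have hΦ : ∀ x ∈ Icc (0 : ℝ) 1, ∀ z ∈ Metric.ball (x : ℂ) r, Ψ (c z) z = Ψ x z := by
    intro x hx z hz
    have hz' : z ∈ segNhd r := ⟨x, hx, by simpa [dist_eq_norm] using hz⟩
    exact hagree _ (hc1 z hz').1 _ hx ⟨(hc1 z hz').2, hz⟩
  refine ⟨fun z => Ψ (c z) z, ?_, fun z hz => hb _ (hc1 z hz).1 _ (hc1 z hz).2, ?_⟩
  · intro z hz
    obtain ⟨h1, h2⟩ := hc1 z hz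
    have h3 := (hd _ h1).differentiableAt (Metric.isOpen_ball.mem_nhds h2)
    refine (h3.congr_of_eventuallyEq ?_).differentiableWithinAt
    filter_upwards [Metric.isOpen_ball.mem_nhds h2] with y hy
    exact hΦ _ h1 y hy
  · intro x hx
    change Ψ (c x) x = _
    rw [hΦ x hx x (Metric.mem_ball_self hr), he x hx x (by simpa using hr)]

/-- Compactness of the square makes the radius and the bound of the local extensions uniform; along
each coordinate line these discs are then glued. -/
lemma exists_lineExt {g : R2 → ℝ} (hg : AnalyticOnNhd ℝ g unitSquare) :
    ∃ R > 0, ∃ M : ℝ, LineExt g R M := by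
  have key : ∃ r > 0, ∃ M : ℝ, ∀ s ∈ unitSquare, ∀ α : Fin 2, ∃ Ψ : ℂ → ℂ,
      DifferentiableOn ℂ Ψ (Metric.ball (s α : ℂ) r) ∧
      (∀ z ∈ Metric.ball (s α : ℂ) r, ‖Ψ z‖ ≤ M) ∧
      ∀ x : ℝ, |x - s α| < r → Ψ x = (g (Function.update s α x) : ℝ) := by
    refine isCompact_unitSquare.induction_on (p := fun U => ∃ r > 0, ∃ M : ℝ, ∀ s ∈ U,
      ∀ α : Fin 2, ∃ Ψ : ℂ → ℂ, DifferentiableOn ℂ Ψ (Metric.ball (s α : ℂ) r) ∧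
      (∀ z ∈ Metric.ball (s α : ℂ) r, ‖Ψ z‖ ≤ M) ∧
      ∀ x : ℝ, |x - s α| < r → Ψ x = (g (Function.update s α x) : ℝ)) ?_ ?_ ?_ ?_
    · exact ⟨1, one_pos, 0, by simp⟩
    · rintro U V hUV ⟨r, hr, M, h⟩
      exact ⟨r, hr, M, fun s hs => h s (hUV hs)⟩
    · rintro U V ⟨r, hr, M, h⟩ ⟨r', hr', M', h'⟩
      refine ⟨min r r', lt_min hr hr', max M M', ?_⟩
      rintro s (hs | hs) α
      · obtain ⟨Ψ, h1, h2, h3⟩ := h s hs α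
        have hsub := Metric.ball_subset_ball (x := (s α : ℂ)) (min_le_left r r')
        exact ⟨Ψ, h1.mono hsub, fun z hz => (h2 z (hsub hz)).trans (le_max_left _ _),
          fun x hx => h3 x (hx.trans_le (min_le_left _ _))⟩
      · obtain ⟨Ψ, h1, h2, h3⟩ := h' s hs α
        have hsub := Metric.ball_subset_ball (x := (s α : ℂ)) (min_le_right r r')
        exact ⟨Ψ, h1.mono hsub, fun z hz => (h2 z (hsub hz)).trans (le_max_right _ _),
          fun x hx => h3 x (hx.trans_le (min_le_right _ _))⟩
    · intro s hs
      obtain ⟨r, hr, M, h⟩ := exists_local_extension (hg s hs)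
      exact ⟨Metric.ball s r, mem_nhdsWithin_of_mem_nhds (Metric.ball_mem_nhds s hr), r, hr, M, h⟩
  obtain ⟨r, hr, M, h⟩ := key
  refine ⟨r, hr, M, fun s hs α => ?_⟩
  refine exists_glued_extension (φ := fun x => ((g (Function.update s α x) : ℝ) : ℂ)) hr
    fun x hx => ?_
  obtain ⟨Ψ, h1, h2, h3⟩ := h _ (update_mem_unitSquare hs α hx) α
  simp only [Function.update_self, Function.update_idem] at h1 h2 h3
  exact ⟨Ψ, h1, h2, h3⟩

lemma LineExt.mono {g : R2 → ℝ} {R R' M M' : ℝ} (h : LineExt g R M) (hR : R' ≤ R) (hM : M ≤ M') :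
    LineExt g R' M' := fun s hs α => by
  obtain ⟨Φ, h1, h2, h3⟩ := h s hs α
  exact ⟨Φ, h1.mono (segNhd_mono hR), fun z hz => (h2 z (segNhd_mono hR hz)).trans hM, h3⟩

/-! ### Holomorphic extension of the kernel along coordinate lines -/

/-- This is the Schwarz lemma on the disc of radius `R` around `ξ`. It provides the Lipschitz
constant that measures how far a complex parameter moves a surface point. -/
lemma norm_sub_le_of_bounded_on_segNhd {R M : ℝ} (hR : 0 < R) {Φ : ℂ → ℂ}
    (hd : DifferentiableOn ℂ Φ (segNhd R)) (hM : ∀ z ∈ segNhd R, ‖Φ z‖ ≤ M)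
    {ξ : ℝ} (hξ : ξ ∈ Icc (0 : ℝ) 1) {ζ : ℂ} (hζ : ‖ζ - ξ‖ < R) :
    ‖Φ ζ - Φ ξ‖ ≤ (2 * M + 1) / R * ‖ζ - ξ‖ := by
  have hsub : Metric.ball (ξ : ℂ) R ⊆ segNhd R := fun z hz =>
    ⟨ξ, hξ, by simpa [dist_eq_norm] using hz⟩
  have h := Complex.dist_le_div_mul_dist_of_mapsTo_ball (f := Φ) (c := (ξ : ℂ)) (R₁ := R)
    (R₂ := 2 * M + 1) (z := ζ) (hd.mono hsub) (fun z hz => ?_) (by simpa [dist_eq_norm] using hζ)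
  · simpa [dist_eq_norm] using h
  · rw [Metric.mem_closedBall, dist_eq_norm]
    have h1 := hM z (hsub hz)
    have h2 := hM ξ (ofReal_mem_segNhd hR hξ)
    linarith [norm_sub_le (Φ z) (Φ ξ)]

/-- The analytic continuation of the fundamental solution, as a function of `‖z‖²`. -/
def helmholtzSq (κ : ℝ) (w : ℂ) : ℂ :=
  Complex.exp (Complex.I * κ * w ^ (2⁻¹ : ℂ)) / (4 * Real.pi * w ^ (2⁻¹ : ℂ))

lemma helmholtzSq_norm_sq (κ : ℝ) {z : R3} (hz : z ≠ 0) :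
    helmholtzSq κ ((‖z‖ : ℂ) ^ 2) = helmholtz κ z := by
  have h : ((‖z‖ : ℂ) ^ (2 : ℕ)) ^ (2⁻¹ : ℂ) = ‖z‖ := by
    have := Complex.sq_cpow_two_inv (x := (‖z‖ : ℂ)) (by simpa using hz)
    simpa using this
  rw [helmholtzSq, helmholtz, h]

lemma differentiableAt_helmholtzSq (κ : ℝ) {w : ℂ} (hw : 0 < w.re) :
    DifferentiableAt ℂ (helmholtzSq κ) w := by
  have h1 : DifferentiableAt ℂ (fun w : ℂ => w ^ (2⁻¹ : ℂ)) w :=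
    differentiableAt_id.cpow (differentiableAt_const _) (Or.inl hw)
  have h0 : w ≠ 0 := by rintro rfl; simp at hw
  have h2 : w ^ (2⁻¹ : ℂ) ≠ 0 := by
    rw [Complex.cpow_def_of_ne_zero h0]; exact Complex.exp_ne_zero _
  have h3 : (4 * Real.pi * w ^ (2⁻¹ : ℂ) : ℂ) ≠ 0 := by
    have : (Real.pi : ℂ) ≠ 0 := by exact_mod_cast Real.pi_ne_zero
    simp [this, h2]
  exact ((h1.const_mul _).cexp).div (h1.const_mul _) h3

/-- The modulus of the root lies between `d` and `D`. The root is no longer real, so the exponential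
is not unimodular and is bounded by `exp (κ D)`. -/
lemma norm_helmholtzSq_le {κ d D : ℝ} (hκ : 0 ≤ κ) (hd : 0 < d) {w : ℂ} (h1 : d ^ 2 ≤ ‖w‖)
    (h2 : ‖w‖ ≤ D ^ 2) (hD : 0 ≤ D) :
    ‖helmholtzSq κ w‖ ≤ Real.exp (κ * D) / (4 * Real.pi * d) := by
  set S := w ^ (2⁻¹ : ℂ) with hS
  have hS2 : S ^ 2 = w := Complex.cpow_ofNat_inv_pow w 2
  have hn : ‖S‖ ^ 2 = ‖w‖ := by rw [← norm_pow, hS2]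
  have hl : d ≤ ‖S‖ := abs_le_of_sq_le_sq' (by linarith) (norm_nonneg _) |>.2
  have hu : ‖S‖ ≤ D := abs_le_of_sq_le_sq' (by linarith) hD |>.2
  rw [helmholtzSq, ← hS, norm_div, norm_mul, norm_mul, Complex.norm_real,
    Real.norm_of_nonneg Real.pi_pos.le]
  have h4 : ‖(4 : ℂ)‖ = 4 := by simp
  rw [h4]
  gcongr
  refine (Complex.norm_exp_le_exp_norm _).trans ?_
  rw [norm_mul, norm_mul, Complex.norm_I, one_mul, Complex.norm_real, Real.norm_of_nonneg hκ]
  gcongr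

/-- Perturbing a real vector by a complex vector that is small relative to it changes the bilinear
square only by a fraction. -/
lemma norm_sum_sq_sub_le {X : R3} {e : Fin 3 → ℂ} (he : ∀ k, ‖e k‖ ≤ ‖X‖ / 16) :
    ‖∑ k, ((X k : ℂ) + e k) ^ 2 - (‖X‖ : ℂ) ^ 2‖ ≤ ‖X‖ ^ 2 / 2 := by
  have h1 : (‖X‖ : ℂ) ^ 2 = ∑ k, (X k : ℂ) ^ 2 := by
    have := EuclideanSpace.real_norm_sq_eq X
    exact_mod_cast this
  rw [h1, ← Finset.sum_sub_distrib]
  -- The constant is `(1/16) (2 + 1/16)`; three components give `99/256`, which is below `1/2`.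
  have h2 : ∀ k, ‖((X k : ℂ) + e k) ^ 2 - (X k : ℂ) ^ 2‖ ≤ (33 / 256) * ‖X‖ ^ 2 := by
    intro k
    have h3 : ((X k : ℂ) + e k) ^ 2 - (X k : ℂ) ^ 2 = e k * (2 * X k + e k) := by ring
    have h4 : ‖(X k : ℂ)‖ ≤ ‖X‖ := by
      rw [Complex.norm_real]; exact PiLp.norm_apply_le X k
    have h5 : ‖2 * (X k : ℂ) + e k‖ ≤ 2 * ‖X‖ + ‖X‖ / 16 := by
      refine (norm_add_le _ _).trans ?_
      rw [norm_mul]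
      have : ‖(2 : ℂ)‖ = 2 := by simp
      rw [this]
      linarith [he k]
    rw [h3, norm_mul]
    calc _ ≤ ‖X‖ / 16 * (2 * ‖X‖ + ‖X‖ / 16) := by gcongr; exact he k
      _ = _ := by ring
  calc _ ≤ ∑ _k : Fin 3, (33 / 256) * ‖X‖ ^ 2 :=
        (norm_sum_le _ _).trans (Finset.sum_le_sum fun k _ => h2 k)
    _ ≤ _ := by simp; nlinarith [sq_nonneg ‖X‖]

/-- The pull-back of the fundamental solution to a line segment of length `h` at a distance of order
`h` from the singularity extends to a neighbourhood of the unit interval that does not depend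
on `h`. -/
lemma exists_kernel_extension {κ R M c D : ℝ} (hκ : 0 < κ) (hR : 0 < R) (hM : 0 ≤ M) (hc : 0 < c) :
    ∃ δ > 0, δ ≤ R ∧ ∃ B : ℝ, 0 ≤ B ∧ ∀ (Φ : Fin 3 → ℂ → ℂ) (φ : ℝ → R3),
      (∀ k, DifferentiableOn ℂ (Φ k) (segNhd R)) → (∀ k, ∀ z ∈ segNhd R, ‖Φ k z‖ ≤ M) →
      (∀ k, ∀ x ∈ Icc (0 : ℝ) 1, Φ k x = (φ x k : ℝ)) →
      ∀ a h : ℝ, 0 < h → h ≤ 1 → 0 ≤ a → a + h ≤ 1 → ∀ y : R3,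
      (∀ x ∈ Icc (0 : ℝ) 1, c * h ≤ ‖φ (a + h * x) - y‖ ∧ ‖φ (a + h * x) - y‖ ≤ D) →
      ∃ H : ℂ → ℂ, DifferentiableOn ℂ H (segNhd δ) ∧ (∀ z ∈ segNhd δ, ‖H z‖ ≤ B / h) ∧
        ∀ x ∈ Icc (0 : ℝ) 1, H x = helmholtz κ (φ (a + h * x) - y) := by
  -- The summand `1` keeps the Lipschitz constant positive even if `M = 0`, so that it may be
  -- divided by.
  set Lp : ℝ := (2 * M + 1) / R with hLp
  have hLp0 : 0 < Lp := by positivity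
  -- Moving the local parameter by `δ` moves each component by at most `Lp h δ ≤ c h / 16`, a
  -- sixteenth of the distance to `y`; the length `h` cancels. With `r` that distance, the
  -- complexified square then has modulus between `(r/2)²` and `(2r)²`, which explains `2 * D` and
  -- `c / 2` in the bound.
  refine ⟨min R (c / (16 * Lp)), by positivity, min_le_left _ _,
    Real.exp (κ * (2 * D)) / (4 * Real.pi * (c / 2)), by positivity, ?_⟩
  set δ := min R (c / (16 * Lp)) with hδ
  have hδR : δ ≤ R := min_le_left _ _
  have hδc : Lp * δ ≤ c / 16 := by
    have : δ ≤ c / (16 * Lp) := min_le_right _ _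
    calc Lp * δ ≤ Lp * (c / (16 * Lp)) := by gcongr
      _ = _ := by field_simp
  intro Φ φ hd hb he a h h0 h1 ha hah y hy
  set Q : ℂ → ℂ := fun z => ∑ k, (Φ k (a + h * z) - y k) ^ 2 with hQ
  have hmemI : ∀ x ∈ Icc (0 : ℝ) 1, a + h * x ∈ Icc (0 : ℝ) 1 := fun x hx =>
    ⟨by nlinarith [hx.1], by nlinarith [hx.2]⟩
  have hclose : ∀ z : ℂ, ∀ x : ℝ, ‖z - x‖ < δ →
      ‖(a + h * z : ℂ) - ((a + h * x : ℝ) : ℂ)‖ = h * ‖z - x‖ := by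
    intro z x _
    rw [show (a + h * z : ℂ) - ((a + h * x : ℝ) : ℂ) = h * (z - x) by push_cast; ring, norm_mul,
      Complex.norm_real, Real.norm_of_nonneg h0.le]
  have hmap : ∀ z ∈ segNhd δ, (a + h * z : ℂ) ∈ segNhd R := by
    rintro z ⟨x, hx, hz⟩
    refine ⟨a + h * x, hmemI x hx, ?_⟩
    rw [hclose z x hz]
    nlinarith [norm_nonneg (z - x)]
  have hQest : ∀ z : ℂ, ∀ x ∈ Icc (0 : ℝ) 1, ‖z - x‖ < δ →
      ‖Q z - (‖φ (a + h * x) - y‖ : ℂ) ^ 2‖ ≤ ‖φ (a + h * x) - y‖ ^ 2 / 2 := by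
    intro z x hx hz
    have h2 : ∀ k, ‖Φ k (a + h * z) - Φ k ((a + h * x : ℝ) : ℂ)‖ ≤
        ‖φ (a + h * x) - y‖ / 16 := by
      intro k
      have h3 := norm_sub_le_of_bounded_on_segNhd hR (hd k) (hb k) (hmemI x hx)
        (ζ := a + h * z) (by rw [hclose z x hz]; nlinarith [norm_nonneg (z - x)])
      rw [hclose z x hz, ← hLp] at h3
      have h4 : Lp * (h * ‖z - x‖) ≤ Lp * (h * δ) := by gcongr
      have h5 : Lp * (h * δ) ≤ c / 16 * h := by nlinarith
      linarith [(hy x hx).1]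
    have h6 := norm_sum_sq_sub_le (X := φ (a + h * x) - y) h2
    convert h6 using 3
    simp only [hQ]
    refine Finset.sum_congr rfl fun k _ => ?_
    rw [he k _ (hmemI x hx)]
    simp
  refine ⟨fun z => helmholtzSq κ (Q z), ?_, ?_, ?_⟩
  · rintro z ⟨x, hx, hz⟩
    have hX : 0 < ‖φ (a + h * x) - y‖ := lt_of_lt_of_le (by positivity) (hy x hx).1
    -- The complexified square is within half of the positive number `‖φ (a + h x) - y‖²` of that
    -- number, so it avoids the branch cut of the root.
    have hre : 0 < (Q z).re := by
      have h2 := (Complex.abs_re_le_norm _).trans (hQest z x hx hz)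
      rw [Complex.sub_re, ← Complex.ofReal_pow, Complex.ofReal_re] at h2
      have := (abs_le.1 h2).1
      nlinarith
    have hQd : DifferentiableAt ℂ Q z := by
      simp only [hQ]
      refine DifferentiableAt.fun_sum fun k _ => ?_
      have h3 : DifferentiableAt ℂ (Φ k) (a + h * z) :=
        (hd k).differentiableAt ((isOpen_segNhd R).mem_nhds (hmap z ⟨x, hx, hz⟩))
      have h4 : DifferentiableAt ℂ (fun z : ℂ => (a + h * z : ℂ)) z := by fun_prop
      exact ((h3.comp z h4).sub_const _).pow 2
    exact ((differentiableAt_helmholtzSq κ hre).comp z hQd).differentiableWithinAt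
  · rintro z ⟨x, hx, hz⟩
    have hX : 0 < ‖φ (a + h * x) - y‖ := lt_of_lt_of_le (by positivity) (hy x hx).1
    have h2 := hQest z x hx hz
    set r := ‖φ (a + h * x) - y‖
    have hr : ‖(r : ℂ) ^ 2‖ = r ^ 2 := by
      rw [norm_pow, Complex.norm_real, Real.norm_of_nonneg hX.le]
    have h3 : r ^ 2 - ‖Q z‖ ≤ r ^ 2 / 2 := by
      rw [← hr]
      refine (norm_sub_norm_le _ _).trans ?_
      rw [norm_sub_rev, hr]; exact h2
    have h4 : ‖Q z‖ - r ^ 2 ≤ r ^ 2 / 2 := by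
      nth_rewrite 1 [← hr]
      exact (norm_sub_norm_le _ _).trans h2
    have h5 := norm_helmholtzSq_le (κ := κ) (d := r / 2) (D := 2 * r) hκ.le (by positivity)
      (w := Q z) (by nlinarith) (by nlinarith) (by positivity)
    have h6 : c * h ≤ r := (hy x hx).1
    have h7 : r ≤ D := (hy x hx).2
    have h8 : Real.exp (κ * (2 * r)) / (4 * Real.pi * (r / 2)) ≤
        Real.exp (κ * (2 * D)) / (4 * Real.pi * (c * h / 2)) := by gcongr
    refine (h5.trans h8).trans (le_of_eq ?_)
    field_simp
  · intro x hx
    have hX : φ (a + h * x) - y ≠ 0 := by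
      have : 0 < ‖φ (a + h * x) - y‖ := lt_of_lt_of_le (by positivity) (hy x hx).1
      exact norm_pos_iff.1 this
    have hQx : Q x = (‖φ (a + h * x) - y‖ : ℂ) ^ 2 := by
      have h1 := EuclideanSpace.real_norm_sq_eq (φ (a + h * x) - y)
      have h2 : ((‖φ (a + h * x) - y‖ : ℂ)) ^ 2 =
          ∑ k, (((φ (a + h * x) - y) k : ℝ) : ℂ) ^ 2 := by
        exact_mod_cast h1
      rw [h2]
      simp only [hQ]
      refine Finset.sum_congr rfl fun k _ => ?_
      have h3 := he k _ (hmemI x hx)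
      push_cast at h3
      rw [h3]
      simp
    change helmholtzSq κ (Q x) = _
    rw [hQx, helmholtzSq_norm_sq κ hX]

/-! ### Tensor product interpolation -/

lemma sum_fin_two_arrow {q : ℕ} (f : (Fin 2 → Fin (q + 1)) → ℂ) :
    ∑ m, f m = ∑ k, ∑ l, f ![k, l] := by
  rw [← Fintype.sum_prod_type']
  exact Fintype.sum_equiv (finTwoArrowEquiv _) _ _ fun m => by
    congr 1
    ext i
    fin_cases i <;> rfl

lemma sum_fin_two_arrow_real {q : ℕ} (f : (Fin 2 → Fin (q + 1)) → ℝ) :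
    ∑ m, f m = ∑ k, ∑ l, f ![k, l] := by
  rw [← Fintype.sum_prod_type']
  exact Fintype.sum_equiv (finTwoArrowEquiv _) _ _ fun m => by
    congr 1
    ext i
    fin_cases i <;> rfl

lemma sum_abs_tensorLagr_le {q : ℕ} {x : Fin (q + 1) → ℝ} {Λ : ℝ}
    (hΛ : ∀ s ∈ Icc (0 : ℝ) 1, ∑ k, |lagr x k s| ≤ Λ) {s : R2} (hs : s ∈ unitSquare) :
    ∑ m, |tensorLagr x m s| ≤ Λ ^ 2 := by
  have h0 := hΛ (s 0) ⟨hs.1 0, hs.2 0⟩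
  have h1 := hΛ (s 1) ⟨hs.1 1, hs.2 1⟩
  have hpos : 0 ≤ ∑ k, |lagr x k (s 1)| := Finset.sum_nonneg fun _ _ => abs_nonneg _
  have h2 : ∑ m, |tensorLagr x m s| = (∑ k, |lagr x k (s 0)|) * ∑ l, |lagr x l (s 1)| := by
    rw [sum_fin_two_arrow_real, Finset.sum_mul_sum]
    simp [tensorLagr, Fin.prod_univ_two, abs_mul]
  rw [h2, sq]
  have h3 : 0 ≤ ∑ k, |lagr x k (s 0)| := Finset.sum_nonneg fun _ _ => abs_nonneg _
  exact mul_le_mul h0 h1 hpos (h3.trans h0)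

lemma node_mem_unitSquare {q : ℕ} {x : Fin (q + 1) → ℝ} (hmem : ∀ k, x k ∈ Icc (0 : ℝ) 1)
    (m : Fin 2 → Fin (q + 1)) : (fun a => x (m a)) ∈ unitSquare :=
  ⟨fun a => (hmem (m a)).1, fun a => (hmem (m a)).2⟩

/-- The variables are interpolated one after the other: the inner error, at points where the first
variable is a node, is amplified by at most `Λ` through the outer interpolation, whose own error is
added. -/
lemma norm_tensor_interpolation_sub_le {q : ℕ} {x : Fin (q + 1) → ℝ} {Λ e : ℝ}
    (hmem : ∀ k, x k ∈ Icc (0 : ℝ) 1) (hΛ : ∀ s ∈ Icc (0 : ℝ) 1, ∑ k, |lagr x k s| ≤ Λ)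
    {g : R2 → ℂ} (hg : ∀ s ∈ unitSquare, ∀ α : Fin 2,
      ‖∑ k, g (Function.update s α (x k)) * ((lagr x k (s α) : ℝ) : ℂ) - g s‖ ≤ e)
    {s : R2} (hs : s ∈ unitSquare) :
    ‖∑ m : Fin 2 → Fin (q + 1), g (fun a => x (m a)) * ((tensorLagr x m s : ℝ) : ℂ) - g s‖ ≤
      e * (1 + Λ) := by
  have he : 0 ≤ e := (norm_nonneg _).trans (hg s hs 0)
  have h1 : ∑ m : Fin 2 → Fin (q + 1), g (fun a => x (m a)) * ((tensorLagr x m s : ℝ) : ℂ) =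
      ∑ k, (∑ l, g (Function.update (Function.update s 0 (x k)) 1 (x l)) *
        ((lagr x l (s 1) : ℝ) : ℂ)) * ((lagr x k (s 0) : ℝ) : ℂ) := by
    rw [sum_fin_two_arrow]
    refine Finset.sum_congr rfl fun k _ => ?_
    rw [Finset.sum_mul]
    refine Finset.sum_congr rfl fun l _ => ?_
    have : (fun a => x (![k, l] a)) = Function.update (Function.update s 0 (x k)) 1 (x l) := by
      ext a; fin_cases a <;> simp
    rw [this]
    simp only [tensorLagr, Fin.prod_univ_two, Matrix.cons_val_zero, Matrix.cons_val_one]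
    push_cast
    ring
  have h2 : ∀ k, ‖∑ l, g (Function.update (Function.update s 0 (x k)) 1 (x l)) *
        ((lagr x l (s 1) : ℝ) : ℂ) - g (Function.update s 0 (x k))‖ ≤ e := by
    intro k
    have := hg _ (update_mem_unitSquare hs 0 (hmem k)) 1
    simpa using this
  have h3 := hg s hs 0
  rw [h1]
  have hsplit : ∑ k, (∑ l, g (Function.update (Function.update s 0 (x k)) 1 (x l)) *
        ((lagr x l (s 1) : ℝ) : ℂ)) * ((lagr x k (s 0) : ℝ) : ℂ) - g s =
      ∑ k, (∑ l, g (Function.update (Function.update s 0 (x k)) 1 (x l)) *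
        ((lagr x l (s 1) : ℝ) : ℂ) - g (Function.update s 0 (x k))) * ((lagr x k (s 0) : ℝ) : ℂ) +
      (∑ k, g (Function.update s 0 (x k)) * ((lagr x k (s 0) : ℝ) : ℂ) - g s) := by
    simp only [sub_mul, Finset.sum_sub_distrib]
    ring
  rw [hsplit]
  refine (norm_add_le _ _).trans ?_
  have h4 : ‖∑ k, (∑ l, g (Function.update (Function.update s 0 (x k)) 1 (x l)) *
        ((lagr x l (s 1) : ℝ) : ℂ) - g (Function.update s 0 (x k))) *
        ((lagr x k (s 0) : ℝ) : ℂ)‖ ≤ e * Λ := by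
    calc _ ≤ ∑ k, e * |lagr x k (s 0)| := by
          refine (norm_sum_le _ _).trans (Finset.sum_le_sum fun k _ => ?_)
          rw [norm_mul, Complex.norm_real, Real.norm_eq_abs]
          gcongr
          exact h2 k
      _ ≤ _ := by
          rw [← Finset.mul_sum]
          gcongr
          exact hΛ _ ⟨hs.1 0, hs.2 0⟩
  linarith

/-- The error of the interpolation in four variables is controlled by the errors of the
interpolation in the single variables. -/
lemma norm_interp_sub_le {q : ℕ} {x : Fin (q + 1) → ℝ} {Λ e : ℝ}
    (hmem : ∀ k, x k ∈ Icc (0 : ℝ) 1) (h1Λ : 1 ≤ Λ)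
    (hΛ : ∀ s ∈ Icc (0 : ℝ) 1, ∑ k, |lagr x k s| ≤ Λ) {K : R2 → R2 → ℂ}
    (h1 : ∀ s ∈ unitSquare, ∀ t ∈ unitSquare, ∀ α : Fin 2,
      ‖∑ k, K (Function.update s α (x k)) t * ((lagr x k (s α) : ℝ) : ℂ) - K s t‖ ≤ e)
    (h2 : ∀ s ∈ unitSquare, ∀ t ∈ unitSquare, ∀ α : Fin 2,
      ‖∑ k, K s (Function.update t α (x k)) * ((lagr x k (t α) : ℝ) : ℂ) - K s t‖ ≤ e)
    {s t : R2} (hs : s ∈ unitSquare) (ht : t ∈ unitSquare) :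
    ‖interp x K s t - K s t‖ ≤ 4 * e * Λ ^ 3 := by
  have he : 0 ≤ e := (norm_nonneg _).trans (h1 s hs t ht 0)
  have hA := norm_tensor_interpolation_sub_le hmem hΛ (g := fun s => K s t)
    (fun s hs α => h1 s hs t ht α) hs
  have hB : ∀ m : Fin 2 → Fin (q + 1),
      ‖∑ m' : Fin 2 → Fin (q + 1), K (fun a => x (m a)) (fun a => x (m' a)) *
        ((tensorLagr x m' t : ℝ) : ℂ) - K (fun a => x (m a)) t‖ ≤ e * (1 + Λ) := fun m =>
    norm_tensor_interpolation_sub_le hmem hΛ (g := fun t => K (fun a => x (m a)) t)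
      (fun t ht α => h2 _ (node_mem_unitSquare hmem m) t ht α) ht
  have hsplit : interp x K s t - K s t =
      ∑ m : Fin 2 → Fin (q + 1), (∑ m' : Fin 2 → Fin (q + 1),
        K (fun a => x (m a)) (fun a => x (m' a)) * ((tensorLagr x m' t : ℝ) : ℂ) -
          K (fun a => x (m a)) t) * ((tensorLagr x m s : ℝ) : ℂ) +
      (∑ m : Fin 2 → Fin (q + 1), K (fun a => x (m a)) t * ((tensorLagr x m s : ℝ) : ℂ) -
        K s t) := by
    simp only [sub_mul, Finset.sum_sub_distrib, interp, Finset.sum_mul]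
    have : ∀ m m' : Fin 2 → Fin (q + 1), K (fun a => x (m a)) (fun a => x (m' a)) *
        ((tensorLagr x m s * tensorLagr x m' t : ℝ) : ℂ) =
        K (fun a => x (m a)) (fun a => x (m' a)) * ((tensorLagr x m' t : ℝ) : ℂ) *
          ((tensorLagr x m s : ℝ) : ℂ) := by
      intro m m'; push_cast; ring
    simp only [this]
    ring
  rw [hsplit]
  refine (norm_add_le _ _).trans ?_
  have hC : ‖∑ m : Fin 2 → Fin (q + 1), (∑ m' : Fin 2 → Fin (q + 1),
        K (fun a => x (m a)) (fun a => x (m' a)) * ((tensorLagr x m' t : ℝ) : ℂ) -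
          K (fun a => x (m a)) t) * ((tensorLagr x m s : ℝ) : ℂ)‖ ≤ e * (1 + Λ) * Λ ^ 2 := by
    calc _ ≤ ∑ m, e * (1 + Λ) * |tensorLagr x m s| := by
          refine (norm_sum_le _ _).trans (Finset.sum_le_sum fun m _ => ?_)
          rw [norm_mul, Complex.norm_real, Real.norm_eq_abs]
          gcongr
          exact hB m
      _ ≤ _ := by
          rw [← Finset.mul_sum]
          gcongr
          exact sum_abs_tensorLagr_le hΛ hs
  -- Each of the four terms of `(1 + Λ) (Λ² + 1)` is at most `Λ³`, because `Λ ≥ 1`.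
  have hfin : e * (1 + Λ) * Λ ^ 2 + e * (1 + Λ) ≤ 4 * e * Λ ^ 3 := by
    have h5 : (1 + Λ) * (Λ ^ 2 + 1) ≤ 4 * Λ ^ 3 := by
      nlinarith [mul_self_nonneg (Λ - 1), mul_nonneg (sub_nonneg.2 h1Λ) (sq_nonneg Λ),
        mul_nonneg (sub_nonneg.2 h1Λ) (sub_nonneg.2 h1Λ)]
    calc _ = e * ((1 + Λ) * (Λ ^ 2 + 1)) := by ring
      _ ≤ e * (4 * Λ ^ 3) := by gcongr
      _ = _ := by ring
  linarith

/-! ### Geometry of the clusters -/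

/-- The affine map of the reference domain onto the subsquare of a cluster. -/
def subMap {N j : ℕ} (l : Cluster N j) (s : R2) : R2 := fun a => (((l.2 a : ℕ) : ℝ) + s a) / 2 ^ j

lemma clusterMap_eq {N j : ℕ} (F : Fin N → R2 → R3) (l : Cluster N j) :
    clusterMap F l = F l.1 ∘ subMap l := rfl

lemma subMap_mem {N j : ℕ} (l : Cluster N j) {s : R2} (hs : s ∈ unitSquare) :
    subMap l s ∈ unitSquare := by
  have hp : (0 : ℝ) < 2 ^ j := by positivity
  constructor <;> intro a
  · have := hs.1 a
    simp only [subMap, Pi.zero_apply] at this ⊢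
    positivity
  · have h1 := hs.2 a
    have h2 : ((l.2 a : ℕ) : ℝ) + 1 ≤ 2 ^ j := by exact_mod_cast (l.2 a).isLt
    simp only [subMap, Pi.one_apply] at h1 ⊢
    rw [div_le_one hp]
    linarith

lemma hasFDerivAt_subMap {N j : ℕ} (l : Cluster N j) (s : R2) :
    HasFDerivAt (subMap l) (((2 : ℝ) ^ j)⁻¹ • ContinuousLinearMap.id ℝ R2) s := by
  have : subMap l = fun s => (fun a => ((l.2 a : ℕ) : ℝ) / 2 ^ j) + ((2 : ℝ) ^ j)⁻¹ • s := by
    ext s a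
    simp [subMap, div_eq_inv_mul, mul_add]
  rw [this]
  exact ((hasFDerivAt_id (𝕜 := ℝ) s).const_smul ((2 : ℝ) ^ j)⁻¹).const_add
    (fun a => ((l.2 a : ℕ) : ℝ) / 2 ^ j)

lemma continuous_subMap {N j : ℕ} (l : Cluster N j) : Continuous (subMap l) := by
  unfold subMap; fun_prop

/-! ### Derivatives, surface elements and lower Lipschitz bounds of the patches -/

section Derivatives

variable {N : ℕ} {F : Fin N → R2 → R3} {Ω : Set R3}

lemma partialD_clusterMap (hF : IsMultipatchBoundary F Ω) {j : ℕ} (l : Cluster N j) (α : Fin 2)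
    {s : R2} (hs : s ∈ unitSquare) :
    partialD (clusterMap F l) α s = ((2 : ℝ) ^ j)⁻¹ • partialD (F l.1) α (subMap l s) := by
  have h1 : HasFDerivAt (F l.1) (fderiv ℝ (F l.1) (subMap l s)) (subMap l s) :=
    (hF.analytic l.1 _ (subMap_mem l hs)).differentiableAt.hasFDerivAt
  have h2 := h1.comp s (hasFDerivAt_subMap l s)
  rw [partialD, clusterMap_eq, h2.fderiv]
  simp [partialD]

lemma normalVec_clusterMap (hF : IsMultipatchBoundary F Ω) {j : ℕ} (l : Cluster N j)
    {s : R2} (hs : s ∈ unitSquare) :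
    normalVec (clusterMap F l) s = ((4 : ℝ) ^ j)⁻¹ • normalVec (F l.1) (subMap l s) := by
  have h4 : ((4 : ℝ) ^ j)⁻¹ = ((2 : ℝ) ^ j)⁻¹ * ((2 : ℝ) ^ j)⁻¹ := by
    rw [← mul_inv, ← mul_pow]; norm_num
  rw [normalVec, partialD_clusterMap hF l 0 hs, partialD_clusterMap hF l 1 hs, normalVec, h4,
    WithLp.ofLp_smul, WithLp.ofLp_smul, map_smul, map_smul, LinearMap.smul_apply, smul_smul]
  rfl

lemma surfElt_clusterMap (hF : IsMultipatchBoundary F Ω) {j : ℕ} (l : Cluster N j)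
    {s : R2} (hs : s ∈ unitSquare) :
    surfElt (clusterMap F l) s = ((4 : ℝ) ^ j)⁻¹ * surfElt (F l.1) (subMap l s) := by
  rw [surfElt, normalVec_clusterMap hF l hs, norm_smul, surfElt, Real.norm_of_nonneg (by positivity)]

lemma analyticOnNhd_partialD (hF : IsMultipatchBoundary F Ω) (i : Fin N) (α : Fin 2) :
    AnalyticOnNhd ℝ (partialD (F i) α) unitSquare := fun s hs =>
  (ContinuousLinearMap.analyticAt (ContinuousLinearMap.apply ℝ R3 (Pi.single α 1 : R2)) _).comp
    ((hF.analytic i).fderiv s hs)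

lemma continuousOn_normalVec (hF : IsMultipatchBoundary F Ω) (i : Fin N) :
    ContinuousOn (normalVec (F i)) unitSquare := by
  have h : ∀ α k, ContinuousOn (fun s => partialD (F i) α s k) unitSquare := fun α k =>
    (EuclideanSpace.proj (𝕜 := ℝ) k).continuous.comp_continuousOn
      (analyticOnNhd_partialD hF i α).continuousOn
  refine (PiLp.continuous_toLp 2 _).comp_continuousOn (continuousOn_pi.2 fun k => ?_)
  simp only [cross_apply]
  fin_cases k <;>
  simp only [Fin.zero_eta, Fin.mk_one, Fin.reduceFinMk, Matrix.cons_val] <;>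
  exact ((h _ _).mul (h _ _)).sub ((h _ _).mul (h _ _))

lemma continuousOn_surfElt (hF : IsMultipatchBoundary F Ω) (i : Fin N) :
    ContinuousOn (surfElt (F i)) unitSquare := (continuousOn_normalVec hF i).norm

/-- In a vanishing combination of the two tangent vectors, the cross product with one of them
isolates the coefficient of the other, times the nonzero normal. -/
lemma fderiv_injective (hF : IsMultipatchBoundary F Ω) (i : Fin N) {s : R2} (hs : s ∈ unitSquare) :
    Function.Injective (fderiv ℝ (F i) s) := by
  have hn := hF.regular i s hs
  rw [injective_iff_map_eq_zero]
  intro v hv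
  have h1 : v = v 0 • (Pi.single 0 (1 : ℝ) : R2) + v 1 • (Pi.single 1 (1 : ℝ) : R2) := by
    ext a; fin_cases a <;> simp
  rw [h1, map_add, map_smul, map_smul] at hv
  change v 0 • partialD (F i) 0 s + v 1 • partialD (F i) 1 s = 0 at hv
  have hv' : v 0 • (partialD (F i) 0 s).ofLp + v 1 • (partialD (F i) 1 s).ofLp = 0 := by
    have := congrArg WithLp.ofLp hv
    simpa using this
  have hc : crossProduct (partialD (F i) 0 s).ofLp (partialD (F i) 1 s).ofLp ≠ 0 := by
    intro h; apply hn; rw [normalVec, h]; rfl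
  have h0 : v 0 = 0 := by
    have := congrArg (fun w => crossProduct w (partialD (F i) 1 s).ofLp) hv'
    simp only [map_add, map_smul, LinearMap.add_apply, LinearMap.smul_apply, cross_self, smul_zero,
      add_zero, map_zero, LinearMap.zero_apply] at this
    exact (smul_eq_zero.1 this).resolve_right hc
  have h1' : v 1 = 0 := by
    have := congrArg (fun w => crossProduct (partialD (F i) 0 s).ofLp w) hv'
    simp only [map_add, map_smul, cross_self, smul_zero, zero_add, map_zero] at this
    exact (smul_eq_zero.1 this).resolve_right hc
  ext a; fin_cases a <;> simp [h0, h1']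

lemma norm_sub_le_one_of_mem_unitSquare {s t : R2} (hs : s ∈ unitSquare) (ht : t ∈ unitSquare) :
    ‖s - t‖ ≤ 1 := by
  rw [pi_norm_le_iff_of_nonneg zero_le_one]
  intro a
  have h1 := hs.1 a; have h2 := hs.2 a; have h3 := ht.1 a; have h4 := ht.2 a
  simp only [Pi.zero_apply, Pi.one_apply] at h1 h2 h3 h4
  rw [Pi.sub_apply, Real.norm_eq_abs, abs_le]
  constructor <;> linarith

/-- The bound is local on the compact set of pairs. Near the diagonal it follows from strict
differentiability with an injective derivative; away from it, injectivity and continuity bound the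
distance of the images from below, and the parameters are at most `1` apart. -/
lemma exists_bilipschitz_patch (hF : IsMultipatchBoundary F Ω) (i : Fin N) :
    ∃ c > 0, ∀ s ∈ unitSquare, ∀ t ∈ unitSquare, c * ‖s - t‖ ≤ ‖F i s - F i t‖ := by
  have key : ∃ c > 0, ∀ p ∈ unitSquare ×ˢ unitSquare, c * ‖p.1 - p.2‖ ≤ ‖F i p.1 - F i p.2‖ := by
    refine (isCompact_unitSquare.prod isCompact_unitSquare).induction_on
      (p := fun U => ∃ c > (0 : ℝ), ∀ p ∈ U, c * ‖p.1 - p.2‖ ≤ ‖F i p.1 - F i p.2‖) ?_ ?_ ?_ ?_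
    · exact ⟨1, one_pos, by simp⟩
    · rintro U V hUV ⟨c, hc, h⟩
      exact ⟨c, hc, fun p hp => h p (hUV hp)⟩
    · rintro U V ⟨c, hc, h⟩ ⟨c', hc', h'⟩
      refine ⟨min c c', lt_min hc hc', ?_⟩
      rintro p (hp | hp)
      · exact (mul_le_mul_of_nonneg_right (min_le_left _ _) (norm_nonneg _)).trans (h p hp)
      · exact (mul_le_mul_of_nonneg_right (min_le_right _ _) (norm_nonneg _)).trans (h' p hp)
    · rintro ⟨s₀, t₀⟩ ⟨hs₀, ht₀⟩
      by_cases hst : s₀ = t₀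
      · subst hst
        have hstrict := (hF.analytic i s₀ hs₀).hasStrictFDerivAt
        obtain ⟨K, hK0, hK⟩ := LinearMap.exists_antilipschitzWith
          (fderiv ℝ (F i) s₀ : R2 →ₗ[ℝ] R3) (LinearMap.ker_eq_bot.2 (fderiv_injective hF i hs₀))
        have hK' : (0 : ℝ) < K := by exact_mod_cast hK0
        have hlow : ∀ v : R2, ‖v‖ ≤ K * ‖fderiv ℝ (F i) s₀ v‖ := fun v => by
          have := hK.le_mul_norm_sub v 0
          simpa using this
        -- The derivative expands by at least `1 / K`; a linearization error of half that size
        -- leaves the constant `1 / (2 K)`.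
        have hev := hstrict.isLittleO.def (c := 1 / (2 * K)) (by positivity)
        refine ⟨{p | ‖F i p.1 - F i p.2 - fderiv ℝ (F i) s₀ (p.1 - p.2)‖ ≤
          1 / (2 * K) * ‖p.1 - p.2‖}, mem_nhdsWithin_of_mem_nhds hev, 1 / (2 * K), by positivity, ?_⟩
        intro p hp
        have h1 := hlow (p.1 - p.2)
        have h2 : ‖p.1 - p.2‖ / K ≤ ‖fderiv ℝ (F i) s₀ (p.1 - p.2)‖ := by
          rw [div_le_iff₀ hK']; linarith
        have h3 := norm_sub_norm_le (fderiv ℝ (F i) s₀ (p.1 - p.2)) (F i p.1 - F i p.2)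
        rw [norm_sub_rev (fderiv ℝ (F i) s₀ (p.1 - p.2))] at h3
        have h4 : ‖F i p.1 - F i p.2 - fderiv ℝ (F i) s₀ (p.1 - p.2)‖ ≤
          1 / (2 * K) * ‖p.1 - p.2‖ := hp
        have h5 : ‖p.1 - p.2‖ / K = 1 / (2 * K) * ‖p.1 - p.2‖ + 1 / (2 * K) * ‖p.1 - p.2‖ := by
          field_simp; ring
        linarith
      · have hne : F i s₀ - F i t₀ ≠ 0 := fun h =>
          hst (hF.injective i hs₀ ht₀ (sub_eq_zero.1 h))
        have hcont : ContinuousAt (fun p : R2 × R2 => ‖F i p.1 - F i p.2‖) (s₀, t₀) :=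
          (((hF.analytic i s₀ hs₀).continuousAt.comp continuousAt_fst).sub
            ((hF.analytic i t₀ ht₀).continuousAt.comp continuousAt_snd)).norm
        have hpos := norm_pos_iff.2 hne
        have hev := hcont.eventually (lt_mem_nhds (half_lt_self hpos))
        refine ⟨{p | ‖F i s₀ - F i t₀‖ / 2 < ‖F i p.1 - F i p.2‖} ∩ unitSquare ×ˢ unitSquare,
          Filter.inter_mem (mem_nhdsWithin_of_mem_nhds hev) self_mem_nhdsWithin,
          ‖F i s₀ - F i t₀‖ / 2, by positivity, ?_⟩
        rintro p ⟨hp, hp1, hp2⟩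
        have h1 := norm_sub_le_one_of_mem_unitSquare hp1 hp2
        have h2 : ‖F i s₀ - F i t₀‖ / 2 < ‖F i p.1 - F i p.2‖ := hp
        nlinarith
  obtain ⟨c, hc, h⟩ := key
  exact ⟨c, hc, fun s hs t ht => h (s, t) ⟨hs, ht⟩⟩

/-- A positive lower bound that each of finitely many antitone conditions admits is admitted by all
of them. -/
lemma exists_pos_forall_fin {N : ℕ} {P : Fin N → ℝ → Prop}
    (hP : ∀ i, ∃ c > 0, P i c) (hmono : ∀ i c c', 0 < c' → c' ≤ c → P i c → P i c') :
    ∃ c > 0, ∀ i, P i c := by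
  choose c hc h using hP
  have hev : ∀ᶠ d in nhdsWithin (0 : ℝ) (Ioi 0), ∀ i, P i d := by
    rw [Filter.eventually_all]
    intro i
    filter_upwards [Ioo_mem_nhdsGT (hc i)] with d hd
    exact hmono i _ _ hd.1 hd.2.le (h i)
  obtain ⟨d, hd, hd0⟩ := (hev.and self_mem_nhdsWithin).exists
  exact ⟨d, hd0, hd⟩

lemma exists_forall_fin_le {N : ℕ} {P : Fin N → ℝ → Prop}
    (hP : ∀ i, ∃ M, P i M) (hmono : ∀ i M M', M ≤ M' → P i M → P i M') :
    ∃ M, 0 ≤ M ∧ ∀ i, P i M := by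
  choose M h using hP
  obtain ⟨B, hB⟩ := Finite.exists_le M
  exact ⟨max 0 B, le_max_left _ _, fun i => hmono i _ _ ((hB i).trans (le_max_right _ _)) (h i)⟩

lemma exists_bilipschitz (hF : IsMultipatchBoundary F Ω) :
    ∃ c > 0, ∀ i, ∀ s ∈ unitSquare, ∀ t ∈ unitSquare, c * ‖s - t‖ ≤ ‖F i s - F i t‖ :=
  exists_pos_forall_fin (P := fun i c => ∀ s ∈ unitSquare, ∀ t ∈ unitSquare,
    c * ‖s - t‖ ≤ ‖F i s - F i t‖) (exists_bilipschitz_patch hF)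
    fun _ _ _ _ hc h s hs t ht =>
      (mul_le_mul_of_nonneg_right hc (norm_nonneg _)).trans (h s hs t ht)

lemma exists_forall_norm_le {E : Type*} [NormedAddCommGroup E] {f : Fin N → R2 → E}
    (hf : ∀ i, ContinuousOn (f i) unitSquare) :
    ∃ M, 0 ≤ M ∧ ∀ i, ∀ s ∈ unitSquare, ‖f i s‖ ≤ M :=
  exists_forall_fin_le (P := fun i M => ∀ s ∈ unitSquare, ‖f i s‖ ≤ M)
    (fun i => isCompact_unitSquare.exists_bound_of_continuousOn (hf i))
    fun _ _ _ hM h s hs => (h s hs).trans hM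

lemma exists_surfElt_lower_bound (hF : IsMultipatchBoundary F Ω) :
    ∃ c > 0, ∀ i, ∀ s ∈ unitSquare, c ≤ surfElt (F i) s := by
  refine exists_pos_forall_fin (P := fun i c => ∀ s ∈ unitSquare, c ≤ surfElt (F i) s)
    (fun i => ?_) fun _ _ _ _ hc h s hs => hc.trans (h s hs)
  obtain ⟨s₀, hs₀, hmin⟩ := isCompact_unitSquare.exists_isMinOn ⟨0, by simp [unitSquare]⟩
    (continuousOn_surfElt hF i)
  exact ⟨surfElt (F i) s₀, norm_pos_iff.2 (hF.regular i s₀ hs₀), fun s hs => hmin hs⟩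

lemma continuousOn_clusterMap (hF : IsMultipatchBoundary F Ω) {j : ℕ} (l : Cluster N j) :
    ContinuousOn (clusterMap F l) unitSquare :=
  (hF.analytic l.1).continuousOn.comp (continuous_subMap l).continuousOn fun _ hs => subMap_mem l hs

lemma isCompact_clusterSet (hF : IsMultipatchBoundary F Ω) {j : ℕ} (l : Cluster N j) :
    IsCompact (clusterSet F l) := isCompact_unitSquare.image_of_continuousOn (continuousOn_clusterMap hF l)

/-! ### Distances of clusters, and admissibility along the cluster tree -/

lemma setDist_le {A B : Set R3} {a b : R3} (ha : a ∈ A) (hb : b ∈ B) : setDist A B ≤ dist a b :=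
  csInf_le ⟨0, by rintro _ ⟨x, _, y, _, rfl⟩; exact dist_nonneg⟩ ⟨a, ha, b, hb, rfl⟩

lemma setDist_nonneg (A B : Set R3) : 0 ≤ setDist A B :=
  Real.sInf_nonneg (by rintro _ ⟨x, _, y, _, rfl⟩; exact dist_nonneg)

/-- The points of admissible clusters keep a distance of the order of the mesh size. -/
lemma Admissible.le_dist (hF : IsMultipatchBoundary F Ω) {η c : ℝ} (hη : η ∈ Ioo (0 : ℝ) 1)
    (hc : ∀ i, ∀ s ∈ unitSquare, ∀ t ∈ unitSquare, c * ‖s - t‖ ≤ ‖F i s - F i t‖)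
    {j : ℕ} {l l' : Cluster N j} (h : Admissible F η l l') {s t : R2}
    (hs : s ∈ unitSquare) (ht : t ∈ unitSquare) :
    c * ((2 : ℝ) ^ j)⁻¹ ≤ ‖clusterMap F l s - clusterMap F l' t‖ := by
  have h0 : (0 : R2) ∈ unitSquare := by simp [unitSquare]
  have h1 : (1 : R2) ∈ unitSquare := by simp [unitSquare]
  -- The images of two opposite corners show that the diameter is at least `c 2⁻ʲ`; admissibility
  -- with `η < 1` transfers this lower bound to the distance.
  have hdiff : subMap l 1 - subMap l 0 = fun _ => ((2 : ℝ) ^ j)⁻¹ := by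
    ext a; simp [subMap]; field_simp; ring
  have hd1 := hc l.1 _ (subMap_mem l h1) _ (subMap_mem l h0)
  rw [hdiff, pi_norm_const, Real.norm_of_nonneg (by positivity)] at hd1
  have hd2 : ‖F l.1 (subMap l 1) - F l.1 (subMap l 0)‖ ≤ Metric.diam (clusterSet F l) := by
    rw [← dist_eq_norm]
    exact Metric.dist_le_diam_of_mem (isCompact_clusterSet hF l).isBounded ⟨1, h1, rfl⟩ ⟨0, h0, rfl⟩
  have hd3 : Metric.diam (clusterSet F l) ≤ η * setDist (clusterSet F l) (clusterSet F l') :=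
    (le_max_left _ _).trans h
  have hd4 := setDist_nonneg (clusterSet F l) (clusterSet F l')
  have hd5 : setDist (clusterSet F l) (clusterSet F l') ≤
      ‖clusterMap F l s - clusterMap F l' t‖ := by
    rw [← dist_eq_norm]; exact setDist_le ⟨s, hs, rfl⟩ ⟨t, ht, rfl⟩
  nlinarith [hη.1, hη.2]

/-- The position of a cluster within its father. -/
lemma exists_clusterMap_eq_dad (F : Fin N → R2 → R3) {j : ℕ} (l : Cluster N (j + 1)) {s : R2}
    (hs : s ∈ unitSquare) : ∃ t ∈ unitSquare, clusterMap F l s = clusterMap F (dad l) t := by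
  refine ⟨fun a => (((l.2 a : ℕ) % 2 : ℕ) + s a) / 2, ⟨fun a => ?_, fun a => ?_⟩, ?_⟩
  · have := hs.1 a
    simp only [Pi.zero_apply] at this ⊢
    positivity
  · have h1 := hs.2 a
    have h2 : (((l.2 a : ℕ) % 2 : ℕ) : ℝ) ≤ 1 := by
      exact_mod_cast Nat.lt_succ_iff.1 (Nat.mod_lt _ two_pos)
    simp only [Pi.one_apply] at h1 ⊢
    linarith
  · simp only [clusterMap, dad]
    congr 1
    ext a
    have h3 : ((l.2 a : ℕ) : ℝ) = 2 * (((l.2 a : ℕ) / 2 : ℕ) : ℝ) + (((l.2 a : ℕ) % 2 : ℕ) : ℝ) := by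
      exact_mod_cast (Nat.div_add_mod (l.2 a : ℕ) 2).symm
    rw [h3, show (2 : ℝ) ^ (j + 1) = 2 * 2 ^ j by ring]
    field_simp
    ring

lemma clusterSet_subset_dad (F : Fin N → R2 → R3) {j : ℕ} (l : Cluster N (j + 1)) :
    clusterSet F l ⊆ clusterSet F (dad l) := by
  rintro _ ⟨s, hs, rfl⟩
  obtain ⟨t, ht, h⟩ := exists_clusterMap_eq_dad F l hs
  exact ⟨t, ht, h.symm⟩

lemma clusterSet_nonempty (F : Fin N → R2 → R3) {j : ℕ} (l : Cluster N j) :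
    (clusterSet F l).Nonempty := ⟨_, 0, by simp [unitSquare], rfl⟩

/-- The sons of an admissible block are admissible. -/
lemma Admissible.of_dad (hF : IsMultipatchBoundary F Ω) {η : ℝ} (hη : 0 ≤ η) {j : ℕ}
    {l l' : Cluster N (j + 1)} (h : Admissible F η (dad l) (dad l')) : Admissible F η l l' := by
  have h1 := Metric.diam_mono (clusterSet_subset_dad F l) (isCompact_clusterSet hF _).isBounded
  have h2 := Metric.diam_mono (clusterSet_subset_dad F l') (isCompact_clusterSet hF _).isBounded
  have h3 : setDist (clusterSet F (dad l)) (clusterSet F (dad l')) ≤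
      setDist (clusterSet F l) (clusterSet F l') := by
    refine csInf_le_csInf ⟨0, ?_⟩ ((clusterSet_nonempty F l).image2 (clusterSet_nonempty F l'))
      (image2_subset (clusterSet_subset_dad F l) (clusterSet_subset_dad F l'))
    rintro _ ⟨x, _, y, _, rfl⟩
    exact dist_nonneg
  exact (max_le_max h1 h2).trans (h.trans (by gcongr))

end Derivatives

/-! ### Interpolation error on admissible blocks -/

lemma exists_common_lineExt {ι : Type*} [Finite ι] {g : ι → R2 → ℝ}
    (hg : ∀ i, AnalyticOnNhd ℝ (g i) unitSquare) : ∃ R > 0, ∃ M, 0 ≤ M ∧ ∀ i, LineExt (g i) R M := by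
  choose R hR M h using fun i => exists_lineExt (hg i)
  obtain ⟨B, hB⟩ := Finite.exists_le M
  -- A common lower bound for the radii is obtained from an upper bound for their reciprocals; the
  -- maximum with `1` keeps it invertible.
  obtain ⟨A, hA⟩ := Finite.exists_le fun i => (R i)⁻¹
  refine ⟨(max 1 A)⁻¹, by positivity, max 0 B, le_max_left _ _, fun i => (h i).mono ?_
    ((hB i).trans (le_max_right _ _))⟩
  exact inv_le_of_inv_le₀ (hR i) ((hA i).trans (le_max_right _ _))

lemma subMap_update {N j : ℕ} (l : Cluster N j) (s : R2) (α : Fin 2) (x : ℝ) :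
    subMap l (Function.update s α x) =
      Function.update (subMap l s) α (((l.2 α : ℕ) : ℝ) / 2 ^ j + ((2 : ℝ) ^ j)⁻¹ * x) := by
  ext a
  by_cases h : a = α
  · subst h; simp [subMap]; ring
  · simp [subMap, h]

lemma subMap_offset_le {N j : ℕ} (l : Cluster N j) (α : Fin 2) :
    ((l.2 α : ℕ) : ℝ) / 2 ^ j + ((2 : ℝ) ^ j)⁻¹ ≤ 1 := by
  have h2 : ((l.2 α : ℕ) : ℝ) + 1 ≤ 2 ^ j := by exact_mod_cast (l.2 α).isLt
  rw [inv_eq_one_div, ← add_div, div_le_one (by positivity)]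
  exact h2

lemma inv_two_pow_le_one (j : ℕ) : ((2 : ℝ) ^ j)⁻¹ ≤ 1 :=
  inv_le_one_of_one_le₀ (one_le_pow₀ one_le_two)

/-- The affine map onto a dyadic subinterval contracts, so it maps the `R`-neighbourhood of the unit
interval into itself. Hence radius and bound are the same on all levels. -/
lemma LineExt.comp_subMap {g : R2 → ℝ} {R M : ℝ} (h : LineExt g R M) {N j : ℕ}
    (l : Cluster N j) : LineExt (g ∘ subMap l) R M := by
  intro s hs α
  obtain ⟨Φ, h1, h2, h3⟩ := h _ (subMap_mem l hs) α
  set a : ℝ := ((l.2 α : ℕ) : ℝ) / 2 ^ j with ha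
  set b : ℝ := ((2 : ℝ) ^ j)⁻¹ with hb
  have hb0 : 0 < b := by positivity
  have hb1 : b ≤ 1 := inv_two_pow_le_one j
  have hab : a + b ≤ 1 := subMap_offset_le l α
  have ha0 : 0 ≤ a := by positivity
  have hmem : ∀ x ∈ Icc (0 : ℝ) 1, a + b * x ∈ Icc (0 : ℝ) 1 := fun x hx =>
    ⟨by nlinarith [hx.1], by nlinarith [hx.2]⟩
  have hmap : MapsTo (fun z : ℂ => (a + b * z : ℂ)) (segNhd R) (segNhd R) := by
    rintro z ⟨x, hx, hz⟩
    refine ⟨a + b * x, hmem x hx, ?_⟩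
    rw [show (a + b * z : ℂ) - ((a + b * x : ℝ) : ℂ) = b * (z - x) by push_cast; ring, norm_mul,
      Complex.norm_real, Real.norm_of_nonneg hb0.le]
    nlinarith [norm_nonneg (z - x)]
  refine ⟨fun z => Φ (a + b * z), h1.comp (by fun_prop) hmap, fun z hz => h2 _ (hmap hz), ?_⟩
  intro x hx
  have := h3 _ (hmem x hx)
  push_cast at this
  change Φ (a + b * x) = _
  rw [this, Function.comp_apply, subMap_update]

/-- This serves for inner products of tangent vectors: with one of the two points frozen they are
linear combinations of components at the other. -/
lemma LineExt.sum_mul_const {ι : Type*} (u : Finset ι) {g : ι → R2 → ℝ} {R M : ℝ}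
    (h : ∀ i, LineExt (g i) R M) {b : ι → ℝ} {B : ℝ} (hb : ∀ i, |b i| ≤ B) :
    LineExt (fun s => ∑ i ∈ u, g i s * b i) R (u.card * (M * B)) := by
  intro s hs α
  choose Φ h1 h2 h3 using fun i => h i s hs α
  refine ⟨fun z => ∑ i ∈ u, Φ i z * b i, ?_, ?_, ?_⟩
  · exact DifferentiableOn.fun_sum fun i _ => (h1 i).mul_const _
  · intro z hz
    refine (norm_sum_le _ _).trans ?_
    rw [← nsmul_eq_mul]
    refine Finset.sum_le_card_nsmul _ _ _ fun i _ => ?_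
    rw [norm_mul, Complex.norm_real, Real.norm_eq_abs]
    have := h2 i z hz
    exact mul_le_mul this (hb i) (abs_nonneg _) ((norm_nonneg _).trans this)
  · intro x hx
    push_cast
    exact Finset.sum_congr rfl fun i _ => by rw [h3 i x hx]

lemma helmholtz_sub_comm (κ : ℝ) (a b : R3) : helmholtz κ (a - b) = helmholtz κ (b - a) := by
  rw [helmholtz, helmholtz, norm_sub_rev]

section

variable {N : ℕ} {F : Fin N → R2 → R3} {Ω : Set R3}

/-- A coordinate line of the cluster is a piece of parameter length `h = 2⁻ʲ` of a coordinate line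
of its patch, so `exists_kernel_extension` applies with constants common to all levels; its bound `B
/ h` becomes `B 2ʲ`. -/
lemma exists_clusterKernel_extension (hF : IsMultipatchBoundary F Ω) {κ : ℝ} (hκ : 0 < κ) {c D : ℝ}
    (hc : 0 < c) :
    ∃ δ₀ > 0, ∃ B, 0 ≤ B ∧ ∀ (j : ℕ) (l : Cluster N j) (y : R3),
      (∀ s ∈ unitSquare, c * ((2 : ℝ) ^ j)⁻¹ ≤ ‖clusterMap F l s - y‖ ∧
        ‖clusterMap F l s - y‖ ≤ D) →
      ∀ s ∈ unitSquare, ∀ α : Fin 2, ∃ H : ℂ → ℂ, DifferentiableOn ℂ H (segNhd δ₀) ∧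
        (∀ z ∈ segNhd δ₀, ‖H z‖ ≤ B * 2 ^ j) ∧
        ∀ x ∈ Icc (0 : ℝ) 1, H x = helmholtz κ (clusterMap F l (Function.update s α x) - y) := by
  have hana : ∀ p : Fin N × Fin 3, AnalyticOnNhd ℝ (fun s => F p.1 s p.2) unitSquare := fun p s hs =>
    (ContinuousLinearMap.analyticAt (EuclideanSpace.proj (𝕜 := ℝ) p.2 : R3 →L[ℝ] ℝ) _).comp
      (hF.analytic p.1 s hs)
  obtain ⟨R, hR, M, hM, hext⟩ := exists_common_lineExt hana
  obtain ⟨δ, hδ, -, B, hB, hker⟩ := exists_kernel_extension (D := D) hκ hR hM hc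
  refine ⟨δ, hδ, B, hB, fun j l y hy s hs α => ?_⟩
  choose Φ h1 h2 h3 using fun k => hext (l.1, k) _ (subMap_mem l hs) α
  have hcm : ∀ x : ℝ, F l.1 (Function.update (subMap l s) α
      (((l.2 α : ℕ) : ℝ) / 2 ^ j + ((2 : ℝ) ^ j)⁻¹ * x)) =
      clusterMap F l (Function.update s α x) := fun x => by
    rw [clusterMap_eq, Function.comp_apply, subMap_update]
  obtain ⟨H, hH1, hH2, hH3⟩ := hker Φ (fun x => F l.1 (Function.update (subMap l s) α x)) h1 h2 h3
    (((l.2 α : ℕ) : ℝ) / 2 ^ j) ((2 : ℝ) ^ j)⁻¹ (by positivity) (inv_two_pow_le_one j)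
    (by positivity) (subMap_offset_le l α) y (fun x hx => by
      rw [hcm]; exact hy _ (update_mem_unitSquare hs α hx))
  refine ⟨H, hH1, fun z hz => ?_, fun x hx => by rw [hH3 x hx, hcm]⟩
  simpa [div_eq_mul_inv] using hH2 z hz

/-- The interpolation error of the localized kernel with an analytic weight decays exponentially,
uniformly in all admissible blocks, up to a loss of one power of the mesh size. -/
lemma exists_weighted_interp_error (hF : IsMultipatchBoundary F Ω) {κ η : ℝ} (hκ : 0 < κ)
    (hη : η ∈ Ioo (0 : ℝ) 1) {R M : ℝ} (hR : 0 < R) (hM : 0 ≤ M) :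
    ∃ δ > 0, ∃ B, 0 ≤ B ∧ ∀ {q : ℕ} {x : Fin (q + 1) → ℝ}, Function.Injective x →
      (∀ k, x k ∈ Icc (0 : ℝ) 1) → ∀ Λ : ℝ, 1 ≤ Λ →
      (∀ s ∈ Icc (0 : ℝ) 1, ∑ k, |lagr x k s| ≤ Λ) →
      ∀ (j : ℕ) (l l' : Cluster N j), Admissible F η l l' → ∀ W : R2 → R2 → ℝ,
      (∀ t ∈ unitSquare, LineExt (fun s => W s t) R M) → (∀ s ∈ unitSquare, LineExt (W s) R M) →
      ∀ s ∈ unitSquare, ∀ t ∈ unitSquare,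
        ‖interp x (fun s t => locKernel κ F l l' s t * ((W s t : ℝ) : ℂ)) s t -
          locKernel κ F l l' s t * ((W s t : ℝ) : ℂ)‖ ≤ B * 2 ^ j * (1 + δ)⁻¹ ^ q * Λ ^ 4 := by
  obtain ⟨c, hc, hbi⟩ := exists_bilipschitz hF
  obtain ⟨D, hD, hbd⟩ := exists_forall_norm_le fun i => (hF.analytic i).continuousOn
  obtain ⟨δ₀, hδ₀, B, hB, hker⟩ := exists_clusterKernel_extension hF hκ (D := D + D) hc
  set δ := min δ₀ R with hδ
  have hδ0 : 0 < δ := lt_min hδ₀ hR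
  -- The factor `16` collects `4` from four variables, `2` from `1 + Λ ≤ 2 Λ` and `2` from the
  -- Chebyshev tail; the same `1 + Λ` raises `Λ³` to `Λ⁴`.
  refine ⟨δ, hδ0, 16 * B * M / δ, by positivity, ?_⟩
  intro q x hinj hmem Λ h1Λ hΛ j l l' hadm W hW1 hW2 s hs t ht
  have hdist : ∀ s ∈ unitSquare, ∀ t ∈ unitSquare,
      c * ((2 : ℝ) ^ j)⁻¹ ≤ ‖clusterMap F l s - clusterMap F l' t‖ ∧
        ‖clusterMap F l s - clusterMap F l' t‖ ≤ D + D := fun s hs t ht =>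
    ⟨hadm.le_dist hF hη hbi hs ht, (norm_sub_le _ _).trans
      (add_le_add (hbd _ _ (subMap_mem l hs)) (hbd _ _ (subMap_mem l' ht)))⟩
  set e : ℝ := (1 + Λ) * (2 * (B * 2 ^ j * M) / δ * (1 + δ)⁻¹ ^ q) with he
  have hslice : ∀ (H Γ : ℂ → ℂ) (s : ℝ), s ∈ Icc (0 : ℝ) 1 → DifferentiableOn ℂ H (segNhd δ₀) →
      (∀ z ∈ segNhd δ₀, ‖H z‖ ≤ B * 2 ^ j) → DifferentiableOn ℂ Γ (segNhd R) →
      (∀ z ∈ segNhd R, ‖Γ z‖ ≤ M) →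
      ‖∑ k, H (x k) * Γ (x k) * ((lagr x k s : ℝ) : ℂ) - H s * Γ s‖ ≤ e := by
    intro H Γ s hs hH1 hH2 hΓ1 hΓ2
    refine norm_interpolation_sub_le (Φ := fun z => H z * Γ z) hδ0
      ((hH1.mono (segNhd_mono (min_le_left _ _))).mul (hΓ1.mono (segNhd_mono (min_le_right _ _))))
      (fun z hz => ?_) hinj hmem hs (hΛ s hs)
    rw [norm_mul]
    exact mul_le_mul (hH2 z (segNhd_mono (min_le_left _ _) hz))
      (hΓ2 z (segNhd_mono (min_le_right _ _) hz)) (norm_nonneg _) (by positivity)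
  have hcoord : ∀ s ∈ unitSquare, ∀ α : Fin 2, s α ∈ Icc (0 : ℝ) 1 := fun s hs α =>
    ⟨hs.1 α, hs.2 α⟩
  have hmain := norm_interp_sub_le (x := x) (Λ := Λ) (e := e) hmem h1Λ hΛ
    (K := fun s t => locKernel κ F l l' s t * ((W s t : ℝ) : ℂ)) ?_ ?_ hs ht
  · refine hmain.trans ?_
    calc 4 * e * Λ ^ 3 ≤ 4 * ((Λ + Λ) * (2 * (B * 2 ^ j * M) / δ * (1 + δ)⁻¹ ^ q)) * Λ ^ 3 := by
          rw [he]; gcongr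
      _ = _ := by ring
  · intro s hs t ht α
    obtain ⟨H, hH1, hH2, hH3⟩ := hker j l (clusterMap F l' t) (fun s hs => hdist s hs t ht) s hs α
    obtain ⟨Γ, hΓ1, hΓ2, hΓ3⟩ := hW1 t ht s hs α
    have h := hslice H Γ (s α) (hcoord s hs α) hH1 hH2 hΓ1 hΓ2
    rw [hH3 _ (hcoord s hs α), hΓ3 _ (hcoord s hs α), Function.update_eq_self] at h
    refine le_of_eq_of_le (congrArg norm (congrArg₂ _ (Finset.sum_congr rfl fun k _ => ?_) rfl)) h
    rw [hH3 _ (hmem k), hΓ3 _ (hmem k), locKernel]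
  · intro s hs t ht α
    obtain ⟨H, hH1, hH2, hH3⟩ := hker j l' (clusterMap F l s) (fun t ht => by
      rw [norm_sub_rev]; exact hdist s hs t ht) t ht α
    obtain ⟨Γ, hΓ1, hΓ2, hΓ3⟩ := hW2 s hs t ht α
    have h := hslice H Γ (t α) (hcoord t ht α) hH1 hH2 hΓ1 hΓ2
    rw [hH3 _ (hcoord t ht α), hΓ3 _ (hcoord t ht α), Function.update_eq_self,
      helmholtz_sub_comm] at h
    refine le_of_eq_of_le (congrArg norm (congrArg₂ _ (Finset.sum_congr rfl fun k _ => ?_) rfl)) h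
    rw [hH3 _ (hmem k), hΓ3 _ (hmem k), locKernel, helmholtz_sub_comm]

lemma LineExt.one (R : ℝ) : LineExt (fun _ => 1) R 1 := fun _ _ _ =>
  ⟨fun _ => 1, differentiableOn_const _, by simp, by simp⟩

/-- The interpolation errors of the localized kernel without and with the geometry. -/
lemma exists_interp_error (hF : IsMultipatchBoundary F Ω) {κ η : ℝ} (hκ : 0 < κ)
    (hη : η ∈ Ioo (0 : ℝ) 1) :
    ∃ δ > 0, ∃ B, 0 ≤ B ∧ ∀ {q : ℕ} {x : Fin (q + 1) → ℝ}, Function.Injective x →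
      (∀ k, x k ∈ Icc (0 : ℝ) 1) → ∀ Λ : ℝ, 1 ≤ Λ →
      (∀ s ∈ Icc (0 : ℝ) 1, ∑ k, |lagr x k s| ≤ Λ) →
      ∀ (j : ℕ) (l l' : Cluster N j), Admissible F η l l' → ∀ s ∈ unitSquare, ∀ t ∈ unitSquare,
        ‖interp x (locKernel κ F l l') s t - locKernel κ F l l' s t‖ ≤
          B * 2 ^ j * (1 + δ)⁻¹ ^ q * Λ ^ 4 ∧
        ∀ α β : Fin 2, ‖interp x (fun s t => locKernel κ F l l' s t *
            ((⟪partialD (clusterMap F l) α s, partialD (clusterMap F l') β t⟫ : ℝ) : ℂ)) s t -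
          locKernel κ F l l' s t *
            ((⟪partialD (clusterMap F l) α s, partialD (clusterMap F l') β t⟫ : ℝ) : ℂ)‖ ≤
          B * 2 ^ j * (1 + δ)⁻¹ ^ q * Λ ^ 4 := by
  have hana : ∀ p : Fin N × Fin 2 × Fin 3,
      AnalyticOnNhd ℝ (fun s => partialD (F p.1) p.2.1 s p.2.2) unitSquare := fun p s hs =>
    (ContinuousLinearMap.analyticAt (EuclideanSpace.proj (𝕜 := ℝ) p.2.2 : R3 →L[ℝ] ℝ) _).comp
      (analyticOnNhd_partialD hF p.1 p.2.1 s hs)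
  obtain ⟨R, hR, M, hM, hext⟩ := exists_common_lineExt hana
  obtain ⟨T, hT, hTb⟩ := exists_forall_fin_le (N := N)
    (P := fun i T => ∀ α, ∀ s ∈ unitSquare, ‖partialD (F i) α s‖ ≤ T)
    (fun i => by
      obtain ⟨A, hA⟩ := isCompact_unitSquare.exists_bound_of_continuousOn
        (analyticOnNhd_partialD hF i 0).continuousOn
      obtain ⟨A', hA'⟩ := isCompact_unitSquare.exists_bound_of_continuousOn
        (analyticOnNhd_partialD hF i 1).continuousOn
      refine ⟨max A A', fun α s hs => ?_⟩
      fin_cases α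
      · exact (hA s hs).trans (le_max_left _ _)
      · exact (hA' s hs).trans (le_max_right _ _))
    (fun i M M' h hM α s hs => (hM α s hs).trans h)
  obtain ⟨δ, hδ, B, hB, h⟩ := exists_weighted_interp_error hF hκ hη hR
    -- One bound for both weights: `1` for the bare kernel, and three products of components for the
    -- inner product of tangent vectors.
    (M := max 1 (3 * (M * T))) (by positivity)
  refine ⟨δ, hδ, B, hB, ?_⟩
  intro q x hinj hmem Λ h1Λ hΛ j l l' hadm s hs t ht
  constructor
  · have h1 := h hinj hmem Λ h1Λ hΛ j l l' hadm (fun _ _ => 1)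
      (fun _ _ => (LineExt.one R).mono le_rfl (le_max_left _ _))
      (fun _ _ => (LineExt.one R).mono le_rfl (le_max_left _ _)) s hs t ht
    simpa using h1
  · intro α β
    have hb0 := inv_two_pow_le_one j
    have hbn : 0 ≤ ((2 : ℝ) ^ j)⁻¹ := by positivity
    -- The inner product is expressed through the derivatives of the patches, where uniform
    -- extensions are available; the scaling `4⁻ʲ` goes to the frozen factor and is bounded by `1`.
    set W : R2 → R2 → ℝ := fun s t => ∑ k, partialD (F l.1) α (subMap l s) k *
      (((2 : ℝ) ^ j)⁻¹ * ((2 : ℝ) ^ j)⁻¹ * partialD (F l'.1) β (subMap l' t) k) with hW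
    have hWeq : ∀ s ∈ unitSquare, ∀ t ∈ unitSquare,
        ⟪partialD (clusterMap F l) α s, partialD (clusterMap F l') β t⟫ = W s t := by
      intro s hs t ht
      rw [partialD_clusterMap hF l α hs, partialD_clusterMap hF l' β ht, real_inner_smul_left,
        real_inner_smul_right, PiLp.inner_apply, hW, Finset.mul_sum, Finset.mul_sum]
      refine Finset.sum_congr rfl fun k _ => ?_
      simp only [RCLike.inner_apply, conj_trivial]
      ring
    have hcoef : ∀ (l : Cluster N j) (β : Fin 2), ∀ t ∈ unitSquare, ∀ k,
        |((2 : ℝ) ^ j)⁻¹ * ((2 : ℝ) ^ j)⁻¹ * partialD (F l.1) β (subMap l t) k| ≤ T := by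
      intro l β t ht k
      have h1 : |partialD (F l.1) β (subMap l t) k| ≤ T :=
        (PiLp.norm_apply_le (partialD (F l.1) β (subMap l t)) k).trans
          (hTb l.1 β _ (subMap_mem l ht))
      rw [abs_mul, abs_of_nonneg (by positivity)]
      have h2 : ((2 : ℝ) ^ j)⁻¹ * ((2 : ℝ) ^ j)⁻¹ ≤ 1 := mul_le_one₀ hb0 hbn hb0
      calc _ ≤ 1 * T := by gcongr
        _ = T := one_mul T
    have hcard : ((Finset.univ : Finset (Fin 3)).card : ℝ) = 3 := by simp
    have h1 := h hinj hmem Λ h1Λ hΛ j l l' hadm W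
      (fun t ht => (LineExt.sum_mul_const Finset.univ (fun k =>
        (hext (l.1, α, k)).comp_subMap l) (hcoef l' β t ht)).mono le_rfl
          (by rw [hcard]; exact le_max_right _ _))
      (fun s hs => by
        have h2 := (LineExt.sum_mul_const Finset.univ (fun k =>
          (hext (l'.1, β, k)).comp_subMap l') (hcoef l α s hs)).mono (le_refl R)
          (M' := max 1 (3 * (M * T))) (by rw [hcard]; exact le_max_right _ _)
        convert h2 using 2 with t
        refine Finset.sum_congr rfl fun k _ => ?_
        simp only [Function.comp_apply]
        ring) s hs t ht
    -- The formula for the derivatives of the cluster maps is available on the square only, which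
    -- suffices because interpolation samples the kernel only at nodes.
    have hint : interp x (fun s t => locKernel κ F l l' s t *
        ((⟪partialD (clusterMap F l) α s, partialD (clusterMap F l') β t⟫ : ℝ) : ℂ)) s t =
        interp x (fun s t => locKernel κ F l l' s t * ((W s t : ℝ) : ℂ)) s t := by
      simp only [interp]
      refine Finset.sum_congr rfl fun m _ => Finset.sum_congr rfl fun m' _ => ?_
      rw [hWeq _ (node_mem_unitSquare hmem m) _ (node_mem_unitSquare hmem m')]
    rw [hint, hWeq s hs t ht]
    exact h1

end

/-! ### Surface measures of the clusters -/

/-- The reference domain with the surface element of a parametrization as density. -/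
def refMeasure (f : R2 → R3) : Measure R2 :=
  (volume.restrict unitSquare).withDensity fun s => ENNReal.ofReal (surfElt f s)

/-- The surface measure of a parametrized patch. -/
def patchMeasure (f : R2 → R3) : Measure R3 := Measure.map f (refMeasure f)

lemma surfaceMeasure_eq {N : ℕ} (F : Fin N → R2 → R3) :
    surfaceMeasure F = ∑ i, patchMeasure (F i) := rfl

/-- The half-open subsquare of a cluster. -/
def cell {N j : ℕ} (l : Cluster N j) : Set R2 :=
  Set.pi univ fun a => Ico (((l.2 a : ℕ) : ℝ) / 2 ^ j) ((((l.2 a : ℕ) : ℝ) + 1) / 2 ^ j)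

lemma measurableSet_cell {N j : ℕ} (l : Cluster N j) : MeasurableSet (cell l) :=
  MeasurableSet.univ_pi fun _ => measurableSet_Ico

lemma measurableSet_unitSquare : MeasurableSet unitSquare := measurableSet_Icc

lemma mem_cell_iff {N j : ℕ} (l : Cluster N j) (s : R2) :
    s ∈ cell l ↔ ∀ a, ((l.2 a : ℕ) : ℝ) ≤ 2 ^ j * s a ∧ 2 ^ j * s a < ((l.2 a : ℕ) : ℝ) + 1 := by
  have hp : (0 : ℝ) < 2 ^ j := by positivity
  simp only [cell, mem_univ_pi, mem_Ico, div_le_iff₀ hp, lt_div_iff₀ hp, mul_comm]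

lemma cell_subset_unitSquare {N j : ℕ} (l : Cluster N j) : cell l ⊆ unitSquare := by
  intro s hs
  rw [mem_cell_iff] at hs
  have hp : (0 : ℝ) < 2 ^ j := by positivity
  constructor <;> intro a
  · have h1 : (0 : ℝ) ≤ 2 ^ j * s a := le_trans (by positivity) (hs a).1
    exact nonneg_of_mul_nonneg_right h1 hp
  · have h2 : ((l.2 a : ℕ) : ℝ) + 1 ≤ 2 ^ j := by exact_mod_cast (l.2 a).isLt
    have h3 := (hs a).2
    simp only [Pi.one_apply]
    by_contra h
    push Not at h
    nlinarith

/-- The preimage of the half-open cell is the half-open unit square, which differs from the closed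
one by a null set; the factor `4ʲ` compensates the planar contraction by `2⁻ʲ`. -/
lemma map_subMap_volume {N j : ℕ} (l : Cluster N j) :
    Measure.map (subMap l) (volume.restrict unitSquare) =
      ENNReal.ofReal (4 ^ j) • volume.restrict (cell l) := by
  have hp : (0 : ℝ) < 2 ^ j := by positivity
  have h1 : volume.restrict unitSquare = (volume : Measure R2).restrict (subMap l ⁻¹' cell l) := by
    have hpre : subMap l ⁻¹' cell l = Set.pi univ fun _ => Ico (0 : ℝ) 1 := by
      ext s
      simp only [mem_preimage, mem_cell_iff, mem_univ_pi, mem_Ico, subMap, mul_div_cancel₀ _ hp.ne']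
      refine forall_congr' fun a => ?_
      constructor <;> rintro ⟨h1, h2⟩ <;> constructor <;> linarith
    rw [hpre]
    exact (Measure.restrict_congr_set (Measure.univ_pi_Ico_ae_eq_Icc (f := (0 : R2)) (g := 1))).symm
  have h2 : Measure.map (subMap l) volume = ENNReal.ofReal (4 ^ j) • (volume : Measure R2) := by
    set v : R2 := fun a => ((l.2 a : ℕ) : ℝ) / 2 ^ j with hv
    have hcomp : subMap l = (fun s => v + s) ∘ fun s => ((2 : ℝ) ^ j)⁻¹ • s := by
      ext s a
      simp [subMap, hv, div_eq_inv_mul, mul_add]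
    rw [hcomp, ← Measure.map_map (measurable_const_add v) (measurable_const_smul _),
      Measure.map_addHaar_smul _ (by positivity), Measure.map_smul, map_add_left_eq_self]
    congr 2
    have h4 : ((4 : ℝ) ^ j) = (2 ^ j) ^ 2 := by rw [← pow_mul, mul_comm, pow_mul]; norm_num
    rw [Module.finrank_fintype_fun_eq_card, Fintype.card_fin, inv_pow, inv_inv, abs_of_nonneg
      (by positivity), h4]
  rw [h1, ← Measure.restrict_map (continuous_subMap l).measurable (measurableSet_cell l), h2,
    Measure.restrict_smul]

lemma map_withDensity_comp {X Y : Type*} [MeasurableSpace X] [MeasurableSpace Y] {μ : Measure X}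
    {σ : X → Y} (hσ : Measurable σ) {G : Y → ENNReal} (hG : Measurable G) :
    Measure.map σ (μ.withDensity (G ∘ σ)) = (Measure.map σ μ).withDensity G := by
  ext A hA
  rw [Measure.map_apply hσ hA, withDensity_apply _ (hσ hA), withDensity_apply _ hA,
    setLIntegral_map hA hG hσ]
  rfl

lemma cell_eq_iUnion {N j : ℕ} (l : Cluster N j) :
    cell l = ⋃ k : {k : Cluster N (j + 1) // dad k = l}, cell k.1 := by
  ext s
  simp only [mem_iUnion, mem_cell_iff]
  have hp : (0 : ℝ) < 2 ^ (j + 1) := by positivity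
  have hpow : (2 : ℝ) ^ (j + 1) = 2 * 2 ^ j := by ring
  constructor
  · intro hs
    have h0 : ∀ a, 0 ≤ 2 ^ (j + 1) * s a := fun a => by
      have : (0 : ℝ) ≤ 2 ^ j * s a := le_trans (by positivity) (hs a).1
      rw [hpow]; linarith
    have hlo : ∀ a, 2 * (l.2 a : ℕ) ≤ ⌊2 ^ (j + 1) * s a⌋₊ := fun a => by
      refine Nat.le_floor ?_
      push_cast
      rw [hpow]; linarith [(hs a).1]
    have hhi : ∀ a, ⌊2 ^ (j + 1) * s a⌋₊ < 2 * (l.2 a : ℕ) + 2 := fun a => by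
      rw [Nat.floor_lt (h0 a)]
      push_cast
      rw [hpow]; linarith [(hs a).2]
    have hlt : ∀ a, ⌊2 ^ (j + 1) * s a⌋₊ < 2 ^ (j + 1) := fun a => by
      have h3 := (l.2 a).isLt
      have h4 := hhi a
      have h5 : 2 ^ (j + 1) = 2 * 2 ^ j := by ring
      omega
    -- The son containing `s` is read off from the integer parts of the coordinates scaled by `2 ^
    -- (j + 1)`; half-open cells match the floor exactly.
    refine ⟨⟨(l.1, fun a => ⟨⌊2 ^ (j + 1) * s a⌋₊, hlt a⟩), ?_⟩, fun a => ?_⟩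
    · refine Prod.ext rfl (funext fun a => Fin.ext ?_)
      have h4 := hhi a
      have h5 := hlo a
      simp only [dad]
      omega
    · exact ⟨Nat.floor_le (h0 a), Nat.lt_floor_add_one _⟩
  · rintro ⟨⟨k, rfl⟩, hk⟩ a
    have h1 := hk a
    have h3 : ((k.2 a : ℕ) : ℝ) = 2 * (((k.2 a : ℕ) / 2 : ℕ) : ℝ) + (((k.2 a : ℕ) % 2 : ℕ) : ℝ) := by
      exact_mod_cast (Nat.div_add_mod (k.2 a : ℕ) 2).symm
    have h4 : (((k.2 a : ℕ) % 2 : ℕ) : ℝ) ≤ 1 := by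
      exact_mod_cast Nat.lt_succ_iff.1 (Nat.mod_lt _ two_pos)
    have h5 : (0 : ℝ) ≤ (((k.2 a : ℕ) % 2 : ℕ) : ℝ) := by positivity
    have h6 : (2 : ℝ) ^ (j + 1) * s a = 2 * (2 ^ j * s a) := by ring
    simp only [dad]
    constructor <;> linarith [h1.1, h1.2]

lemma pairwise_disjoint_cell {N j : ℕ} (l : Cluster N j) :
    Pairwise (Function.onFun Disjoint fun k : {k : Cluster N (j + 1) // dad k = l} => cell k.1) := by
  rintro ⟨k, hk⟩ ⟨k', hk'⟩ hne
  rw [Function.onFun, Set.disjoint_left]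
  intro s hs hs'
  refine hne (Subtype.ext (Prod.ext ?_ (funext fun a => Fin.ext ?_)))
  · have h1 := congrArg Prod.fst hk
    have h2 := congrArg Prod.fst hk'
    exact h1.trans h2.symm
  · rw [mem_cell_iff] at hs hs'
    have h1 : ((k.2 a : ℕ) : ℝ) < ((k'.2 a : ℕ) : ℝ) + 1 := (hs a).1.trans_lt (hs' a).2
    have h2 : ((k'.2 a : ℕ) : ℝ) < ((k.2 a : ℕ) : ℝ) + 1 := (hs' a).1.trans_lt (hs a).2
    have h3 : (k.2 a : ℕ) < (k'.2 a : ℕ) + 1 := by exact_mod_cast h1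
    have h4 : (k'.2 a : ℕ) < (k.2 a : ℕ) + 1 := by exact_mod_cast h2
    exact le_antisymm (Nat.lt_succ_iff.1 h3) (Nat.lt_succ_iff.1 h4)

lemma refMeasure_absolutelyContinuous (f : R2 → R3) :
    refMeasure f ≪ volume.restrict unitSquare := withDensity_absolutelyContinuous _ _

section

variable {N : ℕ} {F : Fin N → R2 → R3} {Ω : Set R3}

/-- A measurable function that agrees with a given function on the reference domain. -/
lemma exists_measurable_eqOn {E : Type*} [TopologicalSpace E] [MeasurableSpace E] [BorelSpace E]
    [Zero E] {f : R2 → E} (hf : ContinuousOn f unitSquare) :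
    ∃ g : R2 → E, Measurable g ∧ EqOn g f unitSquare := by
  classical
  exact ⟨unitSquare.piecewise f 0, hf.measurable_piecewise continuousOn_const
    measurableSet_unitSquare, piecewise_eqOn _ _ _⟩

/-- The factor `4⁻ʲ` of the surface element cancels the `4ʲ` of the change of variables. What
remains refers to the patch alone, restricted to the cell of the cluster, and so can be compared
between levels. The globally measurable substitutes are needed because the patch data are controlled
only on the square. -/
lemma patchMeasure_clusterMap (hF : IsMultipatchBoundary F Ω) {j : ℕ} (l : Cluster N j) {f' : R2 → R3}
    {g' : R2 → ℝ} (hf' : Measurable f') (hg' : Measurable g') (hff' : EqOn f' (F l.1) unitSquare)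
    (hgg' : EqOn g' (surfElt (F l.1)) unitSquare) :
    patchMeasure (clusterMap F l) =
      Measure.map f' ((volume.restrict (cell l)).withDensity fun s => ENNReal.ofReal (g' s)) := by
  set G : R2 → ENNReal := fun s => ENNReal.ofReal (g' s) with hG
  have hGm : Measurable G := hg'.ennreal_ofReal
  have hσ : Measurable (subMap l) := (continuous_subMap l).measurable
  have h1 : refMeasure (clusterMap F l) =
      ENNReal.ofReal ((4 : ℝ) ^ j)⁻¹ • (volume.restrict unitSquare).withDensity (G ∘ subMap l) := by
    rw [refMeasure, ← withDensity_smul _ (hGm.comp hσ)]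
    refine withDensity_congr_ae ?_
    filter_upwards [ae_restrict_mem measurableSet_unitSquare] with s hs
    rw [surfElt_clusterMap hF l hs, ← hgg' (subMap_mem l hs), ENNReal.ofReal_mul (by positivity)]
    rfl
  have h2 : patchMeasure (clusterMap F l) =
      Measure.map (f' ∘ subMap l) (refMeasure (clusterMap F l)) := by
    refine Measure.map_congr ?_
    refine (withDensity_absolutelyContinuous _ _).ae_le ?_
    filter_upwards [ae_restrict_mem measurableSet_unitSquare] with s hs
    rw [Function.comp_apply, hff' (subMap_mem l hs), clusterMap_eq, Function.comp_apply]
  rw [h2, h1, Measure.map_smul, ← Measure.map_map hf' hσ, map_withDensity_comp hσ hGm,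
    map_subMap_volume, withDensity_smul_measure, Measure.map_smul, smul_smul,
    ← ENNReal.ofReal_mul (by positivity), inv_mul_cancel₀ (by positivity), ENNReal.ofReal_one,
    one_smul]

-- A cell is the disjoint union of the cells of its sons, and restriction, density and push-forward
-- are additive.
open Classical in
lemma patchMeasure_eq_sum_sons (hF : IsMultipatchBoundary F Ω) {j : ℕ} (l : Cluster N j) :
    patchMeasure (clusterMap F l) =
      ∑ k : Cluster N (j + 1) with dad k = l, patchMeasure (clusterMap F k) := by
  obtain ⟨f', hf', hff'⟩ := exists_measurable_eqOn (hF.analytic l.1).continuousOn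
  obtain ⟨g', hg', hgg'⟩ := exists_measurable_eqOn (continuousOn_surfElt hF l.1)
  rw [Finset.sum_subtype (p := fun k => dad k = l) _ (by simp)]
  have h : ∀ k : {k : Cluster N (j + 1) // dad k = l}, patchMeasure (clusterMap F k.1) =
      Measure.map f' ((volume.restrict (cell k.1)).withDensity fun s => ENNReal.ofReal (g' s)) := by
    rintro ⟨k, rfl⟩
    exact patchMeasure_clusterMap hF k hf' hg' hff' hgg'
  simp only [h]
  rw [patchMeasure_clusterMap hF l hf' hg' hff' hgg', cell_eq_iUnion,
    Measure.restrict_iUnion (pairwise_disjoint_cell l) fun k => measurableSet_cell _,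
    withDensity_sum, Measure.map_sum hf'.aemeasurable, Measure.sum_fintype]

lemma clusterMap_zero (F : Fin N → R2 → R3) (l : Cluster N 0) : clusterMap F l = F l.1 := by
  ext s
  simp [clusterMap]

lemma sum_patchMeasure_zero (F : Fin N → R2 → R3) :
    ∑ l : Cluster N 0, patchMeasure (clusterMap F l) = surfaceMeasure F := by
  rw [surfaceMeasure_eq]
  have : Unique (Fin 2 → Fin (2 ^ 0)) := inferInstanceAs (Unique (Fin 2 → Fin 1))
  refine Fintype.sum_equiv (Equiv.prodUnique (Fin N) (Fin 2 → Fin (2 ^ 0))) _ _ fun l => ?_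
  rw [clusterMap_zero]
  rfl

lemma sum_patchMeasure (hF : IsMultipatchBoundary F Ω) (j : ℕ) :
    ∑ l : Cluster N j, patchMeasure (clusterMap F l) = surfaceMeasure F := by
  classical
  induction j with
  | zero => exact sum_patchMeasure_zero F
  | succ j ih =>
    rw [← ih, ← Finset.sum_fiberwise Finset.univ (dad : Cluster N (j + 1) → Cluster N j)]
    exact Finset.sum_congr rfl fun l _ => (patchMeasure_eq_sum_sons hF l).symm

lemma patchMeasure_le (hF : IsMultipatchBoundary F Ω) {j : ℕ} (l : Cluster N j) :
    patchMeasure (clusterMap F l) ≤ surfaceMeasure F := by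
  rw [← sum_patchMeasure hF j]
  refine Measure.le_iff'.2 fun A => ?_
  rw [Measure.finsetSum_apply]
  exact Finset.single_le_sum (f := fun l : Cluster N j => patchMeasure (clusterMap F l) A)
    (fun _ _ => zero_le) (Finset.mem_univ l)

lemma continuousOn_surfElt_clusterMap (hF : IsMultipatchBoundary F Ω) {j : ℕ} (l : Cluster N j) :
    ContinuousOn (surfElt (clusterMap F l)) unitSquare := by
  have h : ContinuousOn (fun s => ((4 : ℝ) ^ j)⁻¹ * surfElt (F l.1) (subMap l s)) unitSquare :=
    continuousOn_const.mul ((continuousOn_surfElt hF l.1).comp (continuous_subMap l).continuousOn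
      fun _ hs => subMap_mem l hs)
  exact h.congr fun s hs => surfElt_clusterMap hF l hs

lemma aemeasurable_clusterMap (hF : IsMultipatchBoundary F Ω) {j : ℕ} (l : Cluster N j) :
    AEMeasurable (clusterMap F l) (volume.restrict unitSquare) :=
  (continuousOn_clusterMap hF l).aemeasurable measurableSet_unitSquare

lemma aemeasurable_surfElt_clusterMap (hF : IsMultipatchBoundary F Ω) {j : ℕ} (l : Cluster N j) :
    AEMeasurable (surfElt (clusterMap F l)) (volume.restrict unitSquare) :=
  (continuousOn_surfElt_clusterMap hF l).aemeasurable measurableSet_unitSquare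

lemma surfElt_nonneg (f : R2 → R3) (s : R2) : 0 ≤ surfElt f s := norm_nonneg _

lemma integral_patchMeasure (hF : IsMultipatchBoundary F Ω) {j : ℕ} (l : Cluster N j) {E : Type*}
    [NormedAddCommGroup E] [NormedSpace ℝ E] {f : R3 → E}
    (hf : AEStronglyMeasurable f (patchMeasure (clusterMap F l))) :
    ∫ x, f x ∂(patchMeasure (clusterMap F l)) =
      ∫ s in unitSquare, surfElt (clusterMap F l) s • f (clusterMap F l s) := by
  rw [patchMeasure, integral_map ((aemeasurable_clusterMap hF l).mono_ac
    (refMeasure_absolutelyContinuous _)) hf, refMeasure,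
    integral_withDensity_eq_integral_toReal_smul₀
      (aemeasurable_surfElt_clusterMap hF l).ennreal_ofReal (by simp)]
  refine integral_congr_ae (Filter.Eventually.of_forall fun s => ?_)
  simp only [ENNReal.toReal_ofReal (surfElt_nonneg _ _)]

lemma lintegral_patchMeasure (hF : IsMultipatchBoundary F Ω) (i : Fin N) {f : R3 → ENNReal}
    (hf : Measurable f) : ∫⁻ x, f x ∂(patchMeasure (F i)) =
      ∫⁻ s in unitSquare, ENNReal.ofReal (surfElt (F i) s) * f (F i s) := by
  have h1 : AEMeasurable (F i) (volume.restrict unitSquare) :=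
    (hF.analytic i).continuousOn.aemeasurable measurableSet_unitSquare
  have h2 : AEMeasurable (fun s => ENNReal.ofReal (surfElt (F i) s)) (volume.restrict unitSquare) :=
    ((continuousOn_surfElt hF i).aemeasurable measurableSet_unitSquare).ennreal_ofReal
  rw [patchMeasure, lintegral_map' hf.aemeasurable (h1.mono_ac
    (refMeasure_absolutelyContinuous _)), refMeasure,
    lintegral_withDensity_eq_lintegral_mul₀ h2
      (g := fun s => f (F i s)) (hf.comp_aemeasurable h1)]
  rfl

end

/-! ### Integrability of the weakly singular kernel -/

/-- In the plane the polar factor `r` cancels the singularity `r⁻¹`, for any norm. Points of the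
square are at distance at most `1`, so after translation one integral over the unit ball dominates
all of them. -/
lemma exists_lintegral_inv_norm_sub_le :
    ∃ I : ENNReal, I < ⊤ ∧ ∀ s₀ ∈ unitSquare,
      ∫⁻ s in unitSquare, ENNReal.ofReal ‖s - s₀‖⁻¹ ≤ I := by
  set f : ℝ → ℝ := (Iic (1 : ℝ)).indicator fun r => r⁻¹ with hf
  have hint : Integrable (fun s : R2 => f ‖s‖) := by
    rw [integrable_fun_norm_addHaar (volume : Measure R2) (f := f)]
    have hdim : Module.finrank ℝ R2 - 1 = 1 := by
      rw [Module.finrank_fintype_fun_eq_card, Fintype.card_fin]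
    rw [hdim]
    have h1 : IntegrableOn (fun y : ℝ => (Ioc (0 : ℝ) 1).indicator (fun _ => (1 : ℝ)) y) (Ioi 0) :=
      (integrableOn_const (C := (1 : ℝ)) (by simp)).integrable_indicator measurableSet_Ioc
        |>.integrableOn
    refine h1.congr_fun (fun y hy => ?_) measurableSet_Ioi
    have hy' : (0 : ℝ) < y := hy
    by_cases hy1 : y ≤ 1
    · simp [hf, hy', hy1, hy'.ne']
    · simp [hf, hy1]
  refine ⟨∫⁻ s : R2, ENNReal.ofReal (f ‖s‖), ?_, fun s₀ hs₀ => ?_⟩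
  · have := hint.2
    rw [hasFiniteIntegral_iff_norm] at this
    refine lt_of_le_of_lt (lintegral_mono fun s => ENNReal.ofReal_le_ofReal (le_abs_self _)) this
  · rw [← lintegral_sub_right_eq_self (fun s : R2 => ENNReal.ofReal (f ‖s‖)) s₀]
    refine (setLIntegral_mono' measurableSet_unitSquare fun s hs => ?_).trans
      (setLIntegral_le_lintegral unitSquare _)
    rw [hf, indicator_of_mem]
    exact norm_sub_le_one_of_mem_unitSquare hs hs₀

lemma measurable_inv_norm_sub :
    Measurable fun z : R3 × R3 => ENNReal.ofReal ‖z.1 - z.2‖⁻¹ := by fun_prop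

lemma measurable_helmholtz (κ : ℝ) : Measurable (helmholtz κ) := by
  unfold helmholtz
  fun_prop

lemma norm_helmholtz_le (κ : ℝ) (z : R3) : ‖helmholtz κ z‖ ≤ ‖z‖⁻¹ := by
  have h1 : ‖Complex.exp (Complex.I * κ * ‖z‖)‖ = 1 := by
    rw [show Complex.I * κ * ‖z‖ = ((κ * ‖z‖ : ℝ) : ℂ) * Complex.I by push_cast; ring]
    exact Complex.norm_exp_ofReal_mul_I _
  have h2 : ‖(4 * Real.pi * ‖z‖ : ℂ)‖ = 4 * Real.pi * ‖z‖ := by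
    rw [norm_mul, norm_mul, Complex.norm_real, Complex.norm_real, norm_norm,
      Real.norm_of_nonneg Real.pi_pos.le]
    simp
  rw [helmholtz, norm_div, h1, h2, one_div, mul_inv]
  have h3 : (4 * Real.pi)⁻¹ ≤ 1 := inv_le_one_of_one_le₀ (by linarith [Real.pi_gt_three])
  calc _ ≤ 1 * ‖z‖⁻¹ := by gcongr
    _ = _ := one_mul _

lemma norm_bdot_le (a b : C3) : ‖bdot a b‖ ≤ 3 * (‖a‖ * ‖b‖) := by
  calc ‖bdot a b‖ ≤ ∑ _k : Fin 3, ‖a‖ * ‖b‖ := by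
        refine (norm_sum_le _ _).trans (Finset.sum_le_sum fun k _ => ?_)
        rw [norm_mul]
        gcongr
        · exact PiLp.norm_apply_le a k
        · exact PiLp.norm_apply_le b k
    _ = _ := by simp

lemma continuous_bdot : Continuous fun p : C3 × C3 => bdot p.1 p.2 := by
  unfold bdot; fun_prop

section

variable {N : ℕ} {F : Fin N → R2 → R3} {Ω : Set R3}

/-- The single layer potential of the constant density is bounded. -/
lemma exists_lintegral_kernel_le (hF : IsMultipatchBoundary F Ω) :
    ∃ C : ENNReal, C < ⊤ ∧ ∀ y : R3,
      ∫⁻ x, ENNReal.ofReal ‖x - y‖⁻¹ ∂(surfaceMeasure F) ≤ C := by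
  obtain ⟨I, hI, hIb⟩ := exists_lintegral_inv_norm_sub_le
  obtain ⟨c, hc, hbi⟩ := exists_bilipschitz hF
  obtain ⟨T, hT, hTb⟩ := exists_forall_norm_le (continuousOn_surfElt hF)
  refine ⟨∑ _i : Fin N, ENNReal.ofReal (T * (2 / c)) * I, ?_, fun y => ?_⟩
  · exact ENNReal.sum_lt_top.2 fun i _ => ENNReal.mul_lt_top ENNReal.ofReal_lt_top hI
  rw [surfaceMeasure_eq, lintegral_finsetSum_measure]
  refine Finset.sum_le_sum fun i _ => ?_
  rw [lintegral_patchMeasure hF i (by fun_prop)]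
  -- With `s₀` the parameter of a point of the patch nearest to `y`, the triangle inequality gives
  -- `c ‖s - s₀‖ ≤ 2 ‖F i s - y‖`. The point `y` may thus lie anywhere in space.
  obtain ⟨s₀, hs₀, hmin⟩ := isCompact_unitSquare.exists_isMinOn ⟨0, by simp [unitSquare]⟩
    (f := fun s => ‖F i s - y‖) ((hF.analytic i).continuousOn.sub continuousOn_const).norm
  calc ∫⁻ s in unitSquare, ENNReal.ofReal (surfElt (F i) s) * ENNReal.ofReal ‖F i s - y‖⁻¹
      ≤ ∫⁻ s in unitSquare, ENNReal.ofReal (T * (2 / c)) * ENNReal.ofReal ‖s - s₀‖⁻¹ := by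
        refine lintegral_mono_ae ?_
        have hne : ∀ᵐ s ∂(volume.restrict unitSquare), s ≠ s₀ :=
          ae_restrict_of_ae (compl_mem_ae_iff.2 (measure_singleton s₀))
        filter_upwards [hne, ae_restrict_mem measurableSet_unitSquare] with s hs hsm
        rw [← ENNReal.ofReal_mul (surfElt_nonneg _ _), ← ENNReal.ofReal_mul (by positivity)]
        refine ENNReal.ofReal_le_ofReal ?_
        have hpos : 0 < ‖s - s₀‖ := norm_pos_iff.2 (sub_ne_zero.2 hs)
        have h1 := hbi i s hsm s₀ hs₀
        have h2 : ‖F i s₀ - y‖ ≤ ‖F i s - y‖ := hmin hsm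
        have h3 : ‖F i s - F i s₀‖ ≤ ‖F i s - y‖ + ‖F i s₀ - y‖ := by
          rw [← sub_sub_sub_cancel_right _ _ y]; exact norm_sub_le _ _
        have h4 : c / 2 * ‖s - s₀‖ ≤ ‖F i s - y‖ := by linarith
        have h5 : surfElt (F i) s ≤ T := (le_abs_self _).trans (hTb i s hsm)
        calc surfElt (F i) s * ‖F i s - y‖⁻¹ ≤ T * (c / 2 * ‖s - s₀‖)⁻¹ := by gcongr
          _ = _ := by rw [mul_inv, inv_div]; ring
    _ = ENNReal.ofReal (T * (2 / c)) * ∫⁻ s in unitSquare, ENNReal.ofReal ‖s - s₀‖⁻¹ :=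
        lintegral_const_mul _ (by fun_prop)
    _ ≤ _ := by gcongr; exact hIb s₀ hs₀

lemma isFiniteMeasure_surfaceMeasure (hF : IsMultipatchBoundary F Ω) :
    IsFiniteMeasure (surfaceMeasure F) := by
  obtain ⟨T, hT, hTb⟩ := exists_forall_norm_le (continuousOn_surfElt hF)
  refine ⟨?_⟩
  rw [← lintegral_one, surfaceMeasure_eq, lintegral_finsetSum_measure]
  refine ENNReal.sum_lt_top.2 fun i _ => ?_
  rw [lintegral_patchMeasure hF i measurable_const]
  refine lt_of_le_of_lt (setLIntegral_mono' measurableSet_unitSquare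
    (g := fun _ => ENNReal.ofReal T) fun s hs => ?_) ?_
  · rw [mul_one]
    exact ENNReal.ofReal_le_ofReal ((le_abs_self _).trans (hTb i s hs))
  · rw [setLIntegral_const]
    exact ENNReal.mul_lt_top ENNReal.ofReal_lt_top isCompact_unitSquare.measure_lt_top

/-- This is Schur's test. The product `|u| |v|` is dominated by `|u|² + |v|²`, and in each of the
two terms the kernel is first integrated in the variable that the density does not contain, which
gives a bounded potential. -/
lemma integrable_of_weakly_singular (hF : IsMultipatchBoundary F Ω) {E E' : Type*}
    [NormedAddCommGroup E] [NormedAddCommGroup E'] {u : R3 → E} {v : R3 → E'}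
    (hu : MemLp u 2 (surfaceMeasure F)) (hv : MemLp v 2 (surfaceMeasure F)) {f : R3 × R3 → ℂ}
    (hf : AEStronglyMeasurable f ((surfaceMeasure F).prod (surfaceMeasure F))) {A : ℝ} (hA : 0 ≤ A)
    (hb : ∀ z, ‖f z‖ ≤ A * (‖z.1 - z.2‖⁻¹ * (‖u z.1‖ * ‖v z.2‖))) :
    Integrable f ((surfaceMeasure F).prod (surfaceMeasure F)) := by
  have hfin := isFiniteMeasure_surfaceMeasure hF
  set μ := surfaceMeasure F
  obtain ⟨C, hC, hCb⟩ := exists_lintegral_kernel_le hF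
  have hu2 : ∫⁻ x, ‖u x‖ₑ ^ 2 ∂μ < ⊤ := by
    have := lintegral_rpow_enorm_lt_top_of_eLpNorm_lt_top two_ne_zero ENNReal.ofNat_ne_top hu.2
    simpa using this
  have hv2 : ∫⁻ x, ‖v x‖ₑ ^ 2 ∂μ < ⊤ := by
    have := lintegral_rpow_enorm_lt_top_of_eLpNorm_lt_top two_ne_zero ENNReal.ofNat_ne_top hv.2
    simpa using this
  have hum : AEMeasurable (fun x => ‖u x‖ₑ ^ 2) μ := hu.1.enorm.pow_const 2
  have hvm : AEMeasurable (fun x => ‖v x‖ₑ ^ 2) μ := hv.1.enorm.pow_const 2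
  set k : R3 × R3 → ENNReal := fun z => ENNReal.ofReal ‖z.1 - z.2‖⁻¹ with hk
  have hkm : Measurable k := measurable_inv_norm_sub
  have hum' : AEMeasurable (fun z : R3 × R3 => k z * ‖u z.1‖ₑ ^ 2) (μ.prod μ) :=
    hkm.aemeasurable.mul (hum.comp_quasiMeasurePreserving Measure.quasiMeasurePreserving_fst)
  have hvm' : AEMeasurable (fun z : R3 × R3 => k z * ‖v z.2‖ₑ ^ 2) (μ.prod μ) :=
    hkm.aemeasurable.mul (hvm.comp_quasiMeasurePreserving Measure.quasiMeasurePreserving_snd)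
  have h1 : ∫⁻ z, k z * ‖u z.1‖ₑ ^ 2 ∂(μ.prod μ) < ⊤ := by
    rw [lintegral_prod _ hum']
    refine lt_of_le_of_lt (lintegral_mono fun x => ?_)
      (lt_of_eq_of_lt (lintegral_const_mul'' C hum) (ENNReal.mul_lt_top hC hu2))
    have hkx : Measurable fun y => k (x, y) := hkm.comp measurable_prodMk_left
    refine (le_of_eq (lintegral_mul_const (‖u x‖ₑ ^ 2) hkx)).trans ?_
    gcongr
    refine le_trans (le_of_eq ?_) (hCb x)
    simp only [hk, norm_sub_rev x]
    rfl
  have h2 : ∫⁻ z, k z * ‖v z.2‖ₑ ^ 2 ∂(μ.prod μ) < ⊤ := by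
    rw [lintegral_prod_symm _ hvm']
    refine lt_of_le_of_lt (lintegral_mono fun y => ?_)
      (lt_of_eq_of_lt (lintegral_const_mul'' C hvm) (ENNReal.mul_lt_top hC hv2))
    have hky : Measurable fun x => k (x, y) := hkm.comp measurable_prodMk_right
    refine (le_of_eq (lintegral_mul_const (‖v y‖ₑ ^ 2) hky)).trans ?_
    gcongr
    exact hCb y
  refine ⟨hf, ?_⟩
  rw [hasFiniteIntegral_iff_enorm]
  have h3 : ∫⁻ z, ENNReal.ofReal A * (k z * ‖u z.1‖ₑ ^ 2 + k z * ‖v z.2‖ₑ ^ 2) ∂(μ.prod μ) < ⊤ := by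
    rw [lintegral_const_mul' _ _ ENNReal.ofReal_ne_top, lintegral_add_left' hum']
    exact ENNReal.mul_lt_top ENNReal.ofReal_lt_top (ENNReal.add_lt_top.2 ⟨h1, h2⟩)
  refine lt_of_le_of_lt (lintegral_mono fun z => ?_) h3
  have h4 : ‖f z‖ ≤ A * (‖z.1 - z.2‖⁻¹ * ‖u z.1‖ ^ 2 + ‖z.1 - z.2‖⁻¹ * ‖v z.2‖ ^ 2) := by
    refine (hb z).trans ?_
    rw [← mul_add]
    gcongr
    nlinarith [sq_nonneg (‖u z.1‖ - ‖v z.2‖), sq_nonneg ‖u z.1‖, sq_nonneg ‖v z.2‖]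
  rw [← ofReal_norm (f z), ← ofReal_norm (u z.1), ← ofReal_norm (v z.2),
    hk, ← ENNReal.ofReal_pow (norm_nonneg _), ← ENNReal.ofReal_pow (norm_nonneg _),
    ← ENNReal.ofReal_mul (by positivity), ← ENNReal.ofReal_mul (by positivity),
    ← ENNReal.ofReal_add (by positivity) (by positivity), ← ENNReal.ofReal_mul hA]
  exact ENNReal.ofReal_le_ofReal h4

lemma aestronglyMeasurable_helmholtz (κ : ℝ) (μ : Measure (R3 × R3)) :
    AEStronglyMeasurable (fun z : R3 × R3 => helmholtz κ (z.1 - z.2)) μ :=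
  ((measurable_helmholtz κ).comp (measurable_fst.sub measurable_snd)).aestronglyMeasurable

lemma aestronglyMeasurable_bdot {X Y : Type*} [MeasurableSpace X] [MeasurableSpace Y]
    {μ : Measure X} {ν : Measure Y} [SFinite μ] [SFinite ν] {u : X → C3} {v : Y → C3}
    (hu : AEStronglyMeasurable u μ) (hv : AEStronglyMeasurable v ν) :
    AEStronglyMeasurable (fun z : X × Y => bdot (u z.1) (v z.2)) (μ.prod ν) := by
  have h1 : AEStronglyMeasurable (fun z : X × Y => u z.1) (μ.prod ν) := hu.comp_fst
  have h2 : AEStronglyMeasurable (fun z : X × Y => v z.2) (μ.prod ν) := hv.comp_snd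
  exact Continuous.comp_aestronglyMeasurable (g := fun p : C3 × C3 => bdot p.1 p.2)
    (f := fun z : X × Y => (u z.1, v z.2)) continuous_bdot (h1.prodMk h2)

lemma integrable_current (hF : IsMultipatchBoundary F Ω) (κ : ℝ) (u v : HDiv F) :
    Integrable (fun z : R3 × R3 => helmholtz κ (z.1 - z.2) * bdot (u.toFun z.1) (v.toFun z.2))
      ((surfaceMeasure F).prod (surfaceMeasure F)) := by
  have hfin := isFiniteMeasure_surfaceMeasure hF
  have hm : AEStronglyMeasurable (fun z : R3 × R3 => helmholtz κ (z.1 - z.2) *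
      bdot (u.toFun z.1) (v.toFun z.2)) ((surfaceMeasure F).prod (surfaceMeasure F)) :=
    (aestronglyMeasurable_helmholtz κ _).mul
      (aestronglyMeasurable_bdot u.memLp_toFun.1 v.memLp_toFun.1)
  have hb : ∀ z : R3 × R3, ‖helmholtz κ (z.1 - z.2) * bdot (u.toFun z.1) (v.toFun z.2)‖ ≤
      3 * (‖z.1 - z.2‖⁻¹ * (‖u.toFun z.1‖ * ‖v.toFun z.2‖)) := by
    intro z
    rw [norm_mul]
    calc _ ≤ ‖z.1 - z.2‖⁻¹ * (3 * (‖u.toFun z.1‖ * ‖v.toFun z.2‖)) :=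
          mul_le_mul (norm_helmholtz_le κ _) (norm_bdot_le _ _) (norm_nonneg _) (by positivity)
      _ = _ := by ring
  exact integrable_of_weakly_singular hF u.memLp_toFun v.memLp_toFun hm (by norm_num) hb

lemma integrable_charge (hF : IsMultipatchBoundary F Ω) (κ : ℝ) (u v : HDiv F) :
    Integrable (fun z : R3 × R3 => helmholtz κ (z.1 - z.2) * (u.div z.1 * v.div z.2))
      ((surfaceMeasure F).prod (surfaceMeasure F)) := by
  have hfin := isFiniteMeasure_surfaceMeasure hF
  have hm : AEStronglyMeasurable (fun z : R3 × R3 => helmholtz κ (z.1 - z.2) *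
      (u.div z.1 * v.div z.2)) ((surfaceMeasure F).prod (surfaceMeasure F)) :=
    (aestronglyMeasurable_helmholtz κ _).mul (u.memLp_div.1.comp_fst.mul v.memLp_div.1.comp_snd)
  have hb : ∀ z : R3 × R3, ‖helmholtz κ (z.1 - z.2) * (u.div z.1 * v.div z.2)‖ ≤
      1 * (‖z.1 - z.2‖⁻¹ * (‖u.div z.1‖ * ‖v.div z.2‖)) := by
    intro z
    rw [norm_mul, norm_mul, one_mul]
    gcongr
    exact norm_helmholtz_le κ _
  exact integrable_of_weakly_singular hF u.memLp_div v.memLp_div hm (by norm_num) hb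

end

/-! ### Decomposition of the bilinear form along the block-cluster tree -/

section

variable {N : ℕ} {F : Fin N → R2 → R3} {Ω : Set R3}

open Classical in
/-- The far-field blocks and the near-field blocks form a partition of the product of the surface
with itself. -/
lemma farSum_add_nearSum (hF : IsMultipatchBoundary F Ω) {η : ℝ} (hη : 0 ≤ η)
    (B : (j : ℕ) → Cluster N j → Cluster N j → ℂ)
    (hB : ∀ j (l l' : Cluster N j), B j l l' = ∑ k : Cluster N (j + 1) with dad k = l,
      ∑ k' : Cluster N (j + 1) with dad k' = l', B (j + 1) k k') (m : ℕ) :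
    farSum F η m B + nearSum F η m (B m) = ∑ l : Cluster N 0, ∑ l' : Cluster N 0, B 0 l l' := by
  induction m with
  | zero =>
    simp only [farSum, nearSum, zero_add, Finset.range_one, Finset.sum_singleton,
      ← Finset.sum_add_distrib]
    refine Finset.sum_congr rfl fun l _ => Finset.sum_congr rfl fun l' _ => ?_
    change (if Admissible F η l l' then B 0 l l' else 0) + (if Admissible F η l l' then 0 else _) = _
    split_ifs <;> simp
  | succ m ih =>
    rw [← ih]
    -- Refinement by one level: every near-field block is replaced by all pairs of sons, that is, by
    -- the pairs on level `m + 1` whose father block is not admissible.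
    have hnear : nearSum F η m (B m) = ∑ k : Cluster N (m + 1), ∑ k' : Cluster N (m + 1),
        if Admissible F η (dad k) (dad k') then 0 else B (m + 1) k k' := by
      rw [nearSum, ← Finset.sum_fiberwise Finset.univ (dad : Cluster N (m + 1) → Cluster N m)]
      refine Finset.sum_congr rfl fun l _ => ?_
      have h1 : ∀ k ∈ Finset.univ.filter (fun k : Cluster N (m + 1) => dad k = l),
          (∑ k' : Cluster N (m + 1),
            if Admissible F η (dad k) (dad k') then 0 else B (m + 1) k k') =
          ∑ l' : Cluster N m, if Admissible F η l l' then 0 else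
            ∑ k' : Cluster N (m + 1) with dad k' = l', B (m + 1) k k' := by
        intro k hk
        rw [← Finset.sum_fiberwise Finset.univ (dad : Cluster N (m + 1) → Cluster N m)]
        refine Finset.sum_congr rfl fun l' _ => ?_
        rw [(Finset.mem_filter.1 hk).2]
        split_ifs with h
        · refine Finset.sum_eq_zero fun k' hk' => ?_
          rw [(Finset.mem_filter.1 hk').2, if_pos h]
        · refine Finset.sum_congr rfl fun k' hk' => ?_
          rw [(Finset.mem_filter.1 hk').2, if_neg h]
      rw [Finset.sum_congr rfl h1, Finset.sum_comm]
      refine Finset.sum_congr rfl fun l' _ => ?_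
      split_ifs with h
      · simp
      · exact hB m l l'
    rw [hnear, farSum, Finset.sum_range_succ, add_assoc, farSum]
    congr 1
    rw [nearSum, ← Finset.sum_add_distrib]
    refine Finset.sum_congr rfl fun k _ => ?_
    rw [← Finset.sum_add_distrib]
    refine Finset.sum_congr rfl fun k' _ => ?_
    have hfar : IsFar F η (m + 1) k k' ↔
      Admissible F η k k' ∧ ¬ Admissible F η (dad k) (dad k') := Iff.rfl
    simp only [hfar]
    -- Under an admissible father block the pair is itself admissible, so it occurs neither in the
    -- new far-field nor in the new near-field. Otherwise it belongs to exactly one of them.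
    by_cases h1 : Admissible F η (dad k) (dad k')
    · have h2 : Admissible F η k k' := h1.of_dad hF hη
      simp [h1, h2]
    · by_cases h2 : Admissible F η k k' <;> simp [h1, h2]

/-! ### Double integrals over the surface as sums over blocks -/

lemma prod_sum_measure {X ι : Type*} [MeasurableSpace X] (s t : Finset ι) (μ : ι → Measure X)
    [∀ i, IsFiniteMeasure (μ i)] :
    (∑ i ∈ s, μ i).prod (∑ i ∈ t, μ i) = ∑ i ∈ s, ∑ i' ∈ t, (μ i).prod (μ i') := by
  rw [← Finset.sum_coe_sort s, ← Finset.sum_coe_sort t, ← Measure.sum_fintype,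
    ← Measure.sum_fintype, Measure.prod_sum, Measure.sum_fintype, Fintype.sum_prod_type,
    ← Finset.sum_coe_sort s]
  refine Finset.sum_congr rfl fun i _ => ?_
  rw [← Finset.sum_coe_sort t]

lemma integral_prod_sum_measure {X ι : Type*} [MeasurableSpace X] (s t : Finset ι)
    (μ : ι → Measure X) [∀ i, IsFiniteMeasure (μ i)] {f : X × X → ℂ}
    (hf : ∀ i i', Integrable f ((μ i).prod (μ i'))) :
    ∫ z, f z ∂((∑ i ∈ s, μ i).prod (∑ i ∈ t, μ i)) =
      ∑ i ∈ s, ∑ i' ∈ t, ∫ z, f z ∂((μ i).prod (μ i')) := by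
  rw [prod_sum_measure, integral_finsetSum_measure fun i _ =>
    integrable_finsetSum_measure.2 fun i' _ => hf i i']
  exact Finset.sum_congr rfl fun i _ => integral_finsetSum_measure fun i' _ => hf i i'

lemma isFiniteMeasure_patchMeasure (hF : IsMultipatchBoundary F Ω) {j : ℕ} (l : Cluster N j) :
    IsFiniteMeasure (patchMeasure (clusterMap F l)) := by
  have := isFiniteMeasure_surfaceMeasure hF
  exact isFiniteMeasure_of_le _ (patchMeasure_le hF l)

lemma integrable_prod_patchMeasure (hF : IsMultipatchBoundary F Ω) {f : R3 × R3 → ℂ}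
    (hf : Integrable f ((surfaceMeasure F).prod (surfaceMeasure F))) {j : ℕ} (l l' : Cluster N j) :
    Integrable f ((patchMeasure (clusterMap F l)).prod (patchMeasure (clusterMap F l'))) := by
  have := isFiniteMeasure_surfaceMeasure hF
  exact hf.mono_measure (Measure.prod_mono (patchMeasure_le hF l) (patchMeasure_le hF l'))

/-- The double integral over the surface is the sum of the integrals over the far-field and the
near-field. -/
lemma integral_prod_eq_farSum_add_nearSum (hF : IsMultipatchBoundary F Ω) {η : ℝ} (hη : 0 ≤ η)
    {f : R3 × R3 → ℂ} (hf : Integrable f ((surfaceMeasure F).prod (surfaceMeasure F))) (m : ℕ) :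
    ∫ z, f z ∂((surfaceMeasure F).prod (surfaceMeasure F)) =
      farSum F η m (fun _ l l' => ∫ z, f z
        ∂((patchMeasure (clusterMap F l)).prod (patchMeasure (clusterMap F l')))) +
      nearSum F η m (fun l l' => ∫ z, f z
        ∂((patchMeasure (clusterMap F l)).prod (patchMeasure (clusterMap F l')))) := by
  classical
  have hfin : ∀ j (l : Cluster N j), IsFiniteMeasure (patchMeasure (clusterMap F l)) := fun j l =>
    isFiniteMeasure_patchMeasure hF l
  refine Eq.trans ?_ (farSum_add_nearSum hF hη (fun _ l l' => ∫ z, f z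
        ∂((patchMeasure (clusterMap F l)).prod (patchMeasure (clusterMap F l')))) ?_ m).symm
  · rw [← sum_patchMeasure_zero F]
    exact integral_prod_sum_measure Finset.univ Finset.univ
      (fun l : Cluster N 0 => patchMeasure (clusterMap F l))
      fun l l' => integrable_prod_patchMeasure hF hf l l'
  · intro j l l'
    rw [patchMeasure_eq_sum_sons hF l, patchMeasure_eq_sum_sons hF l']
    exact integral_prod_sum_measure _ _ (fun l : Cluster N (j + 1) => patchMeasure (clusterMap F l))
      fun l l' => integrable_prod_patchMeasure hF hf l l'

/-- The integral over the product of two clusters, pulled back to the reference domain. -/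
lemma integral_prod_patchMeasure (hF : IsMultipatchBoundary F Ω) {f : R3 → R3 → ℂ} {j : ℕ}
    (l l' : Cluster N j)
    (hf : Integrable (fun z : R3 × R3 => f z.1 z.2)
      ((patchMeasure (clusterMap F l)).prod (patchMeasure (clusterMap F l'))))
    (hm : ∀ x, AEStronglyMeasurable (f x) (patchMeasure (clusterMap F l'))) :
    ∫ z, f z.1 z.2 ∂((patchMeasure (clusterMap F l)).prod (patchMeasure (clusterMap F l'))) =
      ∫ s in unitSquare, ∫ t in unitSquare, f (clusterMap F l s) (clusterMap F l' t) *
        ((surfElt (clusterMap F l) s * surfElt (clusterMap F l') t : ℝ) : ℂ) := by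
  have := isFiniteMeasure_patchMeasure hF l
  have := isFiniteMeasure_patchMeasure hF l'
  rw [integral_prod _ hf, integral_patchMeasure hF l hf.integral_prod_left.aestronglyMeasurable]
  refine integral_congr_ae (Filter.Eventually.of_forall fun s => ?_)
  simp only
  rw [integral_patchMeasure hF l' (hm _), ← integral_smul]
  refine integral_congr_ae (Filter.Eventually.of_forall fun t => ?_)
  simp only [Complex.real_smul]
  push_cast
  ring

lemma memLp_patch (hF : IsMultipatchBoundary F Ω) {E : Type*} [NormedAddCommGroup E] {u : R3 → E}
    (hu : MemLp u 2 (surfaceMeasure F)) {j : ℕ} (l : Cluster N j) :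
    MemLp u 2 (patchMeasure (clusterMap F l)) := hu.mono_measure (patchMeasure_le hF l)

lemma integral_current_block (hF : IsMultipatchBoundary F Ω) (κ : ℝ) (u v : HDiv F) {j : ℕ}
    (l l' : Cluster N j) :
    ∫ z : R3 × R3, helmholtz κ (z.1 - z.2) * bdot (u.toFun z.1) (v.toFun z.2)
        ∂((patchMeasure (clusterMap F l)).prod (patchMeasure (clusterMap F l'))) =
      currentBlock (locKernel κ F l l') l l' u v := by
  refine (integral_prod_patchMeasure hF
    (f := fun x y => helmholtz κ (x - y) * bdot (u.toFun x) (v.toFun y)) l l'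
    (integrable_prod_patchMeasure hF (integrable_current hF κ u v) l l') fun x => ?_)
  have h1 : Measurable fun y : R3 => helmholtz κ (x - y) :=
    (measurable_helmholtz κ).comp (measurable_const.sub measurable_id)
  have h2 : Continuous fun b : C3 => bdot (u.toFun x) b := by unfold bdot; fun_prop
  exact h1.aestronglyMeasurable.mul
    (h2.comp_aestronglyMeasurable (memLp_patch hF v.memLp_toFun l').1)

lemma integral_charge_block (hF : IsMultipatchBoundary F Ω) (κ : ℝ) (u v : HDiv F) {j : ℕ}
    (l l' : Cluster N j) :
    ∫ z : R3 × R3, helmholtz κ (z.1 - z.2) * (u.div z.1 * v.div z.2)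
        ∂((patchMeasure (clusterMap F l)).prod (patchMeasure (clusterMap F l'))) =
      chargeBlock (locKernel κ F l l') l l' u v := by
  refine (integral_prod_patchMeasure hF
    (f := fun x y => helmholtz κ (x - y) * (u.div x * v.div y)) l l'
    (integrable_prod_patchMeasure hF (integrable_charge hF κ u v) l l') fun x => ?_)
  have h1 : Measurable fun y : R3 => helmholtz κ (x - y) :=
    (measurable_helmholtz κ).comp (measurable_const.sub measurable_id)
  exact h1.aestronglyMeasurable.mul ((memLp_patch hF v.memLp_div l').1.const_mul _)

lemma farSum_sub_mul (η : ℝ) (m : ℕ) (c : ℂ) (f g : (j : ℕ) → Cluster N j → Cluster N j → ℂ) :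
    farSum F η m (fun j l l' => f j l l' - c * g j l l') =
      farSum F η m f - c * farSum F η m g := by
  simp only [farSum, Finset.mul_sum, ← Finset.sum_sub_distrib]
  refine Finset.sum_congr rfl fun j _ => Finset.sum_congr rfl fun l _ =>
    Finset.sum_congr rfl fun l' _ => ?_
  split_ifs <;> simp

lemma nearSum_sub_mul (η : ℝ) (m : ℕ) (c : ℂ) (f g : Cluster N m → Cluster N m → ℂ) :
    nearSum F η m (fun l l' => f l l' - c * g l l') = nearSum F η m f - c * nearSum F η m g := by
  simp only [nearSum, Finset.mul_sum, ← Finset.sum_sub_distrib]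
  refine Finset.sum_congr rfl fun l _ => Finset.sum_congr rfl fun l' _ => ?_
  split_ifs <;> simp

lemma singleLayerForm_eq (hF : IsMultipatchBoundary F Ω) (κ : ℝ) {η : ℝ} (hη : 0 ≤ η) (m : ℕ)
    (u v : HDiv F) :
    singleLayerForm κ u v =
      farSum F η m (fun _ l l' => blockForm κ (locKernel κ F l l') l l' u v) +
        nearSum F η m (fun l l' => blockForm κ (locKernel κ F l l') l l' u v) := by
  have hfin := isFiniteMeasure_surfaceMeasure hF
  have h1 := integral_prod_eq_farSum_add_nearSum hF hη (integrable_current hF κ u v) m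
  have h2 := integral_prod_eq_farSum_add_nearSum hF hη (integrable_charge hF κ u v) m
  simp only [integral_current_block hF] at h1
  simp only [integral_charge_block hF] at h2
  rw [integral_prod _ (integrable_current hF κ u v)] at h1
  rw [integral_prod _ (integrable_charge hF κ u v)] at h2
  simp only [blockForm]
  rw [farSum_sub_mul, nearSum_sub_mul, singleLayerForm, h1, h2]
  ring

end

/-! ### Perturbation of the kernel in a block -/

/-- Lebesgue measure on the reference domain. -/
abbrev sqMeasure : Measure R2 := volume.restrict unitSquare

lemma sqMeasure_prod : sqMeasure.prod sqMeasure =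
    ((volume : Measure R2).prod volume).restrict (unitSquare ×ˢ unitSquare) :=
  Measure.prod_restrict _ _

lemma ae_mem_unitSquare_prod :
    ∀ᵐ z ∂(sqMeasure.prod sqMeasure), z.1 ∈ unitSquare ∧ z.2 ∈ unitSquare := by
  rw [sqMeasure_prod]
  exact ae_restrict_mem (measurableSet_unitSquare.prod measurableSet_unitSquare)

lemma aestronglyMeasurable_of_continuousOn_square {K : R2 → R2 → ℂ}
    (hK : ContinuousOn (fun z : R2 × R2 => K z.1 z.2) (unitSquare ×ˢ unitSquare)) :
    AEStronglyMeasurable (fun z : R2 × R2 => K z.1 z.2) (sqMeasure.prod sqMeasure) := by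
  rw [sqMeasure_prod]
  exact hK.aestronglyMeasurable (measurableSet_unitSquare.prod measurableSet_unitSquare)

lemma integrable_kernel_mul {K p : R2 → R2 → ℂ} {a b : R2 → ℝ}
    (hK : ContinuousOn (fun z : R2 × R2 => K z.1 z.2) (unitSquare ×ˢ unitSquare))
    (hp : AEStronglyMeasurable (fun z : R2 × R2 => p z.1 z.2) (sqMeasure.prod sqMeasure))
    (hpab : ∀ s ∈ unitSquare, ∀ t ∈ unitSquare, ‖p s t‖ ≤ a s * b t)
    (ha : Integrable a sqMeasure) (hb : Integrable b sqMeasure) :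
    Integrable (fun z : R2 × R2 => K z.1 z.2 * p z.1 z.2) (sqMeasure.prod sqMeasure) := by
  obtain ⟨C, hC⟩ := (isCompact_unitSquare.prod isCompact_unitSquare).exists_bound_of_continuousOn hK
  refine Integrable.mono' ((ha.mul_prod hb).const_mul C)
    ((aestronglyMeasurable_of_continuousOn_square hK).mul hp) ?_
  filter_upwards [ae_mem_unitSquare_prod] with z hz
  rw [norm_mul]
  have h1 := hC z ⟨hz.1, hz.2⟩
  exact mul_le_mul h1 (hpab _ hz.1 _ hz.2) (norm_nonneg _) ((norm_nonneg _).trans h1)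

/-- The change of a double integral when its kernel is perturbed. -/
lemma norm_integral_kernel_sub_le {K₁ K₂ p : R2 → R2 → ℂ} {a b : R2 → ℝ} {e : ℝ}
    (hK₁ : ContinuousOn (fun z : R2 × R2 => K₁ z.1 z.2) (unitSquare ×ˢ unitSquare))
    (hK₂ : ContinuousOn (fun z : R2 × R2 => K₂ z.1 z.2) (unitSquare ×ˢ unitSquare))
    (hp : AEStronglyMeasurable (fun z : R2 × R2 => p z.1 z.2) (sqMeasure.prod sqMeasure))
    (hpab : ∀ s ∈ unitSquare, ∀ t ∈ unitSquare, ‖p s t‖ ≤ a s * b t)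
    (ha : Integrable a sqMeasure) (hb : Integrable b sqMeasure)
    (he : ∀ s ∈ unitSquare, ∀ t ∈ unitSquare, ‖K₁ s t - K₂ s t‖ ≤ e) :
    ‖(∫ s in unitSquare, ∫ t in unitSquare, K₁ s t * p s t) -
        ∫ s in unitSquare, ∫ t in unitSquare, K₂ s t * p s t‖ ≤
      e * ((∫ s in unitSquare, a s) * ∫ t in unitSquare, b t) := by
  have h1 := integrable_kernel_mul hK₁ hp hpab ha hb
  have h2 := integrable_kernel_mul hK₂ hp hpab ha hb
  rw [← integral_prod (fun z : R2 × R2 => K₁ z.1 z.2 * p z.1 z.2) h1,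
    ← integral_prod (fun z : R2 × R2 => K₂ z.1 z.2 * p z.1 z.2) h2, ← integral_sub h1 h2,
    ← integral_prod_mul a b, ← integral_const_mul]
  refine norm_integral_le_of_norm_le ((ha.mul_prod hb).const_mul e) ?_
  filter_upwards [ae_mem_unitSquare_prod] with z hz
  rw [← sub_mul, norm_mul]
  have h3 := he _ hz.1 _ hz.2
  exact mul_le_mul h3 (hpab _ hz.1 _ hz.2) (norm_nonneg _) ((norm_nonneg _).trans h3)

lemma continuous_lagr {q : ℕ} (x : Fin (q + 1) → ℝ) (m : Fin (q + 1)) : Continuous (lagr x m) :=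
  (Lagrange.basis Finset.univ x m).continuous

lemma continuous_tensorLagr {q : ℕ} (x : Fin (q + 1) → ℝ) (m : Fin 2 → Fin (q + 1)) :
    Continuous (tensorLagr x m) :=
  continuous_finsetProd _ fun a _ => (continuous_lagr x (m a)).comp (continuous_apply a)

lemma continuous_interp {q : ℕ} (x : Fin (q + 1) → ℝ) (K : R2 → R2 → ℂ) :
    Continuous fun z : R2 × R2 => interp x K z.1 z.2 := by
  unfold interp
  refine continuous_finsetSum _ fun m _ => continuous_finsetSum _ fun m' _ => ?_
  have h1 := (continuous_tensorLagr x m).comp continuous_fst (X := R2 × R2)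
  have h2 := (continuous_tensorLagr x m').comp continuous_snd (X := R2 × R2)
  exact continuous_const.mul (Complex.continuous_ofReal.comp (h1.mul h2))

lemma continuousAt_helmholtz (κ : ℝ) {z : R3} (hz : z ≠ 0) : ContinuousAt (helmholtz κ) z := by
  have h : (4 * Real.pi * ‖z‖ : ℂ) ≠ 0 := by
    have : (Real.pi : ℂ) ≠ 0 := by exact_mod_cast Real.pi_ne_zero
    simp [this, hz]
  unfold helmholtz
  refine ContinuousAt.div ?_ ?_ h <;> fun_prop

section

variable {N : ℕ} {F : Fin N → R2 → R3} {Ω : Set R3}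

lemma continuousOn_locKernel (hF : IsMultipatchBoundary F Ω) (κ : ℝ) {η : ℝ}
    (hη : η ∈ Ioo (0 : ℝ) 1) {j : ℕ} {l l' : Cluster N j} (h : Admissible F η l l') :
    ContinuousOn (fun z : R2 × R2 => locKernel κ F l l' z.1 z.2) (unitSquare ×ˢ unitSquare) := by
  obtain ⟨c, hc, hbi⟩ := exists_bilipschitz hF
  have h1 : ContinuousOn (fun z : R2 × R2 => clusterMap F l z.1 - clusterMap F l' z.2)
      (unitSquare ×ˢ unitSquare) :=
    ((continuousOn_clusterMap hF l).comp continuousOn_fst fun z hz => hz.1).sub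
      ((continuousOn_clusterMap hF l').comp continuousOn_snd fun z hz => hz.2)
  intro z hz
  have h2 : 0 < ‖clusterMap F l z.1 - clusterMap F l' z.2‖ :=
    lt_of_lt_of_le (by positivity) (h.le_dist hF hη hbi hz.1 hz.2)
  exact ContinuousAt.comp_continuousWithinAt (f := fun z : R2 × R2 =>
    clusterMap F l z.1 - clusterMap F l' z.2)
    (continuousAt_helmholtz κ (norm_pos_iff.1 h2)) (h1 z hz)

lemma surfElt_clusterMap_pos (hF : IsMultipatchBoundary F Ω) {j : ℕ} (l : Cluster N j) {s : R2}
    (hs : s ∈ unitSquare) : 0 < surfElt (clusterMap F l) s := by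
  rw [surfElt_clusterMap hF l hs]
  have : 0 < surfElt (F l.1) (subMap l s) := norm_pos_iff.2 (hF.regular _ _ (subMap_mem l hs))
  positivity

/-- Measurability is known with respect to the surface measure; it passes to Lebesgue measure on the
square because the surface element is positive there, so the two measures have the same null sets.
-/
lemma aestronglyMeasurable_comp_clusterMap (hF : IsMultipatchBoundary F Ω) {E : Type*}
    [NormedAddCommGroup E] {u : R3 → E} (hu : MemLp u 2 (surfaceMeasure F)) {j : ℕ}
    (l : Cluster N j) : AEStronglyMeasurable (fun s => u (clusterMap F l s)) sqMeasure := by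
  have h1 : AEStronglyMeasurable (fun s => u (clusterMap F l s)) (refMeasure (clusterMap F l)) :=
    (memLp_patch hF hu l).1.comp_aemeasurable ((aemeasurable_clusterMap hF l).mono_ac
      (refMeasure_absolutelyContinuous _))
  refine h1.mono_ac (withDensity_absolutelyContinuous'
    (aemeasurable_surfElt_clusterMap hF l).ennreal_ofReal ?_)
  filter_upwards [ae_restrict_mem measurableSet_unitSquare] with s hs
  simpa using surfElt_clusterMap_pos hF l hs

/-- The density on the reference domain that belongs to the modulus of a function on a cluster. -/
def absDensity {E : Type*} [Norm E] {j : ℕ} (F : Fin N → R2 → R3) (l : Cluster N j) (u : R3 → E)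
    (s : R2) : ℝ := surfElt (clusterMap F l) s * ‖u (clusterMap F l s)‖

lemma integrable_absDensity (hF : IsMultipatchBoundary F Ω) {E : Type*}
    [NormedAddCommGroup E] {u : R3 → E} (hu : MemLp u 2 (surfaceMeasure F)) {j : ℕ}
    (l : Cluster N j) : Integrable (absDensity F l u) sqMeasure := by
  have hfin := isFiniteMeasure_patchMeasure hF l
  have h1 : Integrable (fun x => ‖u x‖) (patchMeasure (clusterMap F l)) :=
    ((memLp_patch hF hu l).integrable one_le_two).norm
  rw [patchMeasure, integrable_map_measure h1.1 ((aemeasurable_clusterMap hF l).mono_ac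
      (refMeasure_absolutelyContinuous _)), refMeasure,
      integrable_withDensity_iff_integrable_smul₀'
        (aemeasurable_surfElt_clusterMap hF l).ennreal_ofReal (by simp)] at h1
  refine h1.congr (Filter.Eventually.of_forall fun s => ?_)
  simp only [ENNReal.toReal_ofReal (surfElt_nonneg _ _)]
  rfl

/-- The integral is the `L¹` norm on the cluster. It is enlarged to the whole surface and estimated
by Cauchy–Schwarz against the constant `1`; the smallness of the cluster is given away, since the
exponential decay in `q` pays for the number of blocks. -/
lemma integral_absDensity_le (hF : IsMultipatchBoundary F Ω) {E : Type*}
    [NormedAddCommGroup E] {u : R3 → E} (hu : MemLp u 2 (surfaceMeasure F)) {j : ℕ}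
    (l : Cluster N j) :
    ∫ s in unitSquare, absDensity F l u s ≤
      Real.sqrt ((surfaceMeasure F).real univ) *
        Real.sqrt (∫ x, ‖u x‖ ^ 2 ∂(surfaceMeasure F)) := by
  have hfin := isFiniteMeasure_surfaceMeasure hF
  have hint : Integrable (fun x => ‖u x‖) (surfaceMeasure F) := (hu.integrable one_le_two).norm
  have h1 : ∫ s in unitSquare, absDensity F l u s = ∫ x, ‖u x‖ ∂(patchMeasure (clusterMap F l)) :=
    (integral_patchMeasure hF l (memLp_patch hF hu l).1.norm).symm
  have h2 : ∫ x, ‖u x‖ ∂(patchMeasure (clusterMap F l)) ≤ ∫ x, ‖u x‖ ∂(surfaceMeasure F) :=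
    integral_mono_measure (patchMeasure_le hF l)
      (Filter.Eventually.of_forall fun x => norm_nonneg _) hint
  have h3 := integral_mul_le_Lp_mul_Lq_of_nonneg (μ := surfaceMeasure F)
    (p := 2) (q := 2) Real.HolderConjugate.two_two
    (f := fun _ => (1 : ℝ)) (g := fun x => ‖u x‖)
    (Filter.Eventually.of_forall fun _ => zero_le_one)
    (Filter.Eventually.of_forall fun x => norm_nonneg _) (memLp_const 1) (by simpa using hu.norm)
  rw [h1]
  refine h2.trans ?_
  simpa [Real.sqrt_eq_rpow] using h3

lemma sqrt_toFun_le_norm (u : HDiv F) :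
    Real.sqrt (∫ x, ‖u.toFun x‖ ^ 2 ∂(surfaceMeasure F)) ≤ u.norm :=
  Real.sqrt_le_sqrt (le_add_of_nonneg_right (integral_nonneg fun _ => by positivity))

lemma sqrt_div_le_norm (u : HDiv F) :
    Real.sqrt (∫ x, ‖u.div x‖ ^ 2 ∂(surfaceMeasure F)) ≤ u.norm :=
  Real.sqrt_le_sqrt (le_add_of_nonneg_left (integral_nonneg fun _ => by positivity))

lemma integral_absDensity_toFun_le (hF : IsMultipatchBoundary F Ω) (u : HDiv F) {j : ℕ}
    (l : Cluster N j) : ∫ s in unitSquare, absDensity F l u.toFun s ≤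
      Real.sqrt ((surfaceMeasure F).real univ) * u.norm :=
  (integral_absDensity_le hF u.memLp_toFun l).trans
    (mul_le_mul_of_nonneg_left (sqrt_toFun_le_norm u) (Real.sqrt_nonneg _))

lemma integral_absDensity_div_le (hF : IsMultipatchBoundary F Ω) (u : HDiv F) {j : ℕ}
    (l : Cluster N j) : ∫ s in unitSquare, absDensity F l u.div s ≤
      Real.sqrt ((surfaceMeasure F).real univ) * u.norm :=
  (integral_absDensity_le hF u.memLp_div l).trans
    (mul_le_mul_of_nonneg_left (sqrt_div_le_norm u) (Real.sqrt_nonneg _))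

lemma absDensity_nonneg {E : Type*} [NormedAddCommGroup E] {j : ℕ} (l : Cluster N j) (u : R3 → E)
    (s : R2) : 0 ≤ absDensity F l u s := mul_nonneg (surfElt_nonneg _ _) (norm_nonneg _)

lemma HDiv.norm_nonneg (u : HDiv F) : 0 ≤ u.norm := Real.sqrt_nonneg _

lemma aestronglyMeasurable_surfElt_mul (hF : IsMultipatchBoundary F Ω) {j : ℕ} (l l' : Cluster N j) :
    AEStronglyMeasurable (fun z : R2 × R2 =>
      ((surfElt (clusterMap F l) z.1 * surfElt (clusterMap F l') z.2 : ℝ) : ℂ))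
      (sqMeasure.prod sqMeasure) := by
  have h1 : AEStronglyMeasurable (fun z : R2 × R2 => surfElt (clusterMap F l) z.1)
      (sqMeasure.prod sqMeasure) :=
    (aemeasurable_surfElt_clusterMap hF l).aestronglyMeasurable.comp_fst
  have h2 : AEStronglyMeasurable (fun z : R2 × R2 => surfElt (clusterMap F l') z.2)
      (sqMeasure.prod sqMeasure) :=
    (aemeasurable_surfElt_clusterMap hF l').aestronglyMeasurable.comp_snd
  exact Complex.continuous_ofReal.comp_aestronglyMeasurable (h1.mul h2)

/-- The uniform kernel error multiplies two `L¹` norms, each of which costs the root of the surface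
area; the factor `3` comes from the componentwise bound for the bilinear product. -/
lemma norm_currentBlock_sub_le (hF : IsMultipatchBoundary F Ω) {j : ℕ} (l l' : Cluster N j)
    (u v : HDiv F) {K₁ K₂ : R2 → R2 → ℂ} {e : ℝ} (he0 : 0 ≤ e)
    (hK₁ : ContinuousOn (fun z : R2 × R2 => K₁ z.1 z.2) (unitSquare ×ˢ unitSquare))
    (hK₂ : ContinuousOn (fun z : R2 × R2 => K₂ z.1 z.2) (unitSquare ×ˢ unitSquare))
    (he : ∀ s ∈ unitSquare, ∀ t ∈ unitSquare, ‖K₁ s t - K₂ s t‖ ≤ e) :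
    ‖currentBlock K₁ l l' u v - currentBlock K₂ l l' u v‖ ≤
      3 * e * (surfaceMeasure F).real univ * u.norm * v.norm := by
  have hp : AEStronglyMeasurable (fun z : R2 × R2 =>
      bdot (u.toFun (clusterMap F l z.1)) (v.toFun (clusterMap F l' z.2)) *
        ((surfElt (clusterMap F l) z.1 * surfElt (clusterMap F l') z.2 : ℝ) : ℂ))
      (sqMeasure.prod sqMeasure) :=
    (aestronglyMeasurable_bdot (aestronglyMeasurable_comp_clusterMap hF u.memLp_toFun l)
      (aestronglyMeasurable_comp_clusterMap hF v.memLp_toFun l')).mul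
      (aestronglyMeasurable_surfElt_mul hF l l')
  have hpab : ∀ s ∈ unitSquare, ∀ t ∈ unitSquare,
      ‖bdot (u.toFun (clusterMap F l s)) (v.toFun (clusterMap F l' t)) *
        ((surfElt (clusterMap F l) s * surfElt (clusterMap F l') t : ℝ) : ℂ)‖ ≤
      (3 * absDensity F l u.toFun s) * absDensity F l' v.toFun t := by
    intro s _ t _
    rw [norm_mul, Complex.norm_real, Real.norm_of_nonneg
      (mul_nonneg (surfElt_nonneg _ _) (surfElt_nonneg _ _))]
    calc _ ≤ (3 * (‖u.toFun (clusterMap F l s)‖ * ‖v.toFun (clusterMap F l' t)‖)) *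
          (surfElt (clusterMap F l) s * surfElt (clusterMap F l') t) :=
          mul_le_mul_of_nonneg_right (norm_bdot_le _ _)
            (mul_nonneg (surfElt_nonneg _ _) (surfElt_nonneg _ _))
      _ = _ := by rw [absDensity, absDensity]; ring
  have h := norm_integral_kernel_sub_le hK₁ hK₂ hp hpab
    ((integrable_absDensity hF u.memLp_toFun l).const_mul 3)
    (integrable_absDensity hF v.memLp_toFun l') he
  simp only [← mul_assoc] at h
  refine h.trans ?_
  rw [integral_const_mul]
  have hu := integral_absDensity_toFun_le hF u l
  have hv := integral_absDensity_toFun_le hF v l'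
  have hv0 : 0 ≤ ∫ s in unitSquare, absDensity F l' v.toFun s :=
    integral_nonneg fun s => absDensity_nonneg l' _ s
  have hS := Real.mul_self_sqrt (measureReal_nonneg (μ := surfaceMeasure F) (s := univ))
  set S := Real.sqrt ((surfaceMeasure F).real univ)
  calc _ ≤ e * (3 * (S * u.norm)) * (S * v.norm) := by
        have := u.norm_nonneg
        gcongr
    _ = 3 * e * (S * S) * u.norm * v.norm := by ring
    _ = _ := by rw [hS]

lemma norm_chargeBlock_sub_le (hF : IsMultipatchBoundary F Ω) {j : ℕ} (l l' : Cluster N j)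
    (u v : HDiv F) {K₁ K₂ : R2 → R2 → ℂ} {e : ℝ} (he0 : 0 ≤ e)
    (hK₁ : ContinuousOn (fun z : R2 × R2 => K₁ z.1 z.2) (unitSquare ×ˢ unitSquare))
    (hK₂ : ContinuousOn (fun z : R2 × R2 => K₂ z.1 z.2) (unitSquare ×ˢ unitSquare))
    (he : ∀ s ∈ unitSquare, ∀ t ∈ unitSquare, ‖K₁ s t - K₂ s t‖ ≤ e) :
    ‖chargeBlock K₁ l l' u v - chargeBlock K₂ l l' u v‖ ≤
      e * (surfaceMeasure F).real univ * u.norm * v.norm := by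
  have hp : AEStronglyMeasurable (fun z : R2 × R2 =>
      (u.div (clusterMap F l z.1) * v.div (clusterMap F l' z.2)) *
        ((surfElt (clusterMap F l) z.1 * surfElt (clusterMap F l') z.2 : ℝ) : ℂ))
      (sqMeasure.prod sqMeasure) :=
    ((aestronglyMeasurable_comp_clusterMap hF u.memLp_div l).comp_fst.mul
      (aestronglyMeasurable_comp_clusterMap hF v.memLp_div l').comp_snd).mul
      (aestronglyMeasurable_surfElt_mul hF l l')
  have hpab : ∀ s ∈ unitSquare, ∀ t ∈ unitSquare,
      ‖(u.div (clusterMap F l s) * v.div (clusterMap F l' t)) *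
        ((surfElt (clusterMap F l) s * surfElt (clusterMap F l') t : ℝ) : ℂ)‖ ≤
      absDensity F l u.div s * absDensity F l' v.div t := by
    intro s _ t _
    rw [norm_mul, norm_mul, Complex.norm_real, Real.norm_of_nonneg
      (mul_nonneg (surfElt_nonneg _ _) (surfElt_nonneg _ _)), absDensity, absDensity]
    exact le_of_eq (by ring)
  have h := norm_integral_kernel_sub_le hK₁ hK₂ hp hpab
    (integrable_absDensity hF u.memLp_div l) (integrable_absDensity hF v.memLp_div l') he
  have hc : ∀ K : R2 → R2 → ℂ, chargeBlock K l l' u v = ∫ s in unitSquare, ∫ t in unitSquare,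
      K s t * ((u.div (clusterMap F l s) * v.div (clusterMap F l' t)) *
        ((surfElt (clusterMap F l) s * surfElt (clusterMap F l') t : ℝ) : ℂ)) := by
    intro K
    simp only [chargeBlock, mul_assoc]
  rw [hc, hc]
  refine h.trans ?_
  have hu := integral_absDensity_div_le hF u l
  have hv := integral_absDensity_div_le hF v l'
  have hv0 : 0 ≤ ∫ s in unitSquare, absDensity F l' v.div s :=
    integral_nonneg fun s => absDensity_nonneg l' _ s
  have hS := Real.mul_self_sqrt (measureReal_nonneg (μ := surfaceMeasure F) (s := univ))
  set S := Real.sqrt ((surfaceMeasure F).real univ)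
  calc _ ≤ e * ((S * u.norm) * (S * v.norm)) := by
        have := u.norm_nonneg
        gcongr
    _ = e * (S * S) * u.norm * v.norm := by ring
    _ = _ := by rw [hS]

end

/-! ### The kernels that include the geometry -/

/-- The first fundamental form of a parametrization. -/
def gram (f : R2 → R3) (s : R2) : Matrix (Fin 2) (Fin 2) ℝ :=
  Matrix.of fun α β => ⟪partialD f α s, partialD f β s⟫

/-- The transposed cofactor matrix of the first fundamental form. -/
def gramAdj (f : R2 → R3) (s : R2) : Matrix (Fin 2) (Fin 2) ℝ :=
  !![⟪partialD f 1 s, partialD f 1 s⟫, -⟪partialD f 0 s, partialD f 1 s⟫;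
    -⟪partialD f 0 s, partialD f 1 s⟫, ⟪partialD f 0 s, partialD f 0 s⟫]

lemma inner_eq_sum (a b : R3) : ⟪a, b⟫ = a 0 * b 0 + a 1 * b 1 + a 2 * b 2 := by
  rw [PiLp.inner_apply, Fin.sum_univ_three]
  simp only [RCLike.inner_apply, conj_trivial]
  ring

lemma normalVec_apply (f : R2 → R3) (s : R2) :
    normalVec f s 0 = partialD f 0 s 1 * partialD f 1 s 2 - partialD f 0 s 2 * partialD f 1 s 1 ∧
    normalVec f s 1 = partialD f 0 s 2 * partialD f 1 s 0 - partialD f 0 s 0 * partialD f 1 s 2 ∧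
    normalVec f s 2 = partialD f 0 s 0 * partialD f 1 s 1 - partialD f 0 s 1 * partialD f 1 s 0 := by
  simp [normalVec, cross_apply]

lemma surfElt_sq (f : R2 → R3) (s : R2) :
    surfElt f s ^ 2 = normalVec f s 0 ^ 2 + normalVec f s 1 ^ 2 + normalVec f s 2 ^ 2 := by
  rw [surfElt, EuclideanSpace.real_norm_sq_eq, Fin.sum_univ_three]

/-- By Lagrange's identity the Gram determinant is the squared length of the cross product, so
Cramer's rule has the squared surface element as denominator. -/
lemma gram_inv (f : R2 → R3) (s : R2) : (gram f s)⁻¹ = (surfElt f s ^ 2)⁻¹ • gramAdj f s := by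
  have hdet : (gram f s).det = surfElt f s ^ 2 := by
    obtain ⟨h0, h1, h2⟩ := normalVec_apply f s
    rw [surfElt_sq, h0, h1, h2, Matrix.det_fin_two]
    simp only [gram, Matrix.of_apply, inner_eq_sum]
    ring
  rw [Matrix.inv_def, hdet, Ring.inverse_eq_inv', Matrix.adjugate_fin_two]
  congr 1
  ext α β
  fin_cases α <;> fin_cases β <;> simp [gram, gramAdj, real_inner_comm]

lemma pullback_eq (f : R2 → R3) (w : R3 → C3) (s : R2) (α : Fin 2) :
    pullback f w s α = (surfElt f s : ℂ) * ∑ β, (((surfElt f s ^ 2)⁻¹ * gramAdj f s α β : ℝ) : ℂ) *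
      ∑ k, ((partialD f β s k : ℝ) : ℂ) * w (f s) k := by
  have h : ∀ β, (gram f s)⁻¹ α β = (surfElt f s ^ 2)⁻¹ * gramAdj f s α β := fun β => by
    rw [gram_inv]; rfl
  simp only [← h]
  rfl

/-- The pull-back of a tangential field recovers the field. -/
lemma sum_pullback_mul (f : R2 → R3) (w : R3 → C3) {s : R2} (hs : surfElt f s ≠ 0)
    (hw : ∑ k, ((normalVec f s k : ℝ) : ℂ) * w (f s) k = 0) (k : Fin 3) :
    ∑ α, pullback f w s α * ((partialD f α s k : ℝ) : ℂ) = (surfElt f s : ℂ) * w (f s) k := by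
  have hsq : ((surfElt f s : ℂ)) ^ 2 = ((normalVec f s 0 ^ 2 + normalVec f s 1 ^ 2 +
      normalVec f s 2 ^ 2 : ℝ) : ℂ) := by
    exact_mod_cast congrArg (fun r : ℝ => (r : ℂ)) (surfElt_sq f s)
  have hs' : (surfElt f s : ℂ) ≠ 0 := by exact_mod_cast hs
  obtain ⟨h0, h1, h2⟩ := normalVec_apply f s
  simp only [Fin.sum_univ_two, pullback_eq, gramAdj, inner_eq_sum]
  rw [Fin.sum_univ_three] at hw
  set τ : ℂ := (surfElt f s : ℂ) with hτ
  have hmul : ∀ X : ℂ, τ ^ 2 * X = τ ^ 2 * (w (f s) k) → X = w (f s) k := fun X hX =>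
    mul_left_cancel₀ (pow_ne_zero 2 hs') hX
  simp only [Matrix.of_apply, Matrix.cons_val', Matrix.cons_val_zero, Matrix.cons_val_one,
    Matrix.cons_val_fin_one]
  push_cast
  rw [← hτ]
  have hfac : ∀ p q r t x y c d : ℂ, τ * ((τ ^ 2)⁻¹ * p * x + (τ ^ 2)⁻¹ * q * y) * c +
      τ * ((τ ^ 2)⁻¹ * r * x + (τ ^ 2)⁻¹ * t * y) * d =
      τ * ((τ ^ 2)⁻¹ * ((p * x + q * y) * c + (r * x + t * y) * d)) := by
    intros; ring
  rw [hfac]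
  congr 1
  rw [inv_mul_eq_iff_eq_mul₀ (pow_ne_zero 2 hs'), hsq]
  rw [h0, h1, h2] at hw ⊢
  push_cast at hw ⊢
  simp only [Fin.sum_univ_three]
  set a := partialD f 0 s
  set b := partialD f 1 s
  -- For an arbitrary vector `w` with normal `n`, the left-hand side equals `|n|² w_k - n_k (n ⬝
  -- w)`; the coefficient `-n_k` of the tangency relation removes the normal part.
  fin_cases k
  · simp only [Fin.zero_eta]
    linear_combination (-((a 1 : ℂ) * b 2 - a 2 * b 1)) * hw
  · simp only [Fin.mk_one]
    linear_combination (-((a 2 : ℂ) * b 0 - a 0 * b 2)) * hw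
  · simp only [Fin.reduceFinMk]
    linear_combination (-((a 0 : ℂ) * b 1 - a 1 * b 0)) * hw

lemma abs_gramAdj_le {f : R2 → R3} {s : R2} {T : ℝ} (hT : ∀ α, ‖partialD f α s‖ ≤ T)
    (α β : Fin 2) : |gramAdj f s α β| ≤ T ^ 2 := by
  have h : ∀ α β, |⟪partialD f α s, partialD f β s⟫| ≤ T ^ 2 := fun α β =>
    (abs_real_inner_le_norm _ _).trans (by
      rw [sq]; exact mul_le_mul (hT α) (hT β) (norm_nonneg _) ((norm_nonneg _).trans (hT α)))
  fin_cases α <;> fin_cases β <;>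
    simp only [gramAdj, Fin.zero_eta, Fin.mk_one, Matrix.of_apply, Matrix.cons_val', Matrix.cons_val_zero,
      Matrix.cons_val_one, Matrix.cons_val_fin_one, abs_neg] <;>
    exact h _ _

/-- The constant collects two indices `β`, three components, `T² / τ²` from the inverse Gram matrix
and one more `T` from the tangent vector. -/
lemma norm_pullback_le {f : R2 → R3} {s : R2} {T τ : ℝ} (hT : ∀ α, ‖partialD f α s‖ ≤ T)
    (hτ : 0 < τ) (hτs : τ ≤ surfElt f s) (w : R3 → C3) (α : Fin 2) :
    ‖pullback f w s α‖ ≤ (6 * T ^ 3 / τ ^ 2) * (surfElt f s * ‖w (f s)‖) := by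
  have hT0 : 0 ≤ T := (norm_nonneg _).trans (hT 0)
  have h1 : ∀ β, ‖∑ k, ((partialD f β s k : ℝ) : ℂ) * w (f s) k‖ ≤ 3 * (T * ‖w (f s)‖) := by
    intro β
    calc _ ≤ ∑ _k : Fin 3, T * ‖w (f s)‖ := by
          refine (norm_sum_le _ _).trans (Finset.sum_le_sum fun k _ => ?_)
          rw [norm_mul, Complex.norm_real]
          gcongr
          · exact (PiLp.norm_apply_le _ k).trans (hT β)
          · exact PiLp.norm_apply_le (w (f s)) k
      _ = _ := by simp
  have h2 : ∀ β, ‖(((surfElt f s ^ 2)⁻¹ * gramAdj f s α β : ℝ) : ℂ)‖ ≤ (τ ^ 2)⁻¹ * T ^ 2 := by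
    intro β
    rw [Complex.norm_real, Real.norm_eq_abs, abs_mul, abs_of_nonneg (by positivity)]
    gcongr
    exact abs_gramAdj_le hT α β
  rw [pullback_eq, norm_mul, Complex.norm_real, Real.norm_of_nonneg (surfElt_nonneg _ _)]
  have h3 : ‖∑ β, (((surfElt f s ^ 2)⁻¹ * gramAdj f s α β : ℝ) : ℂ) *
      ∑ k, ((partialD f β s k : ℝ) : ℂ) * w (f s) k‖ ≤
      ∑ _β : Fin 2, ((τ ^ 2)⁻¹ * T ^ 2) * (3 * (T * ‖w (f s)‖)) := by
    refine (norm_sum_le _ _).trans (Finset.sum_le_sum fun β _ => ?_)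
    rw [norm_mul]
    exact mul_le_mul (h2 β) (h1 β) (norm_nonneg _) (by positivity)
  calc _ ≤ surfElt f s * ∑ _β : Fin 2, ((τ ^ 2)⁻¹ * T ^ 2) * (3 * (T * ‖w (f s)‖)) :=
        mul_le_mul_of_nonneg_left h3 (surfElt_nonneg _ _)
    _ = _ := by simp; ring

section

variable {N : ℕ} {F : Fin N → R2 → R3} {Ω : Set R3}

lemma continuousOn_partialD_clusterMap (hF : IsMultipatchBoundary F Ω) {j : ℕ} (l : Cluster N j)
    (α : Fin 2) : ContinuousOn (partialD (clusterMap F l) α) unitSquare := by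
  have h : ContinuousOn (fun s => partialD (F l.1) α (subMap l s)) unitSquare :=
    (analyticOnNhd_partialD hF l.1 α).continuousOn.comp
      (continuous_subMap l).continuousOn fun _ hs => subMap_mem l hs
  exact (h.const_smul (((2 : ℝ) ^ j)⁻¹)).congr fun s hs => partialD_clusterMap hF l α hs

lemma aestronglyMeasurable_pullback (hF : IsMultipatchBoundary F Ω) (u : HDiv F) {j : ℕ}
    (l : Cluster N j) (α : Fin 2) :
    AEStronglyMeasurable (fun s => pullback (clusterMap F l) u.toFun s α) sqMeasure := by
  have hτ := continuousOn_surfElt_clusterMap hF l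
  have hin : ∀ α β, ContinuousOn (fun s => ⟪partialD (clusterMap F l) α s,
      partialD (clusterMap F l) β s⟫) unitSquare := fun α β =>
    (continuousOn_partialD_clusterMap hF l α).inner (continuousOn_partialD_clusterMap hF l β)
  have hadj : ∀ α β, ContinuousOn (fun s => gramAdj (clusterMap F l) s α β) unitSquare := by
    intro α β
    fin_cases α <;> fin_cases β
    exacts [hin 1 1, (hin 0 1).neg, (hin 0 1).neg, hin 0 0]
  have hcoef : ∀ β, ContinuousOn (fun s => (((surfElt (clusterMap F l) s ^ 2)⁻¹ *
      gramAdj (clusterMap F l) s α β : ℝ) : ℂ)) unitSquare := fun β =>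
    Complex.continuous_ofReal.comp_continuousOn (((hτ.pow 2).inv₀ fun s hs =>
      pow_ne_zero 2 (surfElt_clusterMap_pos hF l hs).ne').mul (hadj α β))
  have hpart : ∀ β k, ContinuousOn (fun s => ((partialD (clusterMap F l) β s k : ℝ) : ℂ))
      unitSquare := fun β k => Complex.continuous_ofReal.comp_continuousOn
    ((EuclideanSpace.proj (𝕜 := ℝ) k).continuous.comp_continuousOn
      (continuousOn_partialD_clusterMap hF l β))
  have hu : ∀ k : Fin 3, AEStronglyMeasurable (fun s => u.toFun (clusterMap F l s) k) sqMeasure :=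
    fun k => (EuclideanSpace.proj (𝕜 := ℂ) k).continuous.comp_aestronglyMeasurable
      (aestronglyMeasurable_comp_clusterMap hF u.memLp_toFun l)
  simp only [pullback_eq]
  refine ((Complex.continuous_ofReal.comp_continuousOn hτ).aestronglyMeasurable
    measurableSet_unitSquare).mul (Finset.aestronglyMeasurable_fun_sum _ fun β _ => ?_)
  refine ((hcoef β).aestronglyMeasurable measurableSet_unitSquare).mul
    (Finset.aestronglyMeasurable_fun_sum _ fun k _ => ?_)
  exact ((hpart β k).aestronglyMeasurable measurableSet_unitSquare).mul (hu k)

/-- The affine map onto the subsquare pulls null sets back to null sets, and the normal of the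
cluster map is a multiple of that of the patch. -/
lemma tangential_clusterMap (hF : IsMultipatchBoundary F Ω) (u : HDiv F) {j : ℕ}
    (l : Cluster N j) : ∀ᵐ s ∂sqMeasure,
      ∑ k, ((normalVec (clusterMap F l) s k : ℝ) : ℂ) * u.toFun (clusterMap F l s) k = 0 := by
  have hac : Measure.map (subMap l) sqMeasure ≪ sqMeasure := by
    rw [map_subMap_volume]
    exact (Measure.smul_absolutelyContinuous).trans
      (Measure.restrict_mono (cell_subset_unitSquare l) le_rfl).absolutelyContinuous
  have h := ae_of_ae_map (continuous_subMap l).aemeasurable (hac.ae_le (u.tangential l.1))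
  filter_upwards [h, ae_restrict_mem measurableSet_unitSquare] with s hs hsm
  rw [normalVec_clusterMap hF l hsm]
  have h2 : ∀ k, ((((((4 : ℝ) ^ j)⁻¹ • normalVec (F l.1) (subMap l s)) k : ℝ)) : ℂ) *
      u.toFun (clusterMap F l s) k = ((((4 : ℝ) ^ j)⁻¹ : ℝ) : ℂ) *
        (((normalVec (F l.1) (subMap l s) k : ℝ) : ℂ) * u.toFun (F l.1 (subMap l s)) k) := by
    intro k
    rw [PiLp.smul_apply, smul_eq_mul, Complex.ofReal_mul, mul_assoc]
    rfl
  rw [Finset.sum_congr rfl fun k _ => h2 k, ← Finset.mul_sum, hs, mul_zero]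

/-- The surface element is at least of order `4⁻ʲ` and enters squared in the denominator, which
gives `16ʲ`. The scaling of the tangent vectors, which would reduce this to `2ʲ`, is not exploited.
-/
lemma exists_pullback_bound (hF : IsMultipatchBoundary F Ω) :
    ∃ C, 0 ≤ C ∧ ∀ (j : ℕ) (l : Cluster N j) (w : R3 → C3) (α : Fin 2), ∀ s ∈ unitSquare,
      ‖pullback (clusterMap F l) w s α‖ ≤ C * 16 ^ j * absDensity F l w s := by
  obtain ⟨τ, hτ, hτb⟩ := exists_surfElt_lower_bound hF
  obtain ⟨T₀, hT₀, hT₀b⟩ := exists_forall_norm_le fun i => (analyticOnNhd_partialD hF i 0).continuousOn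
  obtain ⟨T₁, hT₁, hT₁b⟩ := exists_forall_norm_le fun i => (analyticOnNhd_partialD hF i 1).continuousOn
  set T := max T₀ T₁ with hT
  have hT0 : 0 ≤ T := hT₀.trans (le_max_left _ _)
  refine ⟨6 * T ^ 3 / τ ^ 2, by positivity, fun j l w α s hs => ?_⟩
  have hpb : ∀ α, ‖partialD (clusterMap F l) α s‖ ≤ T := by
    intro α
    rw [partialD_clusterMap hF l α hs, norm_smul, Real.norm_of_nonneg (by positivity)]
    have h1 : ‖partialD (F l.1) α (subMap l s)‖ ≤ T := by
      fin_cases α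
      · exact (hT₀b _ _ (subMap_mem l hs)).trans (le_max_left _ _)
      · exact (hT₁b _ _ (subMap_mem l hs)).trans (le_max_right _ _)
    calc _ ≤ 1 * T := by gcongr; exact inv_two_pow_le_one j
      _ = T := one_mul T
  have hτs : ((4 : ℝ) ^ j)⁻¹ * τ ≤ surfElt (clusterMap F l) s := by
    rw [surfElt_clusterMap hF l hs]
    gcongr
    exact hτb _ _ (subMap_mem l hs)
  refine (norm_pullback_le hpb (by positivity) hτs w α).trans (le_of_eq ?_)
  have h16 : (16 : ℝ) ^ j = 4 ^ j * 4 ^ j := by rw [← mul_pow]; norm_num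
  rw [absDensity, h16]
  field_simp

/-- The geometric kernels reproduce the block of the first summand. -/
lemma currentBlock_eq_sum (hF : IsMultipatchBoundary F Ω) (u v : HDiv F) {j : ℕ}
    (l l' : Cluster N j) {K : R2 → R2 → ℂ}
    (hint : ∀ α β, Integrable (fun z : R2 × R2 => K z.1 z.2 *
      ((⟪partialD (clusterMap F l) α z.1, partialD (clusterMap F l') β z.2⟫ : ℝ) : ℂ) *
      (pullback (clusterMap F l) u.toFun z.1 α * pullback (clusterMap F l') v.toFun z.2 β))
      (sqMeasure.prod sqMeasure)) :
    currentBlock K l l' u v = ∑ α : Fin 2, ∑ β : Fin 2, ∫ s in unitSquare, ∫ t in unitSquare,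
      K s t * ((⟪partialD (clusterMap F l) α s, partialD (clusterMap F l') β t⟫ : ℝ) : ℂ) *
      (pullback (clusterMap F l) u.toFun s α * pullback (clusterMap F l') v.toFun t β) := by
  have hsum : Integrable (fun z : R2 × R2 => ∑ α : Fin 2, ∑ β : Fin 2, K z.1 z.2 *
      ((⟪partialD (clusterMap F l) α z.1, partialD (clusterMap F l') β z.2⟫ : ℝ) : ℂ) *
      (pullback (clusterMap F l) u.toFun z.1 α * pullback (clusterMap F l') v.toFun z.2 β))
      (sqMeasure.prod sqMeasure) :=
    integrable_finsetSum _ fun α _ => integrable_finsetSum _ fun β _ => hint α β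
  have hae : (fun z : R2 × R2 => ∑ α : Fin 2, ∑ β : Fin 2, K z.1 z.2 *
      ((⟪partialD (clusterMap F l) α z.1, partialD (clusterMap F l') β z.2⟫ : ℝ) : ℂ) *
      (pullback (clusterMap F l) u.toFun z.1 α * pullback (clusterMap F l') v.toFun z.2 β))
      =ᵐ[sqMeasure.prod sqMeasure] fun z => K z.1 z.2 *
        bdot (u.toFun (clusterMap F l z.1)) (v.toFun (clusterMap F l' z.2)) *
        ((surfElt (clusterMap F l) z.1 * surfElt (clusterMap F l') z.2 : ℝ) : ℂ) := by
    filter_upwards [ae_mem_unitSquare_prod,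
      Measure.quasiMeasurePreserving_fst.ae (tangential_clusterMap hF u l),
      Measure.quasiMeasurePreserving_snd.ae (tangential_clusterMap hF v l')] with z hz h1 h2
    have hu := sum_pullback_mul (clusterMap F l) u.toFun (surfElt_clusterMap_pos hF l hz.1).ne' h1
    have hv := sum_pullback_mul (clusterMap F l') v.toFun
      (surfElt_clusterMap_pos hF l' hz.2).ne' h2
    have hb : bdot (u.toFun (clusterMap F l z.1)) (v.toFun (clusterMap F l' z.2)) *
        ((surfElt (clusterMap F l) z.1 * surfElt (clusterMap F l') z.2 : ℝ) : ℂ) =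
        ∑ k, ((surfElt (clusterMap F l) z.1 : ℂ) * u.toFun (clusterMap F l z.1) k) *
          ((surfElt (clusterMap F l') z.2 : ℂ) * v.toFun (clusterMap F l' z.2) k) := by
      rw [bdot, Finset.sum_mul]
      refine Finset.sum_congr rfl fun k _ => ?_
      push_cast
      ring
    rw [mul_assoc, hb]
    simp only [← hu, ← hv, inner_eq_sum, Fin.sum_univ_two, Fin.sum_univ_three]
    push_cast
    ring
  have h1 : currentBlock K l l' u v = ∫ z, K z.1 z.2 *
        bdot (u.toFun (clusterMap F l z.1)) (v.toFun (clusterMap F l' z.2)) *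
        ((surfElt (clusterMap F l) z.1 * surfElt (clusterMap F l') z.2 : ℝ) : ℂ)
        ∂(sqMeasure.prod sqMeasure) := (integral_prod _ (hsum.congr hae)).symm
  rw [h1, ← integral_congr_ae hae, integral_finsetSum _ fun α _ =>
    integrable_finsetSum _ fun β _ => hint α β]
  refine Finset.sum_congr rfl fun α _ => ?_
  rw [integral_finsetSum _ fun β _ => hint α β]
  exact Finset.sum_congr rfl fun β _ => integral_prod _ (hint α β)

/-- The kernel of a block which includes the geometry. -/
def geoKernel {j : ℕ} (κ : ℝ) (F : Fin N → R2 → R3) (l l' : Cluster N j) (α β : Fin 2)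
    (s t : R2) : ℂ :=
  locKernel κ F l l' s t *
    ((⟪partialD (clusterMap F l) α s, partialD (clusterMap F l') β t⟫ : ℝ) : ℂ)

lemma continuousOn_geoKernel (hF : IsMultipatchBoundary F Ω) (κ : ℝ) {η : ℝ}
    (hη : η ∈ Ioo (0 : ℝ) 1) {j : ℕ} {l l' : Cluster N j} (h : Admissible F η l l')
    (α β : Fin 2) :
    ContinuousOn (fun z : R2 × R2 => geoKernel κ F l l' α β z.1 z.2)
      (unitSquare ×ˢ unitSquare) := by
  have h1 : ContinuousOn (fun z : R2 × R2 => partialD (clusterMap F l) α z.1)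
      (unitSquare ×ˢ unitSquare) :=
    (continuousOn_partialD_clusterMap hF l α).comp continuousOn_fst fun z hz => hz.1
  have h2 : ContinuousOn (fun z : R2 × R2 => partialD (clusterMap F l') β z.2)
      (unitSquare ×ˢ unitSquare) :=
    (continuousOn_partialD_clusterMap hF l' β).comp continuousOn_snd fun z hz => hz.2
  exact (continuousOn_locKernel hF κ hη h).mul
    (Complex.continuous_ofReal.comp_continuousOn (h1.inner h2))

/-- A double integral against the components of the pull-backs. -/
def pullbackIntegral {j : ℕ} (K : R2 → R2 → ℂ) (l l' : Cluster N j) (u v : HDiv F)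
    (α β : Fin 2) : ℂ :=
  ∫ s in unitSquare, ∫ t in unitSquare, K s t *
    (pullback (clusterMap F l) u.toFun s α * pullback (clusterMap F l') v.toFun t β)

lemma aestronglyMeasurable_pullback_mul (hF : IsMultipatchBoundary F Ω) {j : ℕ}
    (l l' : Cluster N j) (u v : HDiv F) (α β : Fin 2) :
    AEStronglyMeasurable (fun z : R2 × R2 =>
      pullback (clusterMap F l) u.toFun z.1 α * pullback (clusterMap F l') v.toFun z.2 β)
      (sqMeasure.prod sqMeasure) :=
  (aestronglyMeasurable_pullback hF u l α).comp_fst.mul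
    (aestronglyMeasurable_pullback hF v l' β).comp_snd

lemma norm_pullback_mul_le {C : ℝ} {j : ℕ}
    (hC : ∀ (l : Cluster N j) (w : R3 → C3) (α : Fin 2), ∀ s ∈ unitSquare,
      ‖pullback (clusterMap F l) w s α‖ ≤ C * absDensity F l w s)
    (l l' : Cluster N j) (u v : HDiv F) (α β : Fin 2) : ∀ s ∈ unitSquare, ∀ t ∈ unitSquare,
      ‖pullback (clusterMap F l) u.toFun s α * pullback (clusterMap F l') v.toFun t β‖ ≤
        (C * absDensity F l u.toFun s) * (C * absDensity F l' v.toFun t) := by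
  intro s hs t ht
  rw [norm_mul]
  have h1 := hC l u.toFun α s hs
  exact mul_le_mul h1 (hC l' v.toFun β t ht) (norm_nonneg _) ((norm_nonneg _).trans h1)

lemma norm_pullbackIntegral_sub_le (hF : IsMultipatchBoundary F Ω) {C : ℝ} (hC0 : 0 ≤ C) {j : ℕ}
    (hC : ∀ (l : Cluster N j) (w : R3 → C3) (α : Fin 2), ∀ s ∈ unitSquare,
      ‖pullback (clusterMap F l) w s α‖ ≤ C * absDensity F l w s)
    (l l' : Cluster N j) (u v : HDiv F) (α β : Fin 2) {K₁ K₂ : R2 → R2 → ℂ} {e : ℝ} (he0 : 0 ≤ e)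
    (hK₁ : ContinuousOn (fun z : R2 × R2 => K₁ z.1 z.2) (unitSquare ×ˢ unitSquare))
    (hK₂ : ContinuousOn (fun z : R2 × R2 => K₂ z.1 z.2) (unitSquare ×ˢ unitSquare))
    (he : ∀ s ∈ unitSquare, ∀ t ∈ unitSquare, ‖K₁ s t - K₂ s t‖ ≤ e) :
    ‖pullbackIntegral K₁ l l' u v α β - pullbackIntegral K₂ l l' u v α β‖ ≤
      C ^ 2 * (surfaceMeasure F).real univ * e * u.norm * v.norm := by
  have ha := (integrable_absDensity hF u.memLp_toFun l).const_mul C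
  have hb := (integrable_absDensity hF v.memLp_toFun l').const_mul C
  have h := norm_integral_kernel_sub_le hK₁ hK₂
    (aestronglyMeasurable_pullback_mul hF l l' u v α β) (norm_pullback_mul_le hC l l' u v α β)
    ha hb he
  refine h.trans ?_
  rw [integral_const_mul, integral_const_mul]
  have hu := integral_absDensity_toFun_le hF u l
  have hv := integral_absDensity_toFun_le hF v l'
  have hv0 : 0 ≤ ∫ s in unitSquare, absDensity F l' v.toFun s :=
    integral_nonneg fun s => absDensity_nonneg l' _ s
  have hS := Real.mul_self_sqrt (measureReal_nonneg (μ := surfaceMeasure F) (s := univ))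
  set S := Real.sqrt ((surfaceMeasure F).real univ)
  calc _ ≤ e * ((C * (S * u.norm)) * (C * (S * v.norm))) := by
        have := u.norm_nonneg
        gcongr
    _ = C ^ 2 * (S * S) * e * u.norm * v.norm := by ring
    _ = _ := by rw [hS]

/-- Tangency allows the exact block to be written with the same pull-backs as the compressed one, so
only four kernels are perturbed. Each of the two pull-backs loses `16ʲ`, together `256ʲ`. -/
lemma exists_currentBlockGeo_error (hF : IsMultipatchBoundary F Ω) (κ : ℝ) {η : ℝ}
    (hη : η ∈ Ioo (0 : ℝ) 1) :
    ∃ C, 0 ≤ C ∧ ∀ (j q : ℕ) (x : Fin (q + 1) → ℝ) (l l' : Cluster N j) (u v : HDiv F) (e : ℝ),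
      0 ≤ e → Admissible F η l l' →
      (∀ s ∈ unitSquare, ∀ t ∈ unitSquare, ∀ α β : Fin 2,
        ‖interp x (geoKernel κ F l l' α β) s t - geoKernel κ F l l' α β s t‖ ≤ e) →
      ‖currentBlockGeo κ x l l' u v - currentBlock (locKernel κ F l l') l l' u v‖ ≤
        C * 256 ^ j * e * u.norm * v.norm := by
  obtain ⟨C, hC, hCb⟩ := exists_pullback_bound hF
  refine ⟨4 * (C ^ 2 * (surfaceMeasure F).real univ), by positivity, ?_⟩
  intro j q x l l' u v e he0 hadm he
  have hK := continuousOn_geoKernel hF κ hη hadm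
  have h1 : currentBlock (locKernel κ F l l') l l' u v = ∑ α : Fin 2, ∑ β : Fin 2,
      pullbackIntegral (geoKernel κ F l l' α β) l l' u v α β :=
    currentBlock_eq_sum hF u v l l' fun α β =>
      integrable_kernel_mul (hK α β) (aestronglyMeasurable_pullback_mul hF l l' u v α β)
        (norm_pullback_mul_le (hCb j) l l' u v α β)
        ((integrable_absDensity hF u.memLp_toFun l).const_mul (C * 16 ^ j))
        ((integrable_absDensity hF v.memLp_toFun l').const_mul (C * 16 ^ j))
  have h2 : currentBlockGeo κ x l l' u v = ∑ α : Fin 2, ∑ β : Fin 2,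
      pullbackIntegral (interp x (geoKernel κ F l l' α β)) l l' u v α β := rfl
  rw [h1, h2]
  simp only [← Finset.sum_sub_distrib]
  have hterm : ∀ α β : Fin 2, ‖pullbackIntegral (interp x (geoKernel κ F l l' α β)) l l' u v α β -
      pullbackIntegral (geoKernel κ F l l' α β) l l' u v α β‖ ≤
      (C * 16 ^ j) ^ 2 * (surfaceMeasure F).real univ * e * u.norm * v.norm := fun α β =>
    norm_pullbackIntegral_sub_le hF (by positivity) (hCb j) l l' u v α β he0
      (continuous_interp x _).continuousOn (hK α β) fun s hs t ht => he s hs t ht α β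
  refine (norm_sum_le _ _).trans ((Finset.sum_le_sum fun α _ => (norm_sum_le _ _).trans
    (Finset.sum_le_sum fun β _ => hterm α β)).trans (le_of_eq ?_))
  have h256 : (256 : ℝ) ^ j = 16 ^ j * 16 ^ j := by rw [← mul_pow]; norm_num
  simp only [Finset.sum_const, Finset.card_univ, Fintype.card_fin, nsmul_eq_mul, h256]
  push_cast
  ring

end

/-! ### The error of the compressed forms -/

section

variable {N : ℕ} {F : Fin N → R2 → R3} {Ω : Set R3}

lemma norm_sub_mul_sub_sub_le {κ : ℝ} {a a' b b' : ℂ} {ea eb : ℝ} (ha : ‖a - a'‖ ≤ ea)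
    (hb : ‖b - b'‖ ≤ eb) :
    ‖(a - 1 / (κ : ℂ) ^ 2 * b) - (a' - 1 / (κ : ℂ) ^ 2 * b')‖ ≤ ea + 1 / κ ^ 2 * eb := by
  have h : (a - 1 / (κ : ℂ) ^ 2 * b) - (a' - 1 / (κ : ℂ) ^ 2 * b') =
      (a - a') - 1 / (κ : ℂ) ^ 2 * (b - b') := by ring
  have hκ : ‖1 / (κ : ℂ) ^ 2‖ = 1 / κ ^ 2 := by simp
  rw [h]
  refine (norm_sub_le _ _).trans (add_le_add ha ?_)
  rw [norm_mul, hκ]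
  gcongr

/-- Both variants of the compression change the contribution of an admissible block by an amount
that decreases exponentially in the degree. -/
lemma exists_block_error (hF : IsMultipatchBoundary F Ω) {κ η : ℝ} (hκ : 0 < κ)
    (hη : η ∈ Ioo (0 : ℝ) 1) :
    ∃ δ > 0, ∃ B, 0 ≤ B ∧ ∀ {q : ℕ} {x : Fin (q + 1) → ℝ}, Function.Injective x →
      (∀ k, x k ∈ Icc (0 : ℝ) 1) → ∀ Λ, 1 ≤ Λ →
      (∀ s ∈ Icc (0 : ℝ) 1, ∑ k, |lagr x k s| ≤ Λ) →
      ∀ (j : ℕ) (l l' : Cluster N j), Admissible F η l l' → ∀ u v : HDiv F,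
        ‖blockForm κ (interp x (locKernel κ F l l')) l l' u v -
            blockForm κ (locKernel κ F l l') l l' u v‖ ≤
          B * 512 ^ j * ((1 + δ)⁻¹ ^ q * Λ ^ 4 * (u.norm * v.norm)) ∧
        ‖(currentBlockGeo κ x l l' u v -
            1 / (κ : ℂ) ^ 2 * chargeBlock (interp x (locKernel κ F l l')) l l' u v) -
            blockForm κ (locKernel κ F l l') l l' u v‖ ≤
          B * 512 ^ j * ((1 + δ)⁻¹ ^ q * Λ ^ 4 * (u.norm * v.norm)) := by
  obtain ⟨δ, hδ, B, hB, h⟩ := exists_interp_error hF hκ hη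
  obtain ⟨C, hC, hCb⟩ := exists_currentBlockGeo_error hF κ hη
  set S := (surfaceMeasure F).real univ with hS
  have hS0 : 0 ≤ S := measureReal_nonneg
  -- One constant serves both variants: `3 S` and `C` bound the current blocks without and with the
  -- geometry, `S / κ²` the charge block.
  refine ⟨δ, hδ, B * (3 * S + C + 1 / κ ^ 2 * S), by positivity, ?_⟩
  intro q x hinj hmem Λ hΛ hleb j l l' hadm u v
  have hker := h hinj hmem Λ hΛ hleb j l l' hadm
  set e := B * 2 ^ j * (1 + δ)⁻¹ ^ q * Λ ^ 4 with he
  have he0 : 0 ≤ e := by positivity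
  have hu := u.norm_nonneg
  have hv := v.norm_nonneg
  have hcont := continuousOn_locKernel hF κ hη hadm
  have hcur := norm_currentBlock_sub_le hF l l' u v he0
    (continuous_interp x (locKernel κ F l l')).continuousOn hcont
    fun s hs t ht => (hker s hs t ht).1
  have hcha := norm_chargeBlock_sub_le hF l l' u v he0
    (continuous_interp x (locKernel κ F l l')).continuousOn hcont
    fun s hs t ht => (hker s hs t ht).1
  have hgeo := hCb j q x l l' u v e he0 hadm fun s hs t ht => (hker s hs t ht).2
  -- The kernel bound contributes `2ʲ`, the two pull-backs `256ʲ`.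
  have h512 : (512 : ℝ) ^ j = 2 ^ j * 256 ^ j := by rw [← mul_pow]; norm_num
  have h256 : (1 : ℝ) ≤ 256 ^ j := one_le_pow₀ (by norm_num)
  have key : ∀ a b : ℝ, a ≤ (3 * S + C) * 256 ^ j * e * (u.norm * v.norm) →
      b ≤ 256 ^ j * (e * S * (u.norm * v.norm)) → a + 1 / κ ^ 2 * b ≤
      B * (3 * S + C + 1 / κ ^ 2 * S) * 512 ^ j *
        ((1 + δ)⁻¹ ^ q * Λ ^ 4 * (u.norm * v.norm)) := by
    intro a b ha hb
    calc a + 1 / κ ^ 2 * b ≤ (3 * S + C) * 256 ^ j * e * (u.norm * v.norm) +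
          1 / κ ^ 2 * (256 ^ j * (e * S * (u.norm * v.norm))) := by gcongr
      _ = _ := by rw [h512, he]; ring
  have hb : e * S * u.norm * v.norm ≤ 256 ^ j * (e * S * (u.norm * v.norm)) := by
    rw [mul_assoc (e * S)]
    exact le_mul_of_one_le_left (by positivity) h256
  refine ⟨(norm_sub_mul_sub_sub_le hcur hcha).trans (key _ _ ?_ hb),
    (norm_sub_mul_sub_sub_le hgeo hcha).trans (key _ _ ?_ hb)⟩
  · calc 3 * e * S * u.norm * v.norm = (3 * S) * 1 * e * (u.norm * v.norm) := by ring
      _ ≤ (3 * S + C) * 256 ^ j * e * (u.norm * v.norm) := by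
        gcongr
        exact le_add_of_nonneg_right hC
  · calc C * 256 ^ j * e * u.norm * v.norm = C * 256 ^ j * e * (u.norm * v.norm) := by ring
      _ ≤ (3 * S + C) * 256 ^ j * e * (u.norm * v.norm) := by
        gcongr
        exact le_add_of_nonneg_left (by positivity)

/-! ### Counting the far-field blocks and choosing the degree -/

lemma IsFar.admissible {η : ℝ} : ∀ {j : ℕ} {l l' : Cluster N j}, IsFar F η j l l' →
    Admissible F η l l'
  | 0, _, _, h => h
  | _ + 1, _, _, h => h.1

lemma card_cluster (N j : ℕ) : Fintype.card (Cluster N j) = N * 4 ^ j := by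
  simp only [Cluster, Fintype.card_prod, Fintype.card_fin, Fintype.card_pi, Finset.prod_const,
    Finset.card_univ]
  rw [← pow_mul, mul_comm j 2, pow_mul]
  norm_num

/-- A bound for sums over the far-field, with a crude count of the blocks. -/
lemma norm_farSum_sub_le {η X : ℝ} (hX : 0 ≤ X) (m : ℕ)
    {f g : (j : ℕ) → Cluster N j → Cluster N j → ℂ}
    (h : ∀ j l l', Admissible F η l l' → ‖f j l l' - g j l l'‖ ≤ 512 ^ j * X) :
    ‖farSum F η m f - farSum F η m g‖ ≤ N ^ 2 * 16384 ^ m * X := by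
  classical
  have h1 : ∀ j ∈ Finset.range (m + 1), ‖(∑ l : Cluster N j, ∑ l' : Cluster N j,
      if IsFar F η j l l' then f j l l' else 0) - ∑ l : Cluster N j, ∑ l' : Cluster N j,
      if IsFar F η j l l' then g j l l' else 0‖ ≤ N ^ 2 * 8192 ^ m * X := by
    intro j hj
    have hterm : ∀ l l' : Cluster N j, ‖(if IsFar F η j l l' then f j l l' else 0) -
        if IsFar F η j l l' then g j l l' else 0‖ ≤ 512 ^ j * X := by
      intro l l'
      split_ifs with hfar
      · exact h j l l' hfar.admissible
      · simpa using by positivity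
    simp only [← Finset.sum_sub_distrib]
    refine (norm_sum_le _ _).trans ((Finset.sum_le_sum fun l _ => (norm_sum_le _ _).trans
      (Finset.sum_le_sum fun l' _ => hterm l l')).trans ?_)
    rw [Finset.sum_const, Finset.sum_const, Finset.card_univ, card_cluster, nsmul_eq_mul,
      nsmul_eq_mul]
    -- All pairs of clusters of level `j` are counted, `(N 4ʲ)²` of them, each with the loss `512ʲ`.
    have h2 : (8192 : ℝ) ^ j = 4 ^ j * 4 ^ j * 512 ^ j := by
      rw [← mul_pow, ← mul_pow]; norm_num
    push_cast
    calc (N * 4 ^ j : ℝ) * (N * 4 ^ j * (512 ^ j * X)) = N ^ 2 * 8192 ^ j * X := by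
          rw [h2]; ring
      _ ≤ N ^ 2 * 8192 ^ m * X := by
          gcongr
          · norm_num
          · exact Nat.lt_succ_iff.1 (Finset.mem_range.1 hj)
  unfold farSum
  rw [← Finset.sum_sub_distrib]
  refine (norm_sum_le _ _).trans ((Finset.sum_le_card_nsmul _ _ _ h1).trans ?_)
  rw [Finset.card_range, nsmul_eq_mul]
  -- The number of levels costs one more factor `2 ^ m`, so the total growth is `16384 ^ m = 2 ^ (14
  -- m)`; this is the origin of the `14` in the choice of the degree.
  have h3 : ((m + 1 : ℕ) : ℝ) ≤ 2 ^ m := by exact_mod_cast Nat.lt_two_pow_self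
  have h4 : (16384 : ℝ) ^ m = 2 ^ m * 8192 ^ m := by rw [← mul_pow]; norm_num
  calc ((m + 1 : ℕ) : ℝ) * (N ^ 2 * 8192 ^ m * X) ≤ 2 ^ m * (N ^ 2 * 8192 ^ m * X) := by gcongr
    _ = _ := by rw [h4]; ring

/-- The choice of the degree: exponential decay in the degree beats exponential growth in the
number of levels. -/
lemma inv_pow_mul_pow_le {r : ℝ} (hr : 1 < r) {σ : ℝ} (hσ : 0 < σ) {m q : ℕ}
    (hq : 14 * Real.log 2 / Real.log r * ((σ + 1) * m) ≤ q) :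
    r⁻¹ ^ q * 16384 ^ m ≤ (2 : ℝ) ^ (-(m * σ)) := by
  have hlr := Real.log_pos hr
  have hl2 := Real.log_pos one_lt_two
  have hr0 : 0 < r := one_pos.trans hr
  have h1 : r⁻¹ ^ q = Real.exp (-(q * Real.log r)) := by
    rw [Real.exp_neg, Real.exp_nat_mul, Real.exp_log hr0, inv_pow]
  have h2 : (16384 : ℝ) ^ m = Real.exp (14 * m * Real.log 2) := by
    rw [show (14 * m * Real.log 2 : ℝ) = m * ((14 : ℕ) * Real.log 2) by push_cast; ring,
      Real.exp_nat_mul, Real.exp_nat_mul, Real.exp_log two_pos]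
    norm_num
  rw [h1, h2, ← Real.exp_add, Real.rpow_def_of_pos two_pos]
  refine Real.exp_le_exp.2 ?_
  have h3 : 14 * Real.log 2 * ((σ + 1) * m) ≤ q * Real.log r := by
    rw [div_mul_eq_mul_div, div_le_iff₀ hlr] at hq
    exact hq
  -- The condition on `q` yields decay `2^(-14 (σ+1) m)`; after the growth `2^(14 m)` is paid for,
  -- `2^(-14 σ m)` remains, which is more than required.
  have h4 : 0 ≤ Real.log 2 * (m * σ) := by positivity
  linarith

/-- The error of the compressed bilinear forms. -/
theorem exists_compression_error (hF : IsMultipatchBoundary F Ω) {κ η : ℝ} (hκ : 0 < κ)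
    (hη : η ∈ Ioo (0 : ℝ) 1) {x : (q : ℕ) → Fin (q + 1) → ℝ} (hx : IsInterpolationFamily x) :
    ∃ c₀ : ℝ, 0 < c₀ ∧ ∃ C : ℝ, 0 < C ∧ ∀ σ : ℝ, 0 < σ → ∀ m q : ℕ,
      c₀ * ((σ + 1) * m) ≤ q → ∀ u v : HDiv F,
        ‖singleLayerForm κ u v - compressedForm κ η m (x q) u v‖ ≤
            C * (2 : ℝ) ^ (-(m * σ)) * u.norm * v.norm ∧
          ‖singleLayerForm κ u v - compressedFormGeo κ η m (x q) u v‖ ≤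
            C * (2 : ℝ) ^ (-(m * σ)) * u.norm * v.norm := by
  obtain ⟨δ, hδ, B, hB, hblock⟩ := exists_block_error hF hκ hη
  -- With Lebesgue constants bounded by a multiple of `ρ ^ q`, the factor `Λ⁴` consumes `ρ^(4q)`,
  -- half of the available decay `ρ^(-8q)`; the rate `ρ^(-4q)` is left.
  set ρ : ℝ := (1 + δ) ^ ((8 : ℕ) : ℝ)⁻¹ with hρ
  have hρ1 : 1 < ρ := Real.one_lt_rpow (by linarith) (by norm_num)
  have hρ0 : 0 < ρ := one_pos.trans hρ1
  have hρ8 : ρ ^ 8 = 1 + δ := Real.rpow_inv_natCast_pow (by linarith) (by norm_num)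
  have hρ4 : 1 < ρ ^ 4 := one_lt_pow₀ hρ1 (by norm_num)
  obtain ⟨A, hA⟩ := hx.lebesgue ρ hρ1
  set A' := max 1 A with hA'
  have hA1 : 1 ≤ A' := le_max_left _ _
  -- Both constants are fixed before `σ`, `m`, `q` and the fields; the `+ 1` makes the second one
  -- positive even when `N` or `B` vanishes.
  refine ⟨14 * Real.log 2 / Real.log (ρ ^ 4), div_pos (mul_pos (by norm_num)
    (Real.log_pos one_lt_two)) (Real.log_pos hρ4), B * A' ^ 4 * N ^ 2 + 1, by positivity, ?_⟩
  intro σ hσ m q hq u v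
  have hu := u.norm_nonneg
  have hv := v.norm_nonneg
  have hΛ1 : 1 ≤ A' * ρ ^ q := one_le_mul_of_one_le_of_one_le hA1 (one_le_pow₀ hρ1.le)
  have hleb : ∀ s ∈ Icc (0 : ℝ) 1, ∑ k, |lagr (x q) k s| ≤ A' * ρ ^ q := fun s hs =>
    (hA q s hs).trans (mul_le_mul_of_nonneg_right (le_max_right _ _) (by positivity))
  have hb := hblock (hx.injective q) (hx.mem q) _ hΛ1 hleb
  have hpow : (1 + δ)⁻¹ ^ q * (A' * ρ ^ q) ^ 4 = A' ^ 4 * (ρ ^ 4)⁻¹ ^ q := by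
    have h1 : (1 + δ)⁻¹ * ρ ^ 4 = (ρ ^ 4)⁻¹ := by
      rw [← hρ8]
      field_simp
    rw [← h1]
    ring
  rw [hpow] at hb
  set X := B * (A' ^ 4 * (ρ ^ 4)⁻¹ ^ q * (u.norm * v.norm)) with hX
  have hX0 : 0 ≤ X := by positivity
  have hfinal : N ^ 2 * 16384 ^ m * X ≤
      (B * A' ^ 4 * N ^ 2 + 1) * (2 : ℝ) ^ (-(m * σ)) * u.norm * v.norm := by
    have h1 := inv_pow_mul_pow_le hρ4 hσ hq
    calc N ^ 2 * 16384 ^ m * X = B * A' ^ 4 * N ^ 2 * ((ρ ^ 4)⁻¹ ^ q * 16384 ^ m) *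
          u.norm * v.norm := by rw [hX]; ring
      _ ≤ (B * A' ^ 4 * N ^ 2 + 1) * (2 : ℝ) ^ (-(m * σ)) * u.norm * v.norm := by
        gcongr
        exact le_add_of_nonneg_right zero_le_one
  have hX' : ∀ j : ℕ, B * 512 ^ j * (A' ^ 4 * (ρ ^ 4)⁻¹ ^ q * (u.norm * v.norm)) =
      512 ^ j * X := fun j => by rw [hX]; ring
  -- The exact form is split with the same finest level `m`, so the near-field sums are identical
  -- and cancel.
  rw [norm_sub_rev, norm_sub_rev (singleLayerForm κ u v), singleLayerForm_eq hF κ hη.1.le m,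
    compressedForm, compressedFormGeo, add_sub_add_right_eq_sub, add_sub_add_right_eq_sub]
  exact ⟨(norm_farSum_sub_le hX0 m fun j l l' hadm =>
      (hb j l l' hadm u v).1.trans_eq (hX' j)).trans hfinal,
    (norm_farSum_sub_le hX0 m fun j l l' hadm =>
      (hb j l l' hadm u v).2.trans_eq (hX' j)).trans hfinal⟩

end

end EFIE

end

theorem mainTheorem4 {N : ℕ} (F : Fin N → EFIE.R2 → EFIE.R3) (Ω : Set EFIE.R3)
    (hF : EFIE.IsMultipatchBoundary F Ω) (κ η : ℝ) (hκ : 0 < κ) (hη : η ∈ Set.Ioo (0 : ℝ) 1)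
    (x : (q : ℕ) → Fin (q + 1) → ℝ) (hx : EFIE.IsInterpolationFamily x) :
    ∃ c₀ : ℝ, 0 < c₀ ∧ ∃ C : ℝ, 0 < C ∧
      ∀ σ : ℝ, 0 < σ → ∀ m q : ℕ, 0 < q → c₀ * ((σ + 1) * m) ≤ q → ∀ u v : EFIE.HDiv F,
        ‖EFIE.singleLayerForm κ u v - EFIE.compressedForm κ η m (x q) u v‖ ≤
            C * (2 : ℝ) ^ (-(m * σ)) * u.norm * v.norm ∧
          ‖EFIE.singleLayerForm κ u v - EFIE.compressedFormGeo κ η m (x q) u v‖ ≤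
            C * (2 : ℝ) ^ (-(m * σ)) * u.norm * v.norm := by
  obtain ⟨c₀, hc₀, C, hC, h⟩ := EFIE.exists_compression_error hF hκ hη hx
  exact ⟨c₀, hc₀, C, hC, fun σ hσ m q _ hq u v => h σ hσ m q hq u v⟩
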